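/- **Setting.** Let $R>0$, $0<\beta$, $0<B$, $0<\alpha<1$, let $v\in C^2([0,R];[0,\infty))$ with $v'<0$ on $]0,R[$, and let $f(\rho)=\rho v(\rho)$ satisfy $f(0)=f(R)=0$ and $-B\le f''\le-\beta$ on $[0,R]$. Put $V=\max_{[0,R]}v$. For $u\in[0,V]$ let $F_\alpha(u)=\max_{0\le\rho\le\alpha R}\bigl(\alpha f(\rho/\alpha)-u\rho\bigr)$, and let $\check\rho_u$ and $\hat\rho_u$ be the minimum and the maximum of $\{\rho\in[0,R]: f(\rho)=F_\alpha(u)+u\rho\}$. **Grids.** Fix an integer $\nu\ge1$. Let $u_0=0$ and define $u_j\in[0,V]$ by $\hat\rho_{u_j}=\check\rho_{u_{j-1}}$ for $j\ge 1$; let $J$ be such that $V-u_{J+1}<2^{-\nu}$. For $0\le k<2^\nu$ let $u_{k,0}=k\,u_1 2^{-\nu}$ and $\hat\rho_{u_{k,i}}=\check\rho_{u_{k,i-1}}$ for $1\le i\le J$. The speed grid is $\mathcal U_\nu=\{u_{k,i}: 0\le k<2^\nu,\ 0\le i\le J\}\cup\{V\}$; the density grid is $\mathcal M_\nu=\{0\}\cup\{\check\rho_u,\hat\rho_u: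 u\in\mathcal U_\nu\}\cup\{\hat\rho_0+\ell(R-\hat\rho_0)2^{-\nu}: 1\le\ell\le2^\nu\}$. Let $\delta_u^\nu$ and $\delta_\rho^\nu$ be the smallest distances between consecutive points of $\mathcal U_\nu$ and of $\mathcal M_\nu$. **Approximate solutions.** Let $u_\nu:[0,\infty)\to\mathcal U_\nu$ be right continuous and piecewise constant with finitely many jumps, let $\rho_{0,\nu}:\mathbb R\to\mathcal M_\nu$ be right continuous and piecewise constant with finitely many jumps, and let $y_0\in\mathbb R$. For $l,r\in\mathcal M_\nu$ let $\mathcal R(l,r)(x/t)$ be the right-continuous Riemann solver for $\partial_t\rho+\partial_xf_\nu(\rho)=0$, where $f_\nu$ is the piecewise linear interpolation of $f$ on $\mathcal M_\nu$: one shock with the Rankine–Hugoniot speed if $l<r$, and a fan of rarefaction fronts joining consecutive grid points if $l>r$. The constrained solver $\mathcal R^u(l,r)$ is as follows: with $m=\mathcal R(l,r)(u)$, if $f(m)>F_\alpha(u)+um$ then $\mathcal R^u(l,r)(x/t)$ is $\mathcal R(l,\hat\rho_u)(x/t)$ for $x<ut$ and $\mathcal R(\check\rho_u,r)(x/t)$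 for $x\ge ut$, and the vehicle has speed $u$; otherwise $\mathcal R^u(l,r)=\mathcal R(l,r)$ and the vehicle has speed $\min\{u,v(r)\}$. The wave-front tracking approximation $(\rho_\nu,y_\nu,u_\nu)$ is obtained by solving, at $t=0$, the classical Riemann problem at every jump of $\rho_{0,\nu}$ away from $y_0$ and the constrained one (with $u=u_\nu(0)$) at $y_0$, letting the fronts and the vehicle travel along straight lines, and repeating this (with $u=u_\nu(\bar t)$ at the position of the vehicle) at each time $\bar t$ at which fronts of $\rho_\nu$ meet, a front meets the vehicle, or $u_\nu$ jumps. Suppose that it has been constructed in finitely many stages up to a time $T>0$. Several such events may happen at the same time. **Functional.** Let $$\Upsilon(t)=\mathrm{TV}(\rho_\nu(t,\cdot))+2R+\gamma(t)+\frac6\beta\,\mathrm{TV}(u_\nu;[t,\infty)),$$ where $\gamma(t)=-2(\hat\rho_{u_\nu(t)}-\check\rho_{u_\nu(t)})$ if $\rho_\nu(t,y_\nu(t)_-)=\hat\rho_{u_\nu(t)}$ and $\rho_\nu(t,y_\nu(t)_+)=\check\rho_{u_\nu(t)}$, and $\gamma(t)=0$ otherwise. Let $N(t)$ be the number of waves,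 i.e. of jumps of $\rho_\nu(t,\cdot)$. **Proposition.** Let $0<\bar t<T$ (in particular, $\bar t$ may be the time of any wave interaction or jump of $u_\nu$). Then $\Upsilon$ and $N$ are constant on some interval $]\bar t-\epsilon,\bar t[$ and on some interval $]\bar t,\bar t+\epsilon[$, and their values $\Upsilon(\bar t_\pm)$, $N(\bar t_\pm)$ there satisfy: either $$\Upsilon(\bar t_+)\le\Upsilon(\bar t_-)-\min\Bigl\{\delta_\rho^\nu,\frac{6\,\delta_u^\nu}{\beta}\Bigr\},$$ or $\Upsilon(\bar t_+)=\Upsilon(\bar t_-)$ and $N(\bar t_+)\le N(\bar t_-)$. -/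

import Mathlib

open Set Filter Topology

namespace MovingBottleneck

noncomputable section

/-! ## The flux and the reduced flux -/

/-- The flux `f(ρ) = ρ v(ρ)`. -/
def flux (v : ℝ → ℝ) (r : ℝ) : ℝ := r * v r

/-- Standing assumptions on the speed law `v : [0,R] → [0,∞)` and on `f(ρ) = ρ v(ρ)`. -/
structure FluxCondition (R β B : ℝ) (v : ℝ → ℝ) : Prop where
  R_pos : 0 < R
  beta_pos : 0 < β
  B_pos : 0 < B
  smooth : ContDiffOn ℝ 2 v (Icc 0 R)
  nonneg : ∀ r ∈ Icc 0 R, 0 ≤ v r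
  flux_zero : flux v 0 = 0
  flux_R : flux v R = 0
  concave_lower : ∀ r ∈ Icc 0 R, -B ≤ iteratedDerivWithin 2 (flux v) (Icc 0 R) r
  concave_upper : ∀ r ∈ Icc 0 R, iteratedDerivWithin 2 (flux v) (Icc 0 R) r ≤ -β
  deriv_neg : ∀ r ∈ Ioo 0 R, deriv v r < 0

/-- `V = max_{[0,R]} v`. -/
def maxSpeed (R : ℝ) (v : ℝ → ℝ) : ℝ := sSup (v '' Icc 0 R)

/-- `F_α(u)`, the maximum of `f_α(ρ) - u ρ`, where `f_α(ρ) = α f(ρ/α)` on `[0, αR]`. -/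
def capacity (R α : ℝ) (v : ℝ → ℝ) (u : ℝ) : ℝ :=
  sSup ((fun r => α * flux v (r / α) - u * r) '' Icc 0 (α * R))

/-- The set `I_u` of the densities in `[0,R]` at which the graph of `f` meets the line
`φ_u(ρ) = F_α(u) + u ρ` (the tangent to the graph of `f_α` with slope `u`). -/
def contactSet (R α : ℝ) (v : ℝ → ℝ) (u : ℝ) : Set ℝ :=
  {r | r ∈ Icc 0 R ∧ flux v r = capacity R α v u + u * r}

/-- `ρ̌_u = min I_u`. -/
def rhoCheck (R α : ℝ) (v : ℝ → ℝ) (u : ℝ) : ℝ := sInf (contactSet R α v u)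

/-- `ρ̂_u = max I_u`. -/
def rhoHat (R α : ℝ) (v : ℝ → ℝ) (u : ℝ) : ℝ := sSup (contactSet R α v u)

/-! ## The grids -/

/-- The (unique) speed `w ∈ [0,V]` with `ρ̂_w = ρ̌_u`. -/
def nextSpeed (R α : ℝ) (v : ℝ → ℝ) (u : ℝ) : ℝ :=
  sSup {w | w ∈ Icc 0 (maxSpeed R v) ∧ rhoHat R α v w = rhoCheck R α v u}

/-- The speed `u_{k,i}`: `u_{k,0} = k u_1 2^{-ν}`, where `u_1 = nextSpeed 0`, and
`ρ̂(u_{k,i}) = ρ̌(u_{k,i-1})`. For `k = 0` this is the sequence `u_i` that starts at `u_0 = 0`. -/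
def gridSpeed (R α : ℝ) (v : ℝ → ℝ) (ν k i : ℕ) : ℝ :=
  (nextSpeed R α v)^[i] ((k : ℝ) * nextSpeed R α v 0 / 2 ^ ν)

/-- The speed grid `U_ν ⊆ [0,V]`. -/
def speedGrid (R α : ℝ) (v : ℝ → ℝ) (ν J : ℕ) : Set ℝ :=
  {u | u = maxSpeed R v ∨ ∃ k i : ℕ, k < 2 ^ ν ∧ i ≤ J ∧ u = gridSpeed R α v ν k i}

/-- The density grid `M_ν ⊆ [0,R]`: `0`, all left and right densities `ρ̂_u`, `ρ̌_u` of the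
undercompressive shocks with `u ∈ U_ν`, and the points that divide `[ρ̂_0, R]` into `2^ν` equal
parts. -/
def densityGrid (R α : ℝ) (v : ℝ → ℝ) (ν J : ℕ) : Set ℝ :=
  {r | r = 0 ∨ (∃ u ∈ speedGrid R α v ν J, r = rhoCheck R α v u ∨ r = rhoHat R α v u) ∨
    ∃ l : ℕ, 1 ≤ l ∧ l ≤ 2 ^ ν ∧
      r = rhoHat R α v 0 + (l : ℝ) * (R - rhoHat R α v 0) / 2 ^ ν}

/-- The smallest distance between two points of a finite grid (which is attained at two
consecutive points). -/
def minGap (S : Set ℝ) : ℝ := sInf {d | ∃ a ∈ S, ∃ b ∈ S, a < b ∧ d = b - a}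

/-! ## Riemann solvers

The grid solvers below are those of the conservation law whose flux is the piecewise linear
interpolation of `f` at the points of the grid `M`, for data in `M`. This flux is concave and
agrees with `f` on `M`, and all the states that occur lie in `M`. -/

/-- Rankine-Hugoniot speed of a jump between the densities `p` and `q`. -/
def rhSpeed (f : ℝ → ℝ) (p q : ℝ) : ℝ := (f q - f p) / (q - p)

/-- The classical Riemann solver, as a right continuous function of `ξ = x / t`. If `l < r` the
solution is one shock. If `r ≤ l` it is a fan of rarefaction fronts, which join consecutive points
of the grid from `l` down to `r`: the state on the ray `ξ` is the lowest one such that all the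
fronts above it have speed at most `ξ`. -/
def classicalRiemann (M : Set ℝ) (f : ℝ → ℝ) (l r ξ : ℝ) : ℝ :=
  open Classical in
  if l < r then (if ξ < rhSpeed f l r then l else r)
  else sInf {p | p ∈ M ∧ r ≤ p ∧ p ≤ l ∧ ∀ q ∈ M, p < q → q ≤ l → rhSpeed f p q ≤ ξ}

/-- The classical solution violates the flux constraint along the ray `ξ = u`. -/
def ConstraintViolated (R α : ℝ) (v : ℝ → ℝ) (M : Set ℝ) (u l r : ℝ) : Prop :=
  capacity R α v u + u * classicalRiemann M (flux v) l r u
    < flux v (classicalRiemann M (flux v) l r u)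

/-- The constrained Riemann solver `R^u`, as a function of `ξ = x / t`. -/
def constrainedRiemann (R α : ℝ) (v : ℝ → ℝ) (M : Set ℝ) (u l r ξ : ℝ) : ℝ :=
  open Classical in
  if ConstraintViolated R α v M u l r then
    (if ξ < u then classicalRiemann M (flux v) l (rhoHat R α v u) ξ
      else classicalRiemann M (flux v) (rhoCheck R α v u) r ξ)
  else classicalRiemann M (flux v) l r ξ

/-- The speed of the vehicle in the solution of the constrained Riemann problem: `u` if the
constraint is enforced, and `ω(r;u) = min {u, v(r)}` otherwise. -/
def vehicleSpeed (R α : ℝ) (v : ℝ → ℝ) (M : Set ℝ) (u l r : ℝ) : ℝ :=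
  open Classical in
  if ConstraintViolated R α v M u l r then u else min u (v r)

/-! ## Wave-front tracking -/

/-- A control `u : [0,∞) → U` that is piecewise constant with finitely many jumps (for a finite
`U`), normalised to be right continuous. -/
structure IsStepControl (U : Set ℝ) (u : ℝ → ℝ) : Prop where
  mem : ∀ t, 0 ≤ t → u t ∈ U
  right_cont : ∀ t, 0 ≤ t → ContinuousWithinAt u (Ici t) t
  finite_jumps : {t | 0 < t ∧ ¬ ContinuousAt u t}.Finite

/-- The right continuous step function with jumps at `X 0 ≤ X 1 ≤ … ≤ X (n-1)` and values
`w 0, w 1, …, w n` from left to right. -/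
def stepProfile {n : ℕ} (X : Fin n → ℝ) (w : ℕ → ℝ) (x : ℝ) : ℝ :=
  w (Finset.univ.filter (fun j => X j ≤ x)).card

/-- One stage of the wave-front tracking algorithm on the time interval `[a,b]`. At time `a` all
Riemann problems are solved, the constrained one at the position of the vehicle and classical ones
elsewhere; the fronts that arise and the vehicle then move along straight lines, and in the open
interval `(a,b)` no two fronts meet, the vehicle meets no front (it may travel along one), and the
control does not jump. -/
structure IsStage (R α : ℝ) (v : ℝ → ℝ) (M : Set ℝ) (ρ : ℝ → ℝ → ℝ) (y u : ℝ → ℝ)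
    (a b : ℝ) : Prop where
  /-- `ρ` is piecewise constant with values in the grid and with finitely many straight fronts
  `t ↦ x j + s j * (t - a)`. -/
  fronts : ∃ (n : ℕ) (x s : Fin n → ℝ) (w : ℕ → ℝ),
    (∀ j ≤ n, w j ∈ M) ∧ (∀ j < n, w j ≠ w (j + 1)) ∧
    (∀ t ∈ Ioo a b, StrictMono fun j => x j + s j * (t - a)) ∧
    (∀ t ∈ Icc a b, ∀ z, ρ t z = stepProfile (fun j => x j + s j * (t - a)) w z) ∧
    (∀ j, (∀ t ∈ Ioo a b, x j + s j * (t - a) = y t) ∨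
      (∀ t ∈ Ioo a b, x j + s j * (t - a) ≠ y t))
  control_const : ∀ t ∈ Ico a b, u t = u a
  /-- Away from the vehicle, `ρ` starts as the solution of the classical Riemann problem. -/
  classical : ∀ x₀, x₀ ≠ y a → ∀ ξ, ∀ᶠ t in 𝓝[>] a, ρ t (x₀ + ξ * (t - a)) =
    classicalRiemann M (flux v)
      (Function.leftLim (ρ a) x₀) (Function.rightLim (ρ a) x₀) ξ
  /-- At the vehicle, `ρ` starts as the solution of the constrained Riemann problem. -/
  constrained : ∀ ξ, ∀ᶠ t in 𝓝[>] a, ρ t (y a + ξ * (t - a)) =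
    constrainedRiemann R α v M (u a)
      (Function.leftLim (ρ a) (y a)) (Function.rightLim (ρ a) (y a)) ξ
  vehicle : ∀ t ∈ Icc a b, y t = y a + (t - a) * vehicleSpeed R α v M (u a)
      (Function.leftLim (ρ a) (y a)) (Function.rightLim (ρ a) (y a))

/-- `(ρ, y)` is a wave-front tracking approximation with control `u` and density grid `M`,
constructed up to the time `T` in finitely many stages. The initial density `ρ 0` is an arbitrary
right continuous step function with values in `M` and finitely many jumps, and `y 0` is
arbitrary. -/
def IsWaveFrontTracking (R α : ℝ) (v : ℝ → ℝ) (M : Set ℝ) (T : ℝ)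
    (ρ : ℝ → ℝ → ℝ) (y u : ℝ → ℝ) : Prop :=
  ∃ (m : ℕ) (τ : Fin (m + 1) → ℝ), StrictMono τ ∧ τ 0 = 0 ∧ τ (Fin.last m) = T ∧
    ∀ i : Fin m, IsStage R α v M ρ y u (τ i.castSucc) (τ i.succ)

/-! ## The functional -/

/-- The undercompressive-shock term `γ(t)`. -/
def gammaTerm (R α : ℝ) (v : ℝ → ℝ) (ρ : ℝ → ℝ → ℝ) (y u : ℝ → ℝ) (t : ℝ) : ℝ :=
  open Classical in
  if Function.leftLim (ρ t) (y t) = rhoHat R α v (u t) ∧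
      Function.rightLim (ρ t) (y t) = rhoCheck R α v (u t) then
    -2 * (rhoHat R α v (u t) - rhoCheck R α v (u t))
  else 0

/-- The Glimm type functional
`Υ(t) = TV(ρ(t,·)) + 2R + γ(t) + (6/β) TV(u; [t,∞))`. -/
def glimm (R α β : ℝ) (v : ℝ → ℝ) (ρ : ℝ → ℝ → ℝ) (y u : ℝ → ℝ) (t : ℝ) : ℝ :=
  (eVariationOn (ρ t) univ).toReal + 2 * R + gammaTerm R α v ρ y u t
    + 6 / β * (eVariationOn u (Ici t)).toReal

/-- The number of waves at time `t`: the number of jumps of `ρ(t,·)`. -/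
def waveCount (ρ : ℝ → ℝ → ℝ) (t : ℝ) : ℕ := {x | ¬ ContinuousAt (ρ t) x}.ncard

end

end MovingBottleneck

open Set Filter Topology

namespace MovingBottleneck

/-! ### Strong concavity of the flux -/

section Flux

variable {R β B : ℝ} {v : ℝ → ℝ}

/-! Inside a stage nothing changes, so only the common end of two stages matters. There the change
of `Υ` and of `N` is a finite sum over the points where fronts end or start, the position of the
vehicle also carrying `γ`. Let `l`, `r` be the states on the two sides of such a point and `ρ̌`,
`ρ̂` the contact densities.

Without an undercompressive shock the outgoing variation is `|l - r|`, the least possible. If the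
incoming fronts go both up and down, at least one mesh size is lost. If all go up, they merge into
one shock. Falling fronts spread apart, so a falling group is a single rarefaction front, and it
stays single because it joins consecutive grid points (`classical_interaction`).

At an enforced shock, variation plus `γ` equals `|l - ρ̂| + |r - ρ̌| - (ρ̂ - ρ̌)`. A present shock
is hit without loss only by shocks, so `l ≤ ρ̂` and `ρ̌ ≤ r`, and the value is `r - l` whether or
not the undercompressive shock survives. Creating one costs variation, because the earlier traces at
the vehicle obeyed the constraint (`vehicle_interaction`).

When the control jumps, both contact densities move in the same direction, by at most `2/β` times
the jump (`rhoHat_sub_le`, `rhoCheck_sub_le`). The displayed value then grows by at most twice the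
larger displacement, while the control term releases at least three times it; the surplus is at
least `δ_ρ`. If there was no shock, nothing grows and the control term releases at least `6 δ_u / β`
(`vehicle_jump`).

The grid enters through two facts: contact densities are grid points, and one more grid point lies
strictly between them. Hence a fan cannot jump over the forbidden densities, and the constraint is
enforced exactly when `ρ̌ < l`, `r < ρ̂` and `ρ̌ < ρ̂` (`constraintViolated_iff`).
`IsStage.description` turns a stage into the finite chains of states on which all this is carried
out. -/

theorem FluxCondition.contDiffOn_flux (hF : FluxCondition R β B v) :
    ContDiffOn ℝ 2 (flux v) (Icc 0 R) :=
  contDiffOn_id.mul hF.smooth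

theorem FluxCondition.continuousOn_flux (hF : FluxCondition R β B v) :
    ContinuousOn (flux v) (Icc 0 R) :=
  hF.contDiffOn_flux.continuousOn

theorem FluxCondition.contDiffAt_flux (hF : FluxCondition R β B v) {r : ℝ} (hr : r ∈ Ioo 0 R) :
    ContDiffAt ℝ 2 (flux v) r :=
  hF.contDiffOn_flux.contDiffAt (Icc_mem_nhds hr.1 hr.2)

/-- Encodes the bound `f'' ≤ -β` without derivatives; the quadratic terms in the estimates of the
contact densities come from here. -/
theorem FluxCondition.concaveOn_add_sq (hF : FluxCondition R β B v) :
    ConcaveOn ℝ (Icc 0 R) fun x => flux v x + β / 2 * x ^ 2 := by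
  have hd : ∀ r ∈ Ioo (0 : ℝ) R,
      deriv (fun x => flux v x + β / 2 * x ^ 2) r = deriv (flux v) r + β * r := by
    intro r hr
    have h1 : HasDerivAt (flux v) (deriv (flux v) r) r :=
      ((hF.contDiffAt_flux hr).differentiableAt (by norm_num)).hasDerivAt
    have h2 : HasDerivAt (fun x : ℝ => β / 2 * x ^ 2) (β * r) r := by
      refine ((hasDerivAt_pow 2 r).const_mul (β / 2)).congr_deriv ?_
      norm_num
      ring
    exact (h1.add h2).deriv
  have hdd : ∀ r ∈ Ioo (0 : ℝ) R, HasDerivAt (deriv (flux v)) (deriv (deriv (flux v)) r) r := by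
    intro r hr
    have h : ContDiffOn ℝ 1 (deriv (flux v)) (Ioo 0 R) :=
      (hF.contDiffOn_flux.mono Ioo_subset_Icc_self).deriv_of_isOpen isOpen_Ioo (by norm_num)
    exact ((h.contDiffAt (Ioo_mem_nhds hr.1 hr.2)).differentiableAt (by norm_num)).hasDerivAt
  have hev : ∀ r ∈ Ioo (0 : ℝ) R, deriv (fun x => flux v x + β / 2 * x ^ 2) =ᶠ[𝓝 r]
      fun x => deriv (flux v) x + β * x := fun r hr =>
    Filter.eventually_of_mem (Ioo_mem_nhds hr.1 hr.2) hd
  have hdd' : ∀ r ∈ Ioo (0 : ℝ) R, HasDerivAt (deriv fun x => flux v x + β / 2 * x ^ 2)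
      (deriv (deriv (flux v)) r + β) r := by
    intro r hr
    refine HasDerivAt.congr_of_eventuallyEq ?_ (hev r hr)
    have := (hdd r hr).add ((hasDerivAt_id r).const_mul β)
    rw [mul_one] at this
    exact this
  refine concaveOn_of_deriv2_nonpos (convex_Icc 0 R) ?_ ?_ ?_ ?_
  · exact hF.continuousOn_flux.add (by fun_prop)
  · rw [interior_Icc]
    intro r hr
    exact (((hF.contDiffAt_flux hr).differentiableAt (by norm_num)).add
      (by fun_prop)).differentiableWithinAt
  · rw [interior_Icc]
    intro r hr
    exact (hdd' r hr).differentiableAt.differentiableWithinAt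
  · rw [interior_Icc]
    intro r hr
    have h := hF.concave_upper r (Ioo_subset_Icc_self hr)
    rw [iteratedDerivWithin_eq_iteratedDeriv (uniqueDiffOn_Icc hF.R_pos)
      (hF.contDiffAt_flux hr) (Ioo_subset_Icc_self hr), iteratedDeriv_succ, iteratedDeriv_one] at h
    simp only [Function.iterate_succ, Function.iterate_zero, Function.comp, id]
    rw [(hdd' r hr).deriv]
    linarith

theorem FluxCondition.strong_concave (hF : FluxCondition R β B v) {x y a b : ℝ}
    (hx : x ∈ Icc 0 R) (hy : y ∈ Icc 0 R) (ha : 0 ≤ a) (hb : 0 ≤ b) (hab : a + b = 1) :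
    a * flux v x + b * flux v y + β / 2 * (a * b * (x - y) ^ 2) ≤ flux v (a * x + b * y) := by
  have h := hF.concaveOn_add_sq.2 hx hy ha hb hab
  simp only [smul_eq_mul] at h
  obtain rfl : b = 1 - a := by linarith
  nlinarith [h]

theorem FluxCondition.strictConcaveOn_flux (hF : FluxCondition R β B v) :
    StrictConcaveOn ℝ (Icc 0 R) (flux v) := by
  refine ⟨convex_Icc 0 R, fun x hx y hy hxy a b ha hb hab => ?_⟩
  have h := hF.strong_concave hx hy ha.le hb.le hab
  have : 0 < β / 2 * (a * b * (x - y) ^ 2) := by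
    have := hF.beta_pos
    have := sub_ne_zero.2 hxy
    positivity
  simp only [smul_eq_mul]
  linarith

/-- The tangent at `q` to the concave function `f + β/2 ρ²` lies above its graph; completing the
square moves the quadratic term to the right. -/
theorem FluxCondition.exists_supergradient (hF : FluxCondition R β B v) {q : ℝ}
    (hq : q ∈ Ioo 0 R) :
    ∃ c, ∀ x ∈ Icc 0 R, flux v x ≤ flux v q + c * (x - q) - β / 2 * (x - q) ^ 2 := by
  set k := fun x => flux v x + β / 2 * x ^ 2 with hk
  have hd : DifferentiableAt ℝ k q :=
    ((hF.contDiffAt_flux hq).differentiableAt (by norm_num)).add (by fun_prop)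
  have hq' := Ioo_subset_Icc_self hq
  have key : ∀ x ∈ Icc 0 R, k x ≤ k q + deriv k q * (x - q) := by
    intro x hx
    rcases lt_trichotomy x q with h | rfl | h
    · have := hF.concaveOn_add_sq.le_slope_of_hasDerivAt hx hq' h hd.hasDerivAt
      rw [slope_def_field, le_div_iff₀ (by linarith)] at this
      simp only [hk] at this ⊢
      linarith
    · simp
    · have := hF.concaveOn_add_sq.slope_le_of_hasDerivAt hq' hx h hd.hasDerivAt
      rw [slope_def_field, div_le_iff₀ (by linarith)] at this
      simp only [hk] at this ⊢
      linarith
  refine ⟨deriv k q - β * q, fun x hx => ?_⟩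
  have := key x hx
  simp only [hk] at this ⊢
  nlinarith [this]

/-! ### The maximiser of `f(ρ) - u ρ` -/

/-- `s` maximises `f(ρ) - u ρ` on `[0,R]`, with the quadratic decay given by the uniform
concavity of `f`. -/
def IsStrongMax (R β : ℝ) (v : ℝ → ℝ) (u s : ℝ) : Prop :=
  s ∈ Icc 0 R ∧ ∀ x ∈ Icc 0 R, flux v x - u * x ≤ flux v s - u * s - β / 2 * (x - s) ^ 2

/-- Strong concavity on the segment from the maximiser `s` to `x`, at the point with weight `θ` on
`x`, gives after division by `θ` the decay with an extra factor `1 - θ`; then `θ → 0`. -/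
theorem FluxCondition.exists_isStrongMax (hF : FluxCondition R β B v) (u : ℝ) :
    ∃ s, IsStrongMax R β v u s := by
  have hc : ContinuousOn (fun x => flux v x - u * x) (Icc 0 R) :=
    hF.continuousOn_flux.sub (by fun_prop)
  obtain ⟨s, hs, hmax⟩ := isCompact_Icc.exists_isMaxOn (nonempty_Icc.2 hF.R_pos.le) hc
  refine ⟨s, hs, fun x hx => ?_⟩
  have key : ∀ θ ∈ Ioo (0 : ℝ) 1,
      flux v x - u * x - (flux v s - u * s) + β / 2 * ((1 - θ) * (x - s) ^ 2) ≤ 0 := by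
    intro θ hθ
    have h1 := hF.strong_concave hx hs hθ.1.le (by linarith [hθ.2] : (0 : ℝ) ≤ 1 - θ) (by ring)
    have hm : θ * x + (1 - θ) * s ∈ Icc 0 R :=
      (convex_Icc 0 R) hx hs hθ.1.le (by linarith [hθ.2] : (0 : ℝ) ≤ 1 - θ) (by ring)
    have h2 := hmax hm
    simp only [mem_ofPred_eq] at h2
    have h3 : θ * (flux v x - u * x - (flux v s - u * s) + β / 2 * ((1 - θ) * (x - s) ^ 2)) ≤ 0 := by
      nlinarith [h1, h2]
    by_contra hcon
    push Not at hcon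
    have := mul_pos hθ.1 hcon
    linarith
  have hlim : Tendsto (fun θ : ℝ =>
      flux v x - u * x - (flux v s - u * s) + β / 2 * ((1 - θ) * (x - s) ^ 2)) (𝓝[>] 0)
      (𝓝 (flux v x - u * x - (flux v s - u * s) + β / 2 * ((1 - 0) * (x - s) ^ 2))) := by
    apply Tendsto.mono_left _ nhdsWithin_le_nhds
    apply Continuous.tendsto
    fun_prop
  have := le_of_tendsto hlim (by
    filter_upwards [Ioo_mem_nhdsGT (zero_lt_one' ℝ)] with θ hθ using key θ hθ)
  linarith

theorem IsStrongMax.le {u s x : ℝ} (hβ : 0 < β) (h : IsStrongMax R β v u s) (hx : x ∈ Icc 0 R) :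
    flux v x - u * x ≤ flux v s - u * s := by
  have := h.2 x hx
  have : 0 ≤ β / 2 * (x - s) ^ 2 := by positivity
  linarith

/-- The graph of `f_α` is that of `f` scaled by `α`, so the maximum is reached at `α s` and scales
by `α`. -/
theorem capacity_eq {α u s : ℝ} (hβ : 0 < β) (hα : 0 < α) (h : IsStrongMax R β v u s) :
    capacity R α v u = α * (flux v s - u * s) := by
  have : IsGreatest ((fun r => α * flux v (r / α) - u * r) '' Icc 0 (α * R))
      (α * (flux v s - u * s)) := by
    constructor
    · refine ⟨α * s, ⟨mul_nonneg hα.le h.1.1, mul_le_mul_of_nonneg_left h.1.2 hα.le⟩, ?_⟩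
      simp only
      rw [mul_div_cancel_left₀ _ hα.ne']
      ring
    · rintro _ ⟨r, hr, rfl⟩
      have hr' : r / α ∈ Icc 0 R :=
        ⟨div_nonneg hr.1 hα.le, by rw [div_le_iff₀ hα]; linarith [hr.2]⟩
      have := mul_le_mul_of_nonneg_left (h.le hβ hr') hα.le
      simp only
      calc α * flux v (r / α) - u * r = α * (flux v (r / α) - u * (r / α)) := by
            field_simp
        _ ≤ _ := this
  exact this.csSup_eq

theorem FluxCondition.strictAntiOn (hF : FluxCondition R β B v) : StrictAntiOn v (Icc 0 R) :=
  strictAntiOn_of_deriv_neg (convex_Icc 0 R) hF.smooth.continuousOn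
    (by rw [interior_Icc]; exact hF.deriv_neg)

theorem FluxCondition.maxSpeed_eq (hF : FluxCondition R β B v) : maxSpeed R v = v 0 := by
  have h0 : (0 : ℝ) ∈ Icc 0 R := ⟨le_rfl, hF.R_pos.le⟩
  have : IsGreatest (v '' Icc 0 R) (v 0) := by
    refine ⟨⟨0, h0, rfl⟩, ?_⟩
    rintro _ ⟨r, hr, rfl⟩
    exact hF.strictAntiOn.antitoneOn h0 hr hr.1
  exact this.csSup_eq

theorem FluxCondition.maxSpeed_pos (hF : FluxCondition R β B v) : 0 < maxSpeed R v := by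
  have h0 : (0 : ℝ) ∈ Icc 0 R := ⟨le_rfl, hF.R_pos.le⟩
  have hR : R ∈ Icc 0 R := ⟨hF.R_pos.le, le_rfl⟩
  rw [hF.maxSpeed_eq]
  exact (hF.nonneg R hR).trans_lt (hF.strictAntiOn h0 hR hF.R_pos)

theorem IsStrongMax.nonneg {u s : ℝ} (hF : FluxCondition R β B v) (h : IsStrongMax R β v u s) :
    β / 2 * s ^ 2 ≤ flux v s - u * s := by
  have := h.2 0 ⟨le_rfl, hF.R_pos.le⟩
  rw [hF.flux_zero] at this
  nlinarith

/-- Since `v(0) = V > u`, the graph of `f` is strictly above the line of slope `u` through the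
origin at small positive densities. -/
theorem IsStrongMax.pos {u s : ℝ} (hF : FluxCondition R β B v) (h : IsStrongMax R β v u s)
    (hu : u < maxSpeed R v) : 0 < flux v s - u * s := by
  have h0 : (0 : ℝ) ∈ Icc 0 R := ⟨le_rfl, hF.R_pos.le⟩
  rw [hF.maxSpeed_eq] at hu
  have hc : ContinuousWithinAt v (Icc 0 R) 0 := hF.smooth.continuousOn 0 h0
  have hc' : Tendsto v (𝓝[>] 0) (𝓝 (v 0)) := by
    have := hc.mono (Ioc_subset_Icc_self)
    unfold ContinuousWithinAt at this
    rwa [nhdsWithin_Ioc_eq_nhdsGT hF.R_pos] at this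
  obtain ⟨x, hx, hxI⟩ := ((hc'.eventually (lt_mem_nhds hu)).and
    (Ioo_mem_nhdsGT hF.R_pos)).exists
  have h1 := h.le hF.beta_pos (Ioo_subset_Icc_self hxI)
  have h2 : 0 < x * (v x - u) := mul_pos hxI.1 (by linarith)
  simp only [flux] at h1 ⊢
  nlinarith

end Flux

/-! ### The contact densities -/

section Contact

variable {R β B α : ℝ} {v : ℝ → ℝ}

theorem FluxCondition.isCompact_contactSet (hF : FluxCondition R β B v) (α u : ℝ) :
    IsCompact (contactSet R α v u) := by
  have hc : ContinuousOn (fun x => flux v x - (capacity R α v u + u * x)) (Icc 0 R) :=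
    hF.continuousOn_flux.sub (by fun_prop)
  have : contactSet R α v u =
      Icc 0 R ∩ (fun x => flux v x - (capacity R α v u + u * x)) ⁻¹' {0} := by
    ext x
    simp [contactSet, sub_eq_zero]
  rw [this]
  exact isCompact_Icc.of_isClosed_subset
    (hc.preimage_isClosed_of_isClosed isClosed_Icc isClosed_singleton) inter_subset_left

/-- For `u < V` the contact densities lie on the two sides of the maximiser of `f(ρ) - u ρ`. -/
theorem contact_spec (hF : FluxCondition R β B v) (hα0 : 0 < α) (hα1 : α < 1) {u s : ℝ}
    (hu0 : 0 ≤ u) (hu : u < maxSpeed R v) (hs : IsStrongMax R β v u s) :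
    rhoCheck R α v u ∈ contactSet R α v u ∧ rhoHat R α v u ∈ contactSet R α v u ∧
      0 < rhoCheck R α v u ∧ rhoCheck R α v u < s ∧ s < rhoHat R α v u ∧ rhoHat R α v u < R := by
  have hcap := capacity_eq hF.beta_pos hα0 hs
  have hG := hs.pos hF hu
  have hcapG : capacity R α v u < flux v s - u * s := by rw [hcap]; nlinarith
  have hcap0 : 0 < capacity R α v u := by rw [hcap]; positivity
  have hc : ContinuousOn (fun x => flux v x - u * x) (Icc 0 R) :=
    hF.continuousOn_flux.sub (by fun_prop)
  have hbdd := (hF.isCompact_contactSet α u)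
  -- As `0 < α < 1`, the capacity lies strictly between `0` and the maximum of `f(ρ) - u ρ`. That
  -- function is `0` at `0` and `-u R ≤ 0` at `R`, so the level is attained on each side of `s`.
  obtain ⟨x, hx, hxe⟩ := intermediate_value_Icc hs.1.1
    (hc.mono (Icc_subset_Icc le_rfl hs.1.2))
    (show capacity R α v u ∈ _ from ⟨by simp [hF.flux_zero, hcap0.le], hcapG.le⟩)
  obtain ⟨z, hz, hze⟩ := intermediate_value_Icc' hs.1.2
    (hc.mono (Icc_subset_Icc hs.1.1 le_rfl))
    (show capacity R α v u ∈ _ from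
      ⟨by simp only [hF.flux_R]; nlinarith [hF.R_pos], hcapG.le⟩)
  simp only at hxe hze
  have hxm : x ∈ contactSet R α v u := ⟨⟨hx.1, hx.2.trans hs.1.2⟩, by linarith⟩
  have hzm : z ∈ contactSet R α v u := ⟨⟨hs.1.1.trans hz.1, hz.2⟩, by linarith⟩
  have hC : rhoCheck R α v u ∈ contactSet R α v u := hbdd.sInf_mem ⟨x, hxm⟩
  have hH : rhoHat R α v u ∈ contactSet R α v u := hbdd.sSup_mem ⟨x, hxm⟩
  have hCx : rhoCheck R α v u ≤ x := csInf_le hbdd.bddBelow hxm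
  have hHz : z ≤ rhoHat R α v u := le_csSup hbdd.bddAbove hzm
  have hxs : x ≠ s := by rintro rfl; linarith
  have hzs : z ≠ s := by rintro rfl; linarith
  refine ⟨hC, hH, ?_, hCx.trans_lt (lt_of_le_of_ne hx.2 hxs),
    (lt_of_le_of_ne hz.1 hzs.symm).trans_le hHz, ?_⟩
  · refine lt_of_le_of_ne hC.1.1 fun h => ?_
    have := hC.2
    rw [← h, hF.flux_zero] at this
    linarith
  · refine lt_of_le_of_ne hH.1.2 fun h => ?_
    have := hH.2
    rw [h, hF.flux_R] at this
    nlinarith [hF.R_pos]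

/-- The degenerate speed: `v(ρ) < V` for `ρ > 0`, so the line of slope `V` through the origin meets
the graph only at the origin and the undercompressive shock disappears. -/
theorem contactSet_maxSpeed (hF : FluxCondition R β B v) (hα0 : 0 < α) :
    capacity R α v (maxSpeed R v) = 0 ∧ contactSet R α v (maxSpeed R v) = {0} := by
  have h0 : (0 : ℝ) ∈ Icc 0 R := ⟨le_rfl, hF.R_pos.le⟩
  have hle : ∀ x ∈ Icc 0 R, x ≠ 0 → flux v x - maxSpeed R v * x < 0 := by
    intro x hx hx0
    have hx1 : 0 < x := lt_of_le_of_ne hx.1 hx0.symm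
    have := hF.strictAntiOn h0 hx hx1
    rw [hF.maxSpeed_eq]
    simp only [flux]
    nlinarith
  obtain ⟨s, hs⟩ := hF.exists_isStrongMax (maxSpeed R v)
  have h1 := hs.nonneg hF
  have hs0 : s = 0 := by
    by_contra h
    have := hle s hs.1 h
    have : 0 ≤ β / 2 * s ^ 2 := by have := hF.beta_pos; positivity
    linarith
  have hcap : capacity R α v (maxSpeed R v) = 0 := by
    rw [capacity_eq hF.beta_pos hα0 hs, hs0, hF.flux_zero]; simp
  refine ⟨hcap, ?_⟩
  ext x
  simp only [contactSet, hcap, mem_ofPred_eq, mem_singleton_iff]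
  constructor
  · rintro ⟨hx, hx'⟩
    by_contra h
    linarith [hle x hx h]
  · rintro rfl
    exact ⟨h0, by rw [hF.flux_zero]; ring⟩

theorem rhoCheck_maxSpeed (hF : FluxCondition R β B v) (hα0 : 0 < α) :
    rhoCheck R α v (maxSpeed R v) = 0 := by
  rw [rhoCheck, (contactSet_maxSpeed hF hα0).2, csInf_singleton]

theorem rhoHat_maxSpeed (hF : FluxCondition R β B v) (hα0 : 0 < α) :
    rhoHat R α v (maxSpeed R v) = 0 := by
  rw [rhoHat, (contactSet_maxSpeed hF hα0).2, csSup_singleton]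

theorem contact_mem (hF : FluxCondition R β B v) (hα0 : 0 < α) (hα1 : α < 1) {u : ℝ}
    (hu : u ∈ Icc 0 (maxSpeed R v)) :
    rhoCheck R α v u ∈ contactSet R α v u ∧ rhoHat R α v u ∈ contactSet R α v u := by
  rcases hu.2.eq_or_lt with rfl | h
  · rw [rhoCheck_maxSpeed hF hα0, rhoHat_maxSpeed hF hα0, (contactSet_maxSpeed hF hα0).2]
    simp
  · obtain ⟨s, hs⟩ := hF.exists_isStrongMax u
    have := contact_spec hF hα0 hα1 hu.1 h hs
    exact ⟨this.1, this.2.1⟩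

theorem rhoCheck_le_rhoHat (hF : FluxCondition R β B v) (hα0 : 0 < α) (hα1 : α < 1) {u : ℝ}
    (hu : u ∈ Icc 0 (maxSpeed R v)) : rhoCheck R α v u ≤ rhoHat R α v u :=
  csInf_le (hF.isCompact_contactSet α u).bddBelow (contact_mem hF hα0 hα1 hu).2

theorem capacity_nonneg (hF : FluxCondition R β B v) (hα0 : 0 < α) (u : ℝ) :
    0 ≤ capacity R α v u := by
  obtain ⟨s, hs⟩ := hF.exists_isStrongMax u
  rw [capacity_eq hF.beta_pos hα0 hs]
  have := hs.nonneg hF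
  have h2 : 0 ≤ β / 2 * s ^ 2 := by have := hF.beta_pos; positivity
  exact mul_nonneg hα0.le (by linarith)

/-- Three point form of strict concavity for `f(ρ) - u ρ`. -/
theorem FluxCondition.min_lt (hF : FluxCondition R β B v) {u c x y z : ℝ} (hx : x ∈ Icc 0 R)
    (hz : z ∈ Icc 0 R) (hxy : x < y) (hyz : y < z) (h1 : c ≤ flux v x - u * x)
    (h2 : c ≤ flux v z - u * z) : c < flux v y - u * y := by
  have h := hF.strictConcaveOn_flux.slope_anti_adjacent hx hz hxy hyz
  rw [div_lt_div_iff₀ (by linarith) (by linarith)] at h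
  nlinarith

/-- The constraint is violated exactly at the densities between the two contact densities. -/
theorem capacity_lt_iff (hF : FluxCondition R β B v) (hα0 : 0 < α) (hα1 : α < 1) {u x : ℝ}
    (hu : u ∈ Icc 0 (maxSpeed R v)) (hx : x ∈ Icc 0 R) :
    capacity R α v u + u * x < flux v x ↔ rhoCheck R α v u < x ∧ x < rhoHat R α v u := by
  obtain ⟨hC, hH⟩ := contact_mem hF hα0 hα1 hu
  have hbdd := hF.isCompact_contactSet α u
  constructor
  · intro h
    rcases hu.2.eq_or_lt with rfl | hlt
    · exfalso
      have h0 : (0 : ℝ) ∈ Icc 0 R := ⟨le_rfl, hF.R_pos.le⟩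
      have h1 := hF.strictAntiOn.antitoneOn h0 hx hx.1
      rw [(contactSet_maxSpeed hF hα0).1, hF.maxSpeed_eq] at h
      simp only [flux] at h
      nlinarith [hx.1]
    obtain ⟨s, hs⟩ := hF.exists_isStrongMax u
    obtain ⟨-, -, -, h3, h4, -⟩ := contact_spec hF hα0 hα1 hu.1 hlt hs
    have hch : rhoCheck R α v u < rhoHat R α v u := h3.trans h4
    constructor
    · by_contra hcon
      rcases (not_lt.1 hcon).eq_or_lt with h' | h'
      · rw [h'] at h; linarith [hC.2]
      · have := hF.min_lt (u := u) (c := capacity R α v u) hx hH.1 h' hch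
          (by linarith) (by linarith [hH.2])
        linarith [hC.2]
    · by_contra hcon
      rcases (not_lt.1 hcon).eq_or_lt with h' | h'
      · rw [← h'] at h; linarith [hH.2]
      · have := hF.min_lt (u := u) (c := capacity R α v u) hC.1 hx hch h'
          (by linarith [hC.2]) (by linarith)
        linarith [hH.2]
  · rintro ⟨h1, h2⟩
    have := hF.min_lt (u := u) (c := capacity R α v u) hC.1 hH.1 h1 h2
      (by linarith [hC.2]) (by linarith [hH.2])
    linarith

theorem IsStrongMax.mono {u w su sw : ℝ} (hβ : 0 < β) (hsu : IsStrongMax R β v u su)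
    (hsw : IsStrongMax R β v w sw) (huw : u < w) : sw ≤ su := by
  have h1 := hsu.le hβ hsw.1
  have h2 := hsw.le hβ hsu.1
  nlinarith

/-- The lines `φ_u` and `φ_w` support the graph of `f_α` at `α s_u` and `α s_w`, so they cross at or
to the left of `α s_u ≤ s_u < ρ̂_u`. Hence at `ρ̂_u` the graph of `f` is strictly below `φ_w`, which
is impossible between the contact densities of `w` or at `ρ̂_w`. -/
theorem rhoHat_strictAntiOn (hF : FluxCondition R β B v) (hα0 : 0 < α) (hα1 : α < 1) :
    StrictAntiOn (rhoHat R α v) (Icc 0 (maxSpeed R v)) := by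
  intro u hu w hw huw
  obtain ⟨su, hsu⟩ := hF.exists_isStrongMax u
  obtain ⟨sw, hsw⟩ := hF.exists_isStrongMax w
  have huV : u < maxSpeed R v := huw.trans_le hw.2
  obtain ⟨huC, huH, hu1, hu2, hu3, hu4⟩ := contact_spec hF hα0 hα1 hu.1 huV hsu
  rcases hw.2.eq_or_lt with rfl | hwV
  · rw [rhoHat_maxSpeed hF hα0]
    linarith
  obtain ⟨hwC, hwH, hw1, hw2, hw3, hw4⟩ := contact_spec hF hα0 hα1 hw.1 hwV hsw
  have hss := hsu.mono hF.beta_pos hsw huw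
  by_contra hcon
  push Not at hcon
  have h1 := capacity_eq hF.beta_pos hα0 hsu
  have h2 := capacity_eq hF.beta_pos hα0 hsw
  have h3 := hsw.le hF.beta_pos hsu.1
  have h4 := huH.2
  have h5 : ¬ (rhoHat R α v u < rhoHat R α v w) := by
    intro hlt
    have := (capacity_lt_iff hF hα0 hα1 hw huH.1).2 ⟨by linarith, hlt⟩
    have h6 : α * su ≤ su := by nlinarith [hsu.1.1]
    have : α * (flux v su - w * su) ≤ α * (flux v sw - w * sw) :=
      mul_le_mul_of_nonneg_left h3 hα0.le
    nlinarith
  have h6 : rhoHat R α v u = rhoHat R α v w := le_antisymm hcon (not_lt.1 h5)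
  have h7 := hwH.2
  rw [← h6] at h7
  have h8 : α * su ≤ su := by nlinarith [hsu.1.1]
  have : α * (flux v su - w * su) ≤ α * (flux v sw - w * sw) :=
    mul_le_mul_of_nonneg_left h3 hα0.le
  nlinarith

/-- Concavity and `f(0) = 0` put `f` above `f_α`; where `φ_u` touches the graph of `f_α`, namely at
`α s`, the graph of `f` is therefore not below `φ_u`. -/
theorem rhoCheck_le_mul (hF : FluxCondition R β B v) (hα0 : 0 < α) (hα1 : α < 1) {u s : ℝ}
    (hu : u ∈ Icc 0 (maxSpeed R v)) (hs : IsStrongMax R β v u s) :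
    rhoCheck R α v u ≤ α * s := by
  have h0 : (0 : ℝ) ∈ Icc 0 R := ⟨le_rfl, hF.R_pos.le⟩
  rcases hu.2.eq_or_lt with rfl | hV
  · rw [rhoCheck_maxSpeed hF hα0]
    exact mul_nonneg hα0.le hs.1.1
  obtain ⟨hC, hH, h1, h2, h3, h4⟩ := contact_spec hF hα0 hα1 hu.1 hV hs
  by_contra hcon
  push Not at hcon
  have hs0 : 0 < s := by linarith
  have hcap := capacity_eq hF.beta_pos hα0 hs
  have h5 := hF.strictConcaveOn_flux.2 h0 hs.1 hs0.ne (sub_pos.2 hα1) hα0 (by ring)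
  simp only [smul_eq_mul, hF.flux_zero] at h5
  rw [mul_zero, zero_add, zero_add] at h5
  have hm : α * s ∈ Icc 0 R := ⟨by positivity, by nlinarith [hs.1.2]⟩
  have := ((capacity_lt_iff hF hα0 hα1 hu hm).1 (by rw [hcap]; linarith)).1
  linarith

/-- The lines `φ_u` and `φ_w` cross at or to the right of `α s_w ≥ ρ̌_w`, so at `ρ̌_w` the graph is
not above `φ_u`, and `ρ̌_w` cannot exceed `ρ̌_u`. Equality would force `ρ̌_w = α s_w`, where `f` and
`f_α` would agree, against strict concavity. -/
theorem rhoCheck_strictAntiOn (hF : FluxCondition R β B v) (hα0 : 0 < α) (hα1 : α < 1) :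
    StrictAntiOn (rhoCheck R α v) (Icc 0 (maxSpeed R v)) := by
  intro u hu w hw huw
  obtain ⟨su, hsu⟩ := hF.exists_isStrongMax u
  obtain ⟨sw, hsw⟩ := hF.exists_isStrongMax w
  have huV : u < maxSpeed R v := huw.trans_le hw.2
  obtain ⟨huC, huH, hu1, hu2, hu3, hu4⟩ := contact_spec hF hα0 hα1 hu.1 huV hsu
  rcases hw.2.eq_or_lt with rfl | hwV
  · rw [rhoCheck_maxSpeed hF hα0]
    linarith
  obtain ⟨hwC, hwH, hw1, hw2, hw3, hw4⟩ := contact_spec hF hα0 hα1 hw.1 hwV hsw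
  have hq := rhoCheck_le_mul hF hα0 hα1 hw hsw
  have hhat := rhoHat_strictAntiOn hF hα0 hα1 hu hw huw
  have h1 := capacity_eq hF.beta_pos hα0 hsu
  have h2 := capacity_eq hF.beta_pos hα0 hsw
  have h3 := mul_le_mul_of_nonneg_left (hsu.le hF.beta_pos hsw.1) hα0.le
  have h4 := hwC.2
  rcases lt_trichotomy (rhoCheck R α v w) (rhoCheck R α v u) with h | h | h
  · exact h
  · exfalso
    have h0 : (0 : ℝ) ∈ Icc 0 R := ⟨le_rfl, hF.R_pos.le⟩
    have h5 := hF.strictConcaveOn_flux.2 h0 hsw.1 (by linarith) (sub_pos.2 hα1) hα0 (by ring)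
    simp only [smul_eq_mul, hF.flux_zero] at h5
    rw [mul_zero, zero_add, zero_add] at h5
    have hne : rhoCheck R α v w ≠ α * sw := by
      intro he
      rw [he] at h4
      linarith
    have hlt : rhoCheck R α v w < α * sw := lt_of_le_of_ne hq hne
    have h6 := huC.2
    rw [← h] at h6
    nlinarith
  · exfalso
    have := (capacity_lt_iff hF hα0 hα1 hu hwC.1).2 ⟨h, by linarith⟩
    nlinarith

end Contact

section Grid

variable {R β B α : ℝ} {v : ℝ → ℝ}

/-! ### Lipschitz dependence of the contact densities on the speed -/

theorem isStrongMax_maxSpeed (hF : FluxCondition R β B v) {s : ℝ}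
    (hs : IsStrongMax R β v (maxSpeed R v) s) : s = 0 := by
  have h0 : (0 : ℝ) ∈ Icc 0 R := ⟨le_rfl, hF.R_pos.le⟩
  have h1 := hs.nonneg hF
  have h2 := hF.strictAntiOn.antitoneOn h0 hs.1 hs.1.1
  rw [hF.maxSpeed_eq] at h1
  have h3 : flux v s - v 0 * s ≤ 0 := by
    simp only [flux]
    nlinarith [hs.1.1]
  have h4 : s ^ 2 ≤ 0 := by
    have := hF.beta_pos
    by_contra hcon
    push Not at hcon
    have : 0 < β / 2 * s ^ 2 := by positivity
    linarith
  exact pow_eq_zero_iff (two_ne_zero) |>.1 (le_antisymm h4 (sq_nonneg s))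

/-- Measures how transversally `φ_w` cuts the graph at `q = ρ̂_w`. From `s` to `q` the function
`f(ρ) - w ρ` drops by `(1 - α) G`, where `G` is its maximum. Strong concavity bounds this drop below
by `β/2 (q - s)²`, and by `(1 - α) β/2 s²` because `G ≥ β/2 s²`; the supergradient at `q` bounds it
above. -/
theorem exists_steep_supergradient (hF : FluxCondition R β B v) (hα0 : 0 < α) (hα1 : α < 1)
    {w s : ℝ} (hw : w ∈ Icc 0 (maxSpeed R v)) (hs : IsStrongMax R β v w s) :
    ∃ c, (∀ x ∈ Icc 0 R, flux v x ≤
      flux v (rhoHat R α v w) + c * (x - rhoHat R α v w) - β / 2 * (x - rhoHat R α v w) ^ 2) ∧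
      β * (rhoHat R α v w - s) ≤ w - c ∧ β * ((1 - α) * s) ≤ w - c := by
  have hβ := hF.beta_pos
  rcases hw.2.eq_or_lt with rfl | hV
  · have hs0 := isStrongMax_maxSpeed hF hs
    subst hs0
    rw [rhoHat_maxSpeed hF hα0]
    refine ⟨maxSpeed R v, fun x hx => ?_, by simp, by simp⟩
    have := hs.2 x hx
    nlinarith
  obtain ⟨-, hH, h1, h2, h3, h4⟩ := contact_spec hF hα0 hα1 hw.1 hV hs
  set q := rhoHat R α v w with hq
  obtain ⟨c, hc⟩ := hF.exists_supergradient (q := q) ⟨by linarith, h4⟩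
  have hfq := hH.2
  rw [capacity_eq hF.beta_pos hα0 hs] at hfq
  have e1 := hc s hs.1
  have e2 := hs.2 q hH.1
  have e3 := hs.nonneg hF
  set G := flux v s - w * s with hG
  have hb : 0 < q - s := by linarith
  have hdrop : (1 - α) * G ≤ (w - c) * (q - s) - β / 2 * (q - s) ^ 2 := by nlinarith
  have hdrop2 : β / 2 * (q - s) ^ 2 ≤ (1 - α) * G := by nlinarith
  have hP : β * (q - s) ≤ w - c := by
    have : β * (q - s) * (q - s) ≤ (w - c) * (q - s) := by nlinarith
    exact le_of_mul_le_mul_right this hb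
  have hP0 : 0 < w - c := lt_of_lt_of_le (by positivity) hP
  refine ⟨c, hc, hP, ?_⟩
  have hs0 : 0 ≤ s := hs.1.1
  have h5 : (1 - α) * (β / 2 * s ^ 2) ≤ (1 - α) * G :=
    mul_le_mul_of_nonneg_left e3 (by linarith)
  have h6 : β ^ 2 * ((1 - α) * s ^ 2) ≤ (w - c) ^ 2 := by
    have : 2 * β * ((1 - α) * (β / 2 * s ^ 2)) ≤
        2 * β * ((w - c) * (q - s) - β / 2 * (q - s) ^ 2) :=
      mul_le_mul_of_nonneg_left (h5.trans hdrop) (by positivity)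
    -- The maximum over `t` of `(w - c) t - β/2 t²` is `(w - c)² / (2β)`.
    nlinarith [sq_nonneg (w - c - β * (q - s))]
  have h7 : (β * ((1 - α) * s)) ^ 2 ≤ β ^ 2 * ((1 - α) * s ^ 2) := by
    have : (1 - α) ^ 2 ≤ 1 - α := by nlinarith
    have h8 : 0 ≤ β ^ 2 * s ^ 2 := by positivity
    nlinarith [mul_le_mul_of_nonneg_left this h8]
  exact le_of_sq_le_sq (h7.trans h6) hP0.le

/-- With `X = β (ρ̂_u - ρ̂_w)`, `D = w - u` and `W = w - c` for the steep supergradient `c`, the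
contact equations give `X (W - D) + X²/2 ≤ 2 D W`. This is `(X - 2D)(W + X/2) ≤ 0`, whence `X ≤ 2D`,
uniformly in `α` and down to the degenerate speed. -/
theorem rhoHat_sub_le (hF : FluxCondition R β B v) (hα0 : 0 < α) (hα1 : α < 1) {u w : ℝ}
    (hu : u ∈ Icc 0 (maxSpeed R v)) (hw : w ∈ Icc 0 (maxSpeed R v)) (huw : u < w) :
    β * (rhoHat R α v u - rhoHat R α v w) ≤ 2 * (w - u) := by
  have hβ := hF.beta_pos
  obtain ⟨su, hsu⟩ := hF.exists_isStrongMax u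
  obtain ⟨sw, hsw⟩ := hF.exists_isStrongMax w
  obtain ⟨c, hc, hP1, hP2⟩ := exists_steep_supergradient hF hα0 hα1 hw hsw
  have hlt := rhoHat_strictAntiOn hF hα0 hα1 hu hw huw
  have hp := (contact_mem hF hα0 hα1 hu).2
  have hq := (contact_mem hF hα0 hα1 hw).2
  set p := rhoHat R α v u
  set q := rhoHat R α v w
  have hp2 := hp.2
  have hq2 := hq.2
  rw [capacity_eq hF.beta_pos hα0 hsu] at hp2
  rw [capacity_eq hF.beta_pos hα0 hsw] at hq2
  have e1 := hc p hp.1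
  have e2 := mul_le_mul_of_nonneg_left (hsu.le hβ hsw.1) hα0.le
  have e3 : (p - q) * (w - c - (w - u)) + β / 2 * (p - q) ^ 2 ≤
      (w - u) * ((q - sw) + (1 - α) * sw) := by nlinarith
  have e4 : β * ((q - sw) + (1 - α) * sw) ≤ 2 * (w - c) := by linarith
  have hP0 : 0 ≤ w - c :=
    le_trans (mul_nonneg hβ.le (mul_nonneg (by linarith) hsw.1.1)) hP2
  by_contra hcon
  push Not at hcon
  have e5 := mul_le_mul_of_nonneg_left e3 hβ.le
  have e6 := mul_le_mul_of_nonneg_left e4 (sub_nonneg.2 huw.le)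
  set X := β * (p - q) with hX
  set D := w - u with hD
  have e7 : X * (w - c - D) + X ^ 2 / 2 ≤ 2 * D * (w - c) := by
    calc X * (w - c - D) + X ^ 2 / 2
        = β * ((p - q) * (w - c - D) + β / 2 * (p - q) ^ 2) := by rw [hX]; ring
      _ ≤ 2 * D * (w - c) := by linarith
  have hD0 : 0 < D := sub_pos.2 huw
  nlinarith [mul_nonneg (sub_nonneg.2 hcon.le) hP0, mul_pos (sub_pos.2 hcon) (by linarith : 0 < X)]

/-- The same factorisation as for the left density, now with the supergradient at `ρ̌_u` and `W = c
- u`. The steepness needed is only `β (s_u - ρ̌_u) ≤ c - u`. -/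
theorem rhoCheck_sub_le (hF : FluxCondition R β B v) (hα0 : 0 < α) (hα1 : α < 1) {u w : ℝ}
    (hu : u ∈ Icc 0 (maxSpeed R v)) (hw : w ∈ Icc 0 (maxSpeed R v)) (huw : u < w) :
    β * (rhoCheck R α v u - rhoCheck R α v w) ≤ 2 * (w - u) := by
  have hβ := hF.beta_pos
  obtain ⟨su, hsu⟩ := hF.exists_isStrongMax u
  obtain ⟨sw, hsw⟩ := hF.exists_isStrongMax w
  obtain ⟨-, -, h1, h2, h3, h4⟩ := contact_spec hF hα0 hα1 hu.1 (huw.trans_le hw.2) hsu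
  have hlt := rhoCheck_strictAntiOn hF hα0 hα1 hu hw huw
  have hp := (contact_mem hF hα0 hα1 hu).1
  have hq := (contact_mem hF hα0 hα1 hw).1
  set p := rhoCheck R α v u
  set q := rhoCheck R α v w
  obtain ⟨c, hc⟩ := hF.exists_supergradient (q := p) ⟨h1, by linarith⟩
  have hp2 := hp.2
  have hq2 := hq.2
  rw [capacity_eq hF.beta_pos hα0 hsu] at hp2
  rw [capacity_eq hF.beta_pos hα0 hsw] at hq2
  have e0 := hc su hsu.1
  have e0' := hsu.2 p hp.1
  have hP : β * (su - p) ≤ c - u := by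
    have : β * (su - p) * (su - p) ≤ (c - u) * (su - p) := by nlinarith
    exact le_of_mul_le_mul_right this (by linarith)
  have e1 := hc q hq.1
  have e2 := mul_le_mul_of_nonneg_left (hsw.le hβ hsu.1) hα0.le
  have e3 : (p - q) * (c - u - (w - u)) + β / 2 * (p - q) ^ 2 ≤ (w - u) * (su - p) := by
    have : α * su ≤ su := by nlinarith [hsu.1.1]
    nlinarith
  have hP0 : 0 ≤ c - u := le_trans (mul_nonneg hβ.le (by linarith)) hP
  by_contra hcon
  push Not at hcon
  have e5 := mul_le_mul_of_nonneg_left e3 hβ.le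
  have e6 := mul_le_mul_of_nonneg_left hP (sub_nonneg.2 huw.le)
  set X := β * (p - q) with hX
  set D := w - u with hD
  have hD0 : 0 < D := sub_pos.2 huw
  have e7 : X * (c - u - D) + X ^ 2 / 2 ≤ 2 * D * (c - u) := by
    calc X * (c - u - D) + X ^ 2 / 2
        = β * ((p - q) * (c - u - D) + β / 2 * (p - q) ^ 2) := by rw [hX]; ring
      _ ≤ 2 * D * (c - u) := by nlinarith
  nlinarith [mul_nonneg (sub_nonneg.2 hcon.le) hP0, mul_pos (sub_pos.2 hcon) (by linarith : 0 < X)]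

/-! ### The grids -/

theorem continuousOn_rhoHat (hF : FluxCondition R β B v) (hα0 : 0 < α) (hα1 : α < 1) :
    ContinuousOn (rhoHat R α v) (Icc 0 (maxSpeed R v)) := by
  have hβ := hF.beta_pos
  have : LipschitzOnWith (Real.toNNReal (2 / β)) (rhoHat R α v) (Icc 0 (maxSpeed R v)) := by
    refine LipschitzOnWith.of_dist_le_mul fun u hu w hw => ?_
    rw [Real.coe_toNNReal _ (by positivity), Real.dist_eq, Real.dist_eq]
    rcases lt_trichotomy u w with h | rfl | h
    · have h1 := rhoHat_sub_le hF hα0 hα1 hu hw h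
      have h2 := rhoHat_strictAntiOn hF hα0 hα1 hu hw h
      rw [abs_of_pos (sub_pos.2 h2), abs_of_neg (sub_neg.2 h), div_mul_eq_mul_div,
        le_div_iff₀ hβ]
      linarith
    · simp
    · have h1 := rhoHat_sub_le hF hα0 hα1 hw hu h
      have h2 := rhoHat_strictAntiOn hF hα0 hα1 hw hu h
      rw [abs_of_neg (sub_neg.2 h2), abs_of_pos (sub_pos.2 h), div_mul_eq_mul_div,
        le_div_iff₀ hβ]
      linarith
  exact this.continuousOn

/-- As the speed runs over `[0,V]`, the left density falls continuously and strictly from `ρ̂_0` to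
`0`, so it takes the value `ρ̌_u` exactly once and the supremum defining `nextSpeed` is over a
singleton. -/
theorem nextSpeed_spec (hF : FluxCondition R β B v) (hα0 : 0 < α) (hα1 : α < 1) {u : ℝ}
    (hu : u ∈ Icc 0 (maxSpeed R v)) :
    nextSpeed R α v u ∈ Icc 0 (maxSpeed R v) ∧
      rhoHat R α v (nextSpeed R α v u) = rhoCheck R α v u := by
  have hV := hF.maxSpeed_pos
  have h0 : (0 : ℝ) ∈ Icc 0 (maxSpeed R v) := ⟨le_rfl, hV.le⟩
  obtain ⟨w, hw, hwe⟩ := intermediate_value_Icc' hV.le (continuousOn_rhoHat hF hα0 hα1)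
    (show rhoCheck R α v u ∈ _ from
      ⟨by rw [rhoHat_maxSpeed hF hα0]; exact (contact_mem hF hα0 hα1 hu).1.1.1,
        (rhoCheck_le_rhoHat hF hα0 hα1 hu).trans
          ((rhoHat_strictAntiOn hF hα0 hα1).antitoneOn h0 hu hu.1)⟩)
  have : {x | x ∈ Icc 0 (maxSpeed R v) ∧ rhoHat R α v x = rhoCheck R α v u} = {w} := by
    ext x
    simp only [mem_ofPred_eq, mem_singleton_iff]
    constructor
    · rintro ⟨hx, hxe⟩
      exact (rhoHat_strictAntiOn hF hα0 hα1).injOn hx hw (hxe.trans hwe.symm)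
    · rintro rfl
      exact ⟨hw, hwe⟩
  have hn : nextSpeed R α v u = w := by rw [nextSpeed, this, csSup_singleton]
  rw [hn]
  exact ⟨hw, hwe⟩

theorem nextSpeed_strictMonoOn (hF : FluxCondition R β B v) (hα0 : 0 < α) (hα1 : α < 1) :
    StrictMonoOn (nextSpeed R α v) (Icc 0 (maxSpeed R v)) := by
  intro u hu w hw huw
  obtain ⟨h1, h2⟩ := nextSpeed_spec hF hα0 hα1 hu
  obtain ⟨h3, h4⟩ := nextSpeed_spec hF hα0 hα1 hw
  have h := rhoCheck_strictAntiOn hF hα0 hα1 hu hw huw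
  rw [← h2, ← h4] at h
  exact (rhoHat_strictAntiOn hF hα0 hα1).lt_iff_gt h3 h1 |>.1 h

theorem iterate_nextSpeed (hF : FluxCondition R β B v) (hα0 : 0 < α) (hα1 : α < 1) (i : ℕ) :
    MapsTo (nextSpeed R α v)^[i] (Icc 0 (maxSpeed R v)) (Icc 0 (maxSpeed R v)) ∧
      StrictMonoOn (nextSpeed R α v)^[i] (Icc 0 (maxSpeed R v)) := by
  have hm : MapsTo (nextSpeed R α v) (Icc 0 (maxSpeed R v)) (Icc 0 (maxSpeed R v)) :=
    fun u hu => (nextSpeed_spec hF hα0 hα1 hu).1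
  induction i with
  | zero => exact ⟨fun u hu => hu, fun u _ w _ h => h⟩
  | succ i ih =>
    refine ⟨hm.iterate _, ?_⟩
    rw [Function.iterate_succ']
    exact (nextSpeed_strictMonoOn hF hα0 hα1).comp ih.2 ih.1

theorem nextSpeed_zero_pos (hF : FluxCondition R β B v) (hα0 : 0 < α) (hα1 : α < 1) :
    0 < nextSpeed R α v 0 := by
  have hV := hF.maxSpeed_pos
  have h0 : (0 : ℝ) ∈ Icc 0 (maxSpeed R v) := ⟨le_rfl, hV.le⟩
  obtain ⟨h1, h2⟩ := nextSpeed_spec hF hα0 hα1 h0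
  refine lt_of_le_of_ne h1.1 fun h => ?_
  rw [← h] at h2
  obtain ⟨s, hs⟩ := hF.exists_isStrongMax 0
  obtain ⟨-, -, -, h3, h4, -⟩ := contact_spec hF hα0 hα1 le_rfl hV hs
  linarith

theorem gridSpeed_zero_mem (hF : FluxCondition R β B v) (hα0 : 0 < α) (hα1 : α < 1) {ν k : ℕ}
    (hk : k < 2 ^ ν) :
    (k : ℝ) * nextSpeed R α v 0 / 2 ^ ν ∈ Icc 0 (maxSpeed R v) ∧
      (k : ℝ) * nextSpeed R α v 0 / 2 ^ ν < nextSpeed R α v 0 := by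
  have h0 : (0 : ℝ) ∈ Icc 0 (maxSpeed R v) := ⟨le_rfl, hF.maxSpeed_pos.le⟩
  have h1 := (nextSpeed_spec hF hα0 hα1 h0).1
  have h2 := nextSpeed_zero_pos hF hα0 hα1
  have h3 : (k : ℝ) < 2 ^ ν := by exact_mod_cast hk
  have h4 : (k : ℝ) * nextSpeed R α v 0 / 2 ^ ν < nextSpeed R α v 0 := by
    rw [div_lt_iff₀ (by positivity)]
    nlinarith
  exact ⟨⟨by positivity, h4.le.trans h1.2⟩, h4⟩

theorem gridSpeed_mem (hF : FluxCondition R β B v) (hα0 : 0 < α) (hα1 : α < 1) {ν k : ℕ}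
    (hk : k < 2 ^ ν) (i : ℕ) : gridSpeed R α v ν k i ∈ Icc 0 (maxSpeed R v) :=
  (iterate_nextSpeed hF hα0 hα1 i).1 (gridSpeed_zero_mem hF hα0 hα1 hk).1

theorem speedGrid_subset (hF : FluxCondition R β B v) (hα0 : 0 < α) (hα1 : α < 1) {ν J : ℕ} :
    speedGrid R α v ν J ⊆ Icc 0 (maxSpeed R v) := by
  rintro u (rfl | ⟨k, i, hk, -, rfl⟩)
  · exact ⟨hF.maxSpeed_pos.le, le_rfl⟩
  · exact gridSpeed_mem hF hα0 hα1 hk i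

theorem finite_speedGrid (ν J : ℕ) : (speedGrid R α v ν J).Finite := by
  have : speedGrid R α v ν J ⊆ {maxSpeed R v} ∪
      (fun q : ℕ × ℕ => gridSpeed R α v ν q.1 q.2) '' (Iio (2 ^ ν) ×ˢ Iic J) := by
    rintro u (rfl | ⟨k, i, hk, hi, rfl⟩)
    · exact Or.inl rfl
    · exact Or.inr ⟨(k, i), ⟨hk, hi⟩, rfl⟩
  exact ((finite_singleton _).union (((finite_Iio _).prod (finite_Iic _)).image _)).subset this

theorem finite_densityGrid (ν J : ℕ) : (densityGrid R α v ν J).Finite := by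
  have : densityGrid R α v ν J ⊆ {0} ∪ (rhoCheck R α v '' speedGrid R α v ν J ∪
      (rhoHat R α v '' speedGrid R α v ν J ∪
        (fun l : ℕ => rhoHat R α v 0 + (l : ℝ) * (R - rhoHat R α v 0) / 2 ^ ν) ''
          Iic (2 ^ ν))) := by
    rintro r (rfl | ⟨u, hu, rfl | rfl⟩ | ⟨l, -, hl, rfl⟩)
    · exact Or.inl rfl
    · exact Or.inr (Or.inl ⟨u, hu, rfl⟩)
    · exact Or.inr (Or.inr (Or.inl ⟨u, hu, rfl⟩))
    · exact Or.inr (Or.inr (Or.inr ⟨l, hl, rfl⟩))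
  refine ((finite_singleton _).union ?_).subset this
  exact ((finite_speedGrid ν J).image _).union
    (((finite_speedGrid ν J).image _).union ((finite_Iic _).image _))

theorem densityGrid_subset (hF : FluxCondition R β B v) (hα0 : 0 < α) (hα1 : α < 1) {ν J : ℕ} :
    densityGrid R α v ν J ⊆ Icc 0 R := by
  rintro r (rfl | ⟨u, hu, h⟩ | ⟨l, -, hl, rfl⟩)
  · exact ⟨le_rfl, hF.R_pos.le⟩
  · have := contact_mem hF hα0 hα1 (speedGrid_subset hF hα0 hα1 hu)
    rcases h with rfl | rfl
    · exact this.1.1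
    · exact this.2.1
  · have h := (contact_mem hF hα0 hα1 (u := 0) ⟨le_rfl, hF.maxSpeed_pos.le⟩).2.1
    have hl' : (l : ℝ) ≤ 2 ^ ν := by exact_mod_cast hl
    have h1 : (l : ℝ) * (R - rhoHat R α v 0) / 2 ^ ν ≤ R - rhoHat R α v 0 := by
      rw [div_le_iff₀ (by positivity)]
      nlinarith [h.2]
    have h2 : 0 ≤ (l : ℝ) * (R - rhoHat R α v 0) / 2 ^ ν :=
      div_nonneg (mul_nonneg (Nat.cast_nonneg _) (by linarith [h.2])) (by positivity)
    exact ⟨by linarith [h.1], by linarith⟩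

/-- Some density of the grid lies strictly between the two states of an undercompressive
shock. -/
theorem exists_mem_densityGrid_between (hF : FluxCondition R β B v) (hα0 : 0 < α) (hα1 : α < 1)
    {ν J : ℕ} (hν : 1 ≤ ν) {u : ℝ} (hu : u ∈ speedGrid R α v ν J)
    (hne : rhoCheck R α v u < rhoHat R α v u) :
    ∃ m ∈ densityGrid R α v ν J, rhoCheck R α v u < m ∧ m < rhoHat R α v u := by
  rcases hu with rfl | ⟨k, i, hk, hi, rfl⟩
  · rw [rhoCheck_maxSpeed hF hα0, rhoHat_maxSpeed hF hα0] at hne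
    exact absurd hne (lt_irrefl _)
  have hV := hF.maxSpeed_pos
  have h0 : (0 : ℝ) ∈ Icc 0 (maxSpeed R v) := ⟨le_rfl, hV.le⟩
  have h1 : 1 < 2 ^ ν := Nat.one_lt_two_pow (by omega)
  have hn0 := nextSpeed_zero_pos hF hα0 hα1
  have hn0m := (nextSpeed_spec hF hα0 hα1 h0).1
  obtain ⟨him, his⟩ := iterate_nextSpeed hF hα0 hα1 i
  have hhat := rhoHat_strictAntiOn hF hα0 hα1
  have hcheck := rhoCheck_strictAntiOn hF hα0 hα1
  -- the left density of `u_{0,i+1}` is the right density of `u_{0,i}`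
  have hnext : rhoHat R α v ((nextSpeed R α v)^[i] (nextSpeed R α v 0)) =
      rhoCheck R α v (gridSpeed R α v ν 0 i) := by
    have h := (nextSpeed_spec hF hα0 hα1 (him h0)).2
    rw [← Function.iterate_succ_apply' (nextSpeed R α v) i 0, Function.iterate_succ_apply] at h
    rw [h, gridSpeed]
    simp
  have hlt : ∀ k' < 2 ^ ν, rhoCheck R α v (gridSpeed R α v ν 0 i) <
      rhoHat R α v (gridSpeed R α v ν k' i) := by
    intro k' hk'
    obtain ⟨h2, h3⟩ := gridSpeed_zero_mem hF hα0 hα1 hk'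
    rw [← hnext]
    exact hhat (him h2) (him hn0m) (his h2 hn0m h3)
  have hgrid : ∀ k' < 2 ^ ν, gridSpeed R α v ν k' i ∈ speedGrid R α v ν J :=
    fun k' hk' => Or.inr ⟨k', i, hk', hi, rfl⟩
  have hmono : ∀ k₁ < 2 ^ ν, ∀ k₂ < 2 ^ ν, k₁ < k₂ →
      gridSpeed R α v ν k₁ i < gridSpeed R α v ν k₂ i := by
    intro k₁ hk₁ k₂ hk₂ h
    refine his (gridSpeed_zero_mem hF hα0 hα1 hk₁).1 (gridSpeed_zero_mem hF hα0 hα1 hk₂).1 ?_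
    have : (k₁ : ℝ) < k₂ := by exact_mod_cast h
    gcongr
  -- For `k = 0` the left density of `u_{1,i}` lies in between; this is where `ν ≥ 1` enters. For `k
  -- > 0` it is the density `ρ̌(u_{0,i}) = ρ̂(u_{0,i+1})`.
  rcases Nat.eq_zero_or_pos k with rfl | hkpos
  · refine ⟨rhoHat R α v (gridSpeed R α v ν 1 i),
      Or.inr (Or.inl ⟨_, hgrid 1 h1, Or.inr rfl⟩), hlt 1 h1, ?_⟩
    exact hhat (gridSpeed_mem hF hα0 hα1 hk i) (gridSpeed_mem hF hα0 hα1 h1 i)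
      (hmono 0 hk 1 h1 one_pos)
  · have h2 : 0 < 2 ^ ν := by positivity
    refine ⟨rhoCheck R α v (gridSpeed R α v ν 0 i),
      Or.inr (Or.inl ⟨_, hgrid 0 h2, Or.inl rfl⟩), ?_, hlt k hk⟩
    exact hcheck (gridSpeed_mem hF hα0 hα1 h2 i) (gridSpeed_mem hF hα0 hα1 hk i)
      (hmono 0 h2 k hk hkpos)

theorem minGap_le {S : Set ℝ} {a b : ℝ} (ha : a ∈ S) (hb : b ∈ S) (hab : a ≠ b) :
    minGap S ≤ |b - a| := by
  have hbdd : BddBelow {d | ∃ a ∈ S, ∃ b ∈ S, a < b ∧ d = b - a} := by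
    refine ⟨0, ?_⟩
    rintro _ ⟨a, -, b, -, h, rfl⟩
    linarith
  rcases hab.lt_or_gt with h | h
  · rw [abs_of_pos (sub_pos.2 h)]
    exact csInf_le hbdd ⟨a, ha, b, hb, h, rfl⟩
  · rw [abs_of_neg (sub_neg.2 h), neg_sub]
    exact csInf_le hbdd ⟨b, hb, a, ha, h, rfl⟩

theorem minGap_nonneg (S : Set ℝ) : 0 ≤ minGap S := by
  refine Real.sInf_nonneg ?_
  rintro _ ⟨a, -, b, -, h, rfl⟩
  linarith

end Grid

section Riemann

variable {R β B α : ℝ} {v : ℝ → ℝ} {M : Set ℝ}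

/-! ### Rankine-Hugoniot speeds -/

theorem rhSpeed_comm (f : ℝ → ℝ) (p q : ℝ) : rhSpeed f p q = rhSpeed f q p := by
  rw [rhSpeed, rhSpeed, ← neg_sub, ← neg_sub p q, neg_div_neg_eq]

theorem rhSpeed_eq_iff {f : ℝ → ℝ} {p q u : ℝ} (h : p ≠ q) :
    rhSpeed f p q = u ↔ f q - u * q = f p - u * p := by
  rw [rhSpeed, div_eq_iff (sub_ne_zero.2 h.symm)]
  constructor <;> intro h <;> linarith

theorem rhSpeed_lt_iff {f : ℝ → ℝ} {p q u : ℝ} (h : p < q) :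
    rhSpeed f p q < u ↔ f q - u * q < f p - u * p := by
  rw [rhSpeed, div_lt_iff₀ (sub_pos.2 h)]
  constructor <;> intro h <;> linarith

theorem lt_rhSpeed_iff {f : ℝ → ℝ} {p q u : ℝ} (h : p < q) :
    u < rhSpeed f p q ↔ f p - u * p < f q - u * q := by
  rw [rhSpeed, lt_div_iff₀ (sub_pos.2 h)]
  constructor <;> intro h <;> linarith

/-- Along a descent through `z > y > x` the lower jump is the faster one, so falling jumps spread
apart. -/
theorem FluxCondition.rhSpeed_lt (hF : FluxCondition R β B v) {x y z : ℝ} (hx : x ∈ Icc 0 R)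
    (hz : z ∈ Icc 0 R) (hxy : x < y) (hyz : y < z) :
    rhSpeed (flux v) y z < rhSpeed (flux v) x z ∧
      rhSpeed (flux v) x z < rhSpeed (flux v) x y := by
  have h := (rhSpeed_eq_iff (f := flux v) (u := rhSpeed (flux v) x z) (hxy.trans hyz).ne).1 rfl
  have h2 := hF.min_lt (u := rhSpeed (flux v) x z) hx hz hxy hyz le_rfl h.ge
  rw [rhSpeed_lt_iff hyz, lt_rhSpeed_iff hxy]
  exact ⟨by linarith, h2⟩

/-! ### The classical Riemann solver -/

/-- `B < A` are consecutive points of the grid. -/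
def IsRarefactionFront (M : Set ℝ) (A B : ℝ) : Prop :=
  A ∈ M ∧ B ∈ M ∧ B < A ∧ ∀ q ∈ M, B < q → A ≤ q

/-- The states between `r` and `l` above which the fan has speed at most `ξ`. -/
def fanSet (M : Set ℝ) (f : ℝ → ℝ) (l r ξ : ℝ) : Set ℝ :=
  {p | p ∈ M ∧ r ≤ p ∧ p ≤ l ∧ ∀ q ∈ M, p < q → q ≤ l → rhSpeed f p q ≤ ξ}

theorem classicalRiemann_of_lt (f : ℝ → ℝ) {l r : ℝ} (h : l < r) (ξ : ℝ) :
    classicalRiemann M f l r ξ = if ξ < rhSpeed f l r then l else r := by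
  simp only [classicalRiemann, if_pos h]

theorem classicalRiemann_of_ge (f : ℝ → ℝ) {l r : ℝ} (h : r ≤ l) (ξ : ℝ) :
    classicalRiemann M f l r ξ = sInf (fanSet M f l r ξ) := by
  simp only [classicalRiemann, if_neg (not_lt.2 h), fanSet]

theorem finite_fanSet (hM : M.Finite) (f : ℝ → ℝ) (l r ξ : ℝ) : (fanSet M f l r ξ).Finite :=
  hM.subset fun _ h => h.1

theorem classicalRiemann_le (hM : M.Finite) {f : ℝ → ℝ} {l r ξ p : ℝ} (h : r ≤ l)
    (hp : p ∈ fanSet M f l r ξ) : classicalRiemann M f l r ξ ≤ p := by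
  rw [classicalRiemann_of_ge f h]
  exact csInf_le (finite_fanSet hM f l r ξ).bddBelow hp

theorem classicalRiemann_mem_fanSet (hM : M.Finite) (f : ℝ → ℝ) {l r : ℝ} (h : r ≤ l)
    (hl : l ∈ M) (ξ : ℝ) : classicalRiemann M f l r ξ ∈ fanSet M f l r ξ := by
  rw [classicalRiemann_of_ge f h]
  exact Nonempty.csInf_mem ⟨l, hl, h, le_rfl, fun q _ h1 h2 => absurd h1 (not_lt.2 h2)⟩
    (finite_fanSet hM f l r ξ)

theorem classicalRiemann_mem (hM : M.Finite) (f : ℝ → ℝ) {l r : ℝ} (hl : l ∈ M) (hr : r ∈ M)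
    (ξ : ℝ) : classicalRiemann M f l r ξ ∈ M := by
  rcases lt_or_ge l r with h | h
  · rw [classicalRiemann_of_lt f h]
    split_ifs
    exacts [hl, hr]
  · exact (classicalRiemann_mem_fanSet hM f h hl ξ).1

/-- The fronts of the classical solution: one shock, or fronts between consecutive grid points. -/
theorem classicalRiemann_jump (hF : FluxCondition R β B v) (hM : M.Finite)
    (hMR : M ⊆ Icc 0 R) {l r A C s : ℝ} (hl : l ∈ M)
    (hA : ∀ᶠ ξ in 𝓝[<] s, classicalRiemann M (flux v) l r ξ = A)
    (hC : classicalRiemann M (flux v) l r s = C) (hAC : A ≠ C) :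
    rhSpeed (flux v) A C = s ∧
      ((l < r ∧ A = l ∧ C = r) ∨ (r ≤ l ∧ IsRarefactionFront M A C)) := by
  have hlt : ∀ᶠ ξ in 𝓝[<] s, ξ < s := eventually_mem_nhdsWithin
  rcases lt_or_ge l r with h | h
  · simp only [classicalRiemann_of_lt _ h] at hA hC
    obtain ⟨ξ₀, h1, h2⟩ := (hA.and hlt).exists
    have hs : ¬ s < rhSpeed (flux v) l r := by
      intro hs
      rw [if_pos hs] at hC
      rw [if_pos (h2.trans hs)] at h1
      exact hAC (h1.symm.trans hC)
    rw [if_neg hs] at hC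
    have hle : s ≤ rhSpeed (flux v) l r := by
      by_contra hcon
      have : ∀ᶠ ξ in 𝓝[<] s, rhSpeed (flux v) l r < ξ :=
        (eventually_gt_nhds (not_le.1 hcon)).filter_mono nhdsWithin_le_nhds
      obtain ⟨ξ, h3, h4⟩ := (hA.and this).exists
      rw [if_neg (not_lt.2 h4.le)] at h3
      exact hAC (h3.symm.trans hC)
    have hAl : A = l := by
      rw [if_pos (h2.trans_le hle)] at h1
      exact h1.symm
    subst hAl hC
    exact ⟨le_antisymm (not_lt.1 hs) hle, Or.inl ⟨h, rfl, rfl⟩⟩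
  · have hmem := classicalRiemann_mem_fanSet hM (flux v) h hl
    have hCm := hmem s
    rw [hC] at hCm
    obtain ⟨ξ₀, h1, h2⟩ := (hA.and hlt).exists
    have hAm := hmem ξ₀
    rw [h1] at hAm
    have hCA : C < A := by
      refine lt_of_le_of_ne ?_ hAC.symm
      rw [← hC]
      exact classicalRiemann_le hM h
        ⟨hAm.1, hAm.2.1, hAm.2.2.1, fun q hq h3 h4 => (hAm.2.2.2 q hq h3 h4).trans h2.le⟩
    -- the next grid point above `C`
    have hne : (M ∩ Ioi C).Nonempty := ⟨A, hAm.1, hCA⟩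
    obtain ⟨q, ⟨hqM, hqC⟩, hqmin⟩ := exists_min_image (M ∩ Ioi C) id
      (hM.subset inter_subset_left) hne
    have hqC : C < q := hqC
    have hqA : q ≤ A := hqmin A ⟨hAm.1, hCA⟩
    have hqle : rhSpeed (flux v) C q ≤ s := hCm.2.2.2 q hqM hqC (hqA.trans hAm.2.2.1)
    have hmono : ∀ q' ∈ M, q < q' → rhSpeed (flux v) q q' < rhSpeed (flux v) C q' ∧
        rhSpeed (flux v) C q' < rhSpeed (flux v) C q := fun q' hq' h' =>
      hF.rhSpeed_lt (hMR hCm.1) (hMR hq') hqC h'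
    -- If the lowest front above `C` were slower than `s`, all chords from `C` upwards would be, and
    -- `C` would already be the state slightly before the ray `s`.
    have hqs : s ≤ rhSpeed (flux v) C q := by
      by_contra hcon
      have : ∀ᶠ ξ in 𝓝[<] s, rhSpeed (flux v) C q < ξ :=
        (eventually_gt_nhds (not_le.1 hcon)).filter_mono nhdsWithin_le_nhds
      obtain ⟨ξ, h3, h4⟩ := (hA.and this).exists
      have : classicalRiemann M (flux v) l r ξ ≤ C := by
        refine classicalRiemann_le hM h ⟨hCm.1, hCm.2.1, hCm.2.2.1, fun q' hq' h5 _ => ?_⟩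
        rcases (hqmin q' ⟨hq', h5⟩).eq_or_lt with h6 | h6
        · have h6 : q = q' := h6
          rw [← h6]; exact h4.le
        · exact ((hmono q' hq' h6).2.trans h4).le
      linarith
    -- The chords from `q` upwards are strictly slower than `s`, so slightly before `s` the state is
    -- at most `q`: a fan never crosses two grid intervals on one ray.
    have hAq : A = q := by
      have : ∀ᶠ ξ in 𝓝[<] s, ∀ q' ∈ M, q < q' → rhSpeed (flux v) q q' < ξ := by
        rw [eventually_all_finite hM]
        intro q' hq'
        by_cases h' : q < q'
        · have h6 := hmono q' hq' h'
          have : ∀ᶠ ξ in 𝓝[<] s, rhSpeed (flux v) q q' < ξ :=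
            (eventually_gt_nhds (by linarith)).filter_mono nhdsWithin_le_nhds
          filter_upwards [this] with ξ hξ _ using hξ
        · exact Eventually.of_forall fun ξ h'' => absurd h'' h'
      obtain ⟨ξ, h3, h4⟩ := (hA.and this).exists
      refine le_antisymm ?_ hqA
      rw [← h3]
      exact classicalRiemann_le hM h ⟨hqM, hCm.2.1.trans hqC.le, hqA.trans hAm.2.2.1,
        fun q' hq' h5 _ => (h4 q' hq' h5).le⟩
    subst hAq
    refine ⟨?_, Or.inr ⟨h, hAm.1, hCm.1, hCA, fun q hq h3 => hqmin q ⟨hq, h3⟩⟩⟩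
    rw [rhSpeed_comm]
    exact le_antisymm hqle hqs

/-! ### The constrained Riemann solver -/

/-- The facts on a control value `u` and its contact densities on which the analysis of the
constrained Riemann solver rests. -/
structure IsGridSpeed (R α : ℝ) (v : ℝ → ℝ) (M : Set ℝ) (u : ℝ) : Prop where
  mem : u ∈ Icc 0 (maxSpeed R v)
  capacity_nonneg : 0 ≤ capacity R α v u
  check_le_hat : rhoCheck R α v u ≤ rhoHat R α v u
  hat_eq_zero : rhoHat R α v u ≤ rhoCheck R α v u → rhoHat R α v u = 0
  check_mem : rhoCheck R α v u ∈ M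
  hat_mem : rhoHat R α v u ∈ M
  flux_check : flux v (rhoCheck R α v u) = capacity R α v u + u * rhoCheck R α v u
  flux_hat : flux v (rhoHat R α v u) = capacity R α v u + u * rhoHat R α v u
  capacity_lt_iff : ∀ x ∈ Icc 0 R, capacity R α v u + u * x < flux v x ↔
    rhoCheck R α v u < x ∧ x < rhoHat R α v u
  exists_between : rhoCheck R α v u < rhoHat R α v u →
    ∃ m ∈ M, rhoCheck R α v u < m ∧ m < rhoHat R α v u

theorem isGridSpeed (hF : FluxCondition R β B v) (hα0 : 0 < α) (hα1 : α < 1)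
    {ν J : ℕ} (hν : 1 ≤ ν) {u : ℝ} (hu : u ∈ speedGrid R α v ν J) :
    IsGridSpeed R α v (densityGrid R α v ν J) u :=
  have hu' := speedGrid_subset hF hα0 hα1 hu
  have hc := contact_mem hF hα0 hα1 hu'
  { mem := hu'
    capacity_nonneg := capacity_nonneg hF hα0 u
    check_le_hat := rhoCheck_le_rhoHat hF hα0 hα1 hu'
    hat_eq_zero := fun h => by
      rcases hu'.2.eq_or_lt with hV | hV
      · rw [hV, rhoHat_maxSpeed hF hα0]
      · obtain ⟨s, hs⟩ := hF.exists_isStrongMax u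
        obtain ⟨-, -, -, h1, h2, -⟩ := contact_spec hF hα0 hα1 hu'.1 hV hs
        linarith
    check_mem := Or.inr (Or.inl ⟨u, hu, Or.inl rfl⟩)
    hat_mem := Or.inr (Or.inl ⟨u, hu, Or.inr rfl⟩)
    flux_check := hc.1.2
    flux_hat := hc.2.2
    capacity_lt_iff := fun _ hx => capacity_lt_iff hF hα0 hα1 hu' hx
    exists_between := exists_mem_densityGrid_between hF hα0 hα1 hν hu }

/-- All waves from `ρ̌` to a state below `ρ̂` are strictly faster than `u`: a shock ends above the
line `φ_u`, and a fan descends where chords are steeper than `u`. So they leave the undercompressive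
shock on its right. -/
theorem classicalRiemann_apply_self_left (hF : FluxCondition R β B v) (hM : M.Finite)
    (hMR : M ⊆ Icc 0 R) {u r : ℝ} (hu : IsGridSpeed R α v M u) (hr : r ∈ M)
    (hr' : r < rhoHat R α v u) (hne : rhoCheck R α v u < rhoHat R α v u) :
    classicalRiemann M (flux v) (rhoCheck R α v u) r u = rhoCheck R α v u := by
  rcases lt_or_ge (rhoCheck R α v u) r with h | h
  · rw [classicalRiemann_of_lt _ h, if_pos]
    rw [lt_rhSpeed_iff h]
    have := (hu.capacity_lt_iff r (hMR hr)).2 ⟨h, hr'⟩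
    linarith [hu.flux_check]
  · have hm := classicalRiemann_mem_fanSet hM (flux v) h hu.check_mem u
    refine le_antisymm hm.2.2.1 (not_lt.1 fun hlt => ?_)
    have h1 := hm.2.2.2 _ hu.check_mem hlt le_rfl
    rw [← not_lt, lt_rhSpeed_iff hlt] at h1
    have h3 := hF.min_lt (u := u) (c := capacity R α v u) (hMR hm.1) (hMR hu.hat_mem) hlt hne
      (by linarith [hu.flux_check]) (by linarith [hu.flux_hat])
    linarith [hu.flux_check]

/-- The mirror image: waves from a state above `ρ̌` to `ρ̂` are strictly slower than `u`, so the
left trace along the ray `u` is `ρ̂`. -/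
theorem classicalRiemann_eventually_right (hF : FluxCondition R β B v) (hM : M.Finite)
    (hMR : M ⊆ Icc 0 R) {u l : ℝ} (hu : IsGridSpeed R α v M u) (hl : l ∈ M)
    (hl' : rhoCheck R α v u < l) (hne : rhoCheck R α v u < rhoHat R α v u) :
    ∀ᶠ ξ in 𝓝[<] u, classicalRiemann M (flux v) l (rhoHat R α v u) ξ = rhoHat R α v u := by
  rcases lt_or_ge l (rhoHat R α v u) with h | h
  · have hs : rhSpeed (flux v) l (rhoHat R α v u) < u := by
      rw [rhSpeed_lt_iff h]
      have := (hu.capacity_lt_iff l (hMR hl)).2 ⟨hl', h⟩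
      linarith [hu.flux_hat]
    have : ∀ᶠ ξ in 𝓝[<] u, rhSpeed (flux v) l (rhoHat R α v u) < ξ :=
      (eventually_gt_nhds hs).filter_mono nhdsWithin_le_nhds
    filter_upwards [this] with ξ hξ
    rw [classicalRiemann_of_lt _ h, if_neg (not_lt.2 hξ.le)]
  · have : ∀ᶠ ξ in 𝓝[<] u, ∀ q ∈ M, rhoHat R α v u < q →
        rhSpeed (flux v) (rhoHat R α v u) q < ξ := by
      rw [eventually_all_finite hM]
      intro q hq
      by_cases h' : rhoHat R α v u < q
      · have hs : rhSpeed (flux v) (rhoHat R α v u) q < u := by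
          rw [rhSpeed_lt_iff h']
          by_contra hcon
          have h3 := hF.min_lt (u := u) (c := capacity R α v u) (hMR hu.check_mem) (hMR hq) hne h'
            (by linarith [hu.flux_check]) (by linarith [hu.flux_hat])
          linarith [hu.flux_hat]
        have : ∀ᶠ ξ in 𝓝[<] u, rhSpeed (flux v) (rhoHat R α v u) q < ξ :=
          (eventually_gt_nhds hs).filter_mono nhdsWithin_le_nhds
        filter_upwards [this] with ξ hξ _ using hξ
      · exact Eventually.of_forall fun ξ h'' => absurd h'' h'
    filter_upwards [this] with ξ hξ
    exact le_antisymm (classicalRiemann_le hM h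
      ⟨hu.hat_mem, le_rfl, h, fun q hq h1 _ => (hξ q hq h1).le⟩)
      (classicalRiemann_mem_fanSet hM (flux v) h hl ξ).2.1

/-- The constraint is enforced exactly when the left state is above `ρ̌` and the right state below
`ρ̂`. -/
theorem constraintViolated_iff (hF : FluxCondition R β B v) (hM : M.Finite)
    (hMR : M ⊆ Icc 0 R) {u l r : ℝ} (hu : IsGridSpeed R α v M u) (hl : l ∈ M) (hr : r ∈ M) :
    ConstraintViolated R α v M u l r ↔
      rhoCheck R α v u < l ∧ r < rhoHat R α v u ∧ rhoCheck R α v u < rhoHat R α v u := by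
  set m := classicalRiemann M (flux v) l r u with hm
  have hmM : m ∈ M := classicalRiemann_mem hM _ hl hr u
  unfold ConstraintViolated
  rw [← hm, hu.capacity_lt_iff m (hMR hmM)]
  rcases lt_or_ge l r with h | h
  · have hm' := hm
    rw [classicalRiemann_of_lt _ h] at hm'
    split_ifs at hm' with hs
    · rw [lt_rhSpeed_iff h] at hs
      rw [hm']
      constructor
      · rintro ⟨h1, h2⟩
        have h3 := (hu.capacity_lt_iff l (hMR hl)).2 ⟨h1, h2⟩
        have h4 := (hu.capacity_lt_iff r (hMR hr)).1 (by linarith)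
        exact ⟨h1, h4.2, h1.trans h2⟩
      · rintro ⟨h1, h2, -⟩
        exact ⟨h1, h.trans h2⟩
    · rw [lt_rhSpeed_iff h] at hs
      rw [hm']
      constructor
      · rintro ⟨h1, h2⟩
        have h3 := (hu.capacity_lt_iff r (hMR hr)).2 ⟨h1, h2⟩
        have h4 := (hu.capacity_lt_iff l (hMR hl)).1 (by linarith)
        exact ⟨h4.1, h2, h1.trans h2⟩
      · rintro ⟨h1, h2, -⟩
        exact ⟨h1.trans h, h2⟩
  · have hmf := classicalRiemann_mem_fanSet hM (flux v) h hl u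
    rw [← hm] at hmf
    constructor
    · rintro ⟨h1, h2⟩
      exact ⟨h1.trans_le hmf.2.2.1, hmf.2.1.trans_lt h2, h1.trans h2⟩
    · rintro ⟨h1, h2, h3⟩
      -- a grid point of the interval `[r,l]` where the constraint is violated
      obtain ⟨c, hcM, hc1, hc2, hc3, hc4⟩ : ∃ c ∈ M, rhoCheck R α v u < c ∧ c < rhoHat R α v u ∧
          r ≤ c ∧ c ≤ l := by
        by_cases hl2 : l < rhoHat R α v u
        · exact ⟨l, hl, h1, hl2, h, le_rfl⟩
        by_cases hr2 : rhoCheck R α v u < r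
        · exact ⟨r, hr, hr2, h2, le_rfl, h⟩
        obtain ⟨c, hc, h4, h5⟩ := hu.exists_between h3
        exact ⟨c, hc, h4, h5, by linarith, by linarith⟩
      -- If `m < c`, the fan condition makes `f(ρ) - u ρ` at `m` at least its value at `c`, so `m`
      -- violates the constraint too. If `m` were beyond `ρ̂`, the grid point just below `m` would
      -- be admissible at the ray `u`, against the minimality of `m`.
      rcases lt_trichotomy m c with hmc | hmc | hmc
      · have h5 := hmf.2.2.2 c hcM hmc hc4
        rw [← not_lt, lt_rhSpeed_iff hmc, not_lt] at h5
        have h6 := (hu.capacity_lt_iff c (hMR hcM)).2 ⟨hc1, hc2⟩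
        exact (hu.capacity_lt_iff m (hMR hmM)).1 (by linarith)
      · rw [hmc]
        exact ⟨hc1, hc2⟩
      · by_contra hcon
        have h7 : rhoHat R α v u ≤ m := by
          by_contra h8
          exact hcon ⟨hc1.trans hmc, not_le.1 h8⟩
        have hcm := (hu.capacity_lt_iff c (hMR hcM)).2 ⟨hc1, hc2⟩
        have hmm : flux v m ≤ capacity R α v u + u * m := by
          by_contra h8
          exact hcon ((hu.capacity_lt_iff m (hMR hmM)).1 (not_le.1 h8))
        -- all the chords from the predecessor of `m` have speed less than `u`
        have hne : (M ∩ Ico c m).Nonempty := ⟨c, hcM, le_rfl, hmc⟩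
        obtain ⟨p, ⟨hpM, hpc, hpm⟩, hpmax⟩ := exists_max_image (M ∩ Ico c m) id
          (hM.subset inter_subset_left) hne
        have hspeed : rhSpeed (flux v) p m < u := by
          rcases hpc.eq_or_lt with rfl | hlt
          · rw [rhSpeed_lt_iff hmc]
            linarith
          · have h8 := (hF.rhSpeed_lt (hMR hcM) (hMR hmM) hlt hpm).1
            have h9 : rhSpeed (flux v) c m < u := by
              rw [rhSpeed_lt_iff hmc]
              linarith
            linarith
        have : m ≤ p := by
          rw [hm]
          refine classicalRiemann_le hM h ⟨hpM, hc3.trans hpc, hpm.le.trans hmf.2.2.1,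
            fun q hq h8 _ => ?_⟩
          have hmq : m ≤ q := by
            by_contra h9
            have : q ≤ p := hpmax q ⟨hq, hpc.trans h8.le, not_le.1 h9⟩
            linarith
          rcases hmq.eq_or_lt with rfl | h9
          · exact hspeed.le
          · exact ((hF.rhSpeed_lt (hMR hpM) (hMR hq) hpm h9).2.trans hspeed).le
        linarith

/-- The fronts of the constrained solution. -/
theorem constrainedRiemann_jump (hF : FluxCondition R β B v) (hM : M.Finite)
    (hMR : M ⊆ Icc 0 R) {u l r A C s : ℝ} (hu : IsGridSpeed R α v M u) (hl : l ∈ M)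
    (hr : r ∈ M) (hviol : ConstraintViolated R α v M u l r)
    (hA : ∀ᶠ ξ in 𝓝[<] s, constrainedRiemann R α v M u l r ξ = A)
    (hC : constrainedRiemann R α v M u l r s = C) (hAC : A ≠ C) :
    rhSpeed (flux v) A C = s ∧
      ((s < u ∧ ((l < rhoHat R α v u ∧ A = l ∧ C = rhoHat R α v u) ∨
          (rhoHat R α v u ≤ l ∧ IsRarefactionFront M A C))) ∨
        (s = u ∧ A = rhoHat R α v u ∧ C = rhoCheck R α v u) ∨
        (u < s ∧ ((rhoCheck R α v u < r ∧ A = rhoCheck R α v u ∧ C = r) ∨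
          (r ≤ rhoCheck R α v u ∧ IsRarefactionFront M A C)))) := by
  obtain ⟨h1, h2, h3⟩ := (constraintViolated_iff hF hM hMR hu hl hr).1 hviol
  simp only [constrainedRiemann, if_pos hviol] at hA hC
  have hlt : ∀ᶠ ξ in 𝓝[<] s, ξ < s := eventually_mem_nhdsWithin
  rcases lt_trichotomy s u with h | rfl | h
  · rw [if_pos h] at hC
    have hA' : ∀ᶠ ξ in 𝓝[<] s, classicalRiemann M (flux v) l (rhoHat R α v u) ξ = A := by
      filter_upwards [hA, hlt] with ξ h4 h5
      rwa [if_pos (h5.trans h)] at h4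
    obtain ⟨h4, h5⟩ := classicalRiemann_jump hF hM hMR hl hA' hC hAC
    exact ⟨h4, Or.inl ⟨h, h5⟩⟩
  · rw [if_neg (lt_irrefl _), classicalRiemann_apply_self_left hF hM hMR hu hr h2 h3] at hC
    have h4 := classicalRiemann_eventually_right hF hM hMR hu hl h1 h3
    obtain ⟨ξ, ⟨h5, h6⟩, h7⟩ := ((hA.and hlt).and h4).exists
    rw [if_pos h6] at h5
    have hA' : A = rhoHat R α v s := h5.symm.trans h7
    refine ⟨?_, Or.inr (Or.inl ⟨rfl, hA', hC.symm⟩)⟩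
    rw [rhSpeed_eq_iff hAC, hA', ← hC, hu.flux_hat, hu.flux_check]
    ring
  · rw [if_neg (not_lt.2 h.le)] at hC
    have hgt : ∀ᶠ ξ in 𝓝[<] s, u < ξ := (eventually_gt_nhds h).filter_mono nhdsWithin_le_nhds
    have hA' : ∀ᶠ ξ in 𝓝[<] s, classicalRiemann M (flux v) (rhoCheck R α v u) r ξ = A := by
      filter_upwards [hA, hgt] with ξ h4 h5
      rwa [if_neg (not_lt.2 h5.le)] at h4
    obtain ⟨h4, h5⟩ := classicalRiemann_jump hF hM hMR hu.check_mem hA' hC hAC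
    exact ⟨h4, Or.inr (Or.inr ⟨h, h5⟩)⟩

/-- The traces of the constrained solution along the undercompressive shock. -/
theorem constrainedRiemann_traces (hF : FluxCondition R β B v) (hM : M.Finite)
    (hMR : M ⊆ Icc 0 R) {u l r : ℝ} (hu : IsGridSpeed R α v M u) (hl : l ∈ M) (hr : r ∈ M)
    (hviol : ConstraintViolated R α v M u l r) :
    (∀ᶠ ξ in 𝓝[<] u, constrainedRiemann R α v M u l r ξ = rhoHat R α v u) ∧
      constrainedRiemann R α v M u l r u = rhoCheck R α v u := by
  obtain ⟨h1, h2, h3⟩ := (constraintViolated_iff hF hM hMR hu hl hr).1 hviol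
  simp only [constrainedRiemann, if_pos hviol]
  rw [if_neg (lt_irrefl _), classicalRiemann_apply_self_left hF hM hMR hu hr h2 h3]
  refine ⟨?_, rfl⟩
  have hlt : ∀ᶠ ξ in 𝓝[<] u, ξ < u := eventually_mem_nhdsWithin
  filter_upwards [classicalRiemann_eventually_right hF hM hMR hu hl h1 h3, hlt] with ξ h4 h5
  rw [if_pos h5, h4]

/-- The traces along the vehicle satisfy the constraint. -/
theorem vehicle_traces (hF : FluxCondition R β B v) (hM : M.Finite)
    (hMR : M ⊆ Icc 0 R) {u l r A C : ℝ} (hu : IsGridSpeed R α v M u) (hl : l ∈ M) (hr : r ∈ M)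
    (hA : ∀ᶠ ξ in 𝓝[<] (vehicleSpeed R α v M u l r), constrainedRiemann R α v M u l r ξ = A)
    (hC : constrainedRiemann R α v M u l r (vehicleSpeed R α v M u l r) = C) :
    flux v A ≤ capacity R α v u + u * A ∧ flux v C ≤ capacity R α v u + u * C := by
  have hcap := hu.capacity_nonneg
  by_cases hviol : ConstraintViolated R α v M u l r
  · obtain ⟨h1, h2⟩ := constrainedRiemann_traces hF hM hMR hu hl hr hviol
    simp only [vehicleSpeed, if_pos hviol] at hA hC
    obtain ⟨ξ, h3, h4⟩ := (hA.and h1).exists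
    rw [← h3, h4, ← hC, h2]
    exact ⟨hu.flux_hat.le, hu.flux_check.le⟩
  · simp only [vehicleSpeed, constrainedRiemann, if_neg hviol] at hA hC
    have hjump := fun hne => (classicalRiemann_jump hF hM hMR hl hA hC hne).1
    -- A vehicle moving at its own speed `u` has the right trace tested by the solver, and
    -- Rankine–Hugoniot carries the bound across a front on its path. A vehicle slowed to `v(r)` has
    -- right trace `r`, since no wave is faster than `v(r)`, and both traces have flux `v(r) ρ ≤ u
    -- ρ`.
    rcases le_or_gt u (v r) with huv | huv
    · rw [min_eq_left huv] at hA hC hjump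
      have hC' : flux v C ≤ capacity R α v u + u * C := by
        rw [← hC]
        exact not_lt.1 hviol
      refine ⟨?_, hC'⟩
      by_cases hne : A = C
      · rwa [hne]
      · have := (rhSpeed_eq_iff hne).1 (hjump hne)
        linarith
    · rw [min_eq_right huv.le] at hA hC hjump
      have h0 : (0 : ℝ) ∈ Icc 0 R := ⟨le_rfl, hF.R_pos.le⟩
      have hr0 : 0 < r := by
        refine lt_of_le_of_ne (hMR hr).1 fun h => ?_
        rw [← h, ← hF.maxSpeed_eq] at huv
        exact absurd hu.mem.2 (not_le.2 huv)
      have hchord : ∀ x ∈ M, x < r → rhSpeed (flux v) x r ≤ v r := by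
        intro x hx hxr
        rw [← not_lt, lt_rhSpeed_iff hxr, not_lt]
        have := hF.strictAntiOn.antitoneOn (hMR hx) (hMR hr) hxr.le
        simp only [flux]
        nlinarith [(hMR hx).1]
      have hchord' : ∀ x ∈ M, r < x → rhSpeed (flux v) r x ≤ v r := by
        intro x hx hxr
        rw [← not_lt, lt_rhSpeed_iff hxr, not_lt]
        have := hF.strictAntiOn.antitoneOn (hMR hr) (hMR hx) hxr.le
        simp only [flux]
        nlinarith [(hMR hx).1]
      have hCr : C = r := by
        rw [← hC]
        rcases lt_or_ge l r with h | h
        · rw [classicalRiemann_of_lt _ h, if_neg (not_lt.2 (hchord l hl h))]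
        · exact le_antisymm (classicalRiemann_le hM h
            ⟨hr, le_rfl, h, fun q hq h1 _ => hchord' q hq h1⟩)
            (classicalRiemann_mem_fanSet hM (flux v) h hl _).2.1
      have hC' : flux v C ≤ capacity R α v u + u * C := by
        rw [hCr]
        simp only [flux]
        nlinarith
      refine ⟨?_, hC'⟩
      by_cases hne : A = C
      · rwa [hne]
      · have h1 := (rhSpeed_eq_iff hne).1 (hjump hne)
        have hAM : A ∈ M := by
          obtain ⟨ξ, hξ⟩ := hA.exists
          rw [← hξ]
          exact classicalRiemann_mem hM _ hl hr ξ
        rw [hCr] at h1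
        have h2 : flux v r = v r * r := mul_comm _ _
        nlinarith [(hMR hAM).1]

end Riemann

section Step

variable {n : ℕ}

/-! ### Counting functions of a finite sequence -/

/-- The number of positions that are at most `z`. -/
noncomputable def countLE (X : Fin n → ℝ) (z : ℝ) : ℕ := (Finset.univ.filter fun j => X j ≤ z).card

/-- The number of positions that are less than `z`. -/
noncomputable def countLT (X : Fin n → ℝ) (z : ℝ) : ℕ := (Finset.univ.filter fun j => X j < z).card

/-- A set of indices closed downwards is an initial segment, so its cardinality is the threshold
index. This converts counts of fronts into comparisons of positions. -/
theorem lt_card_filter_iff {p : Fin n → Prop} [DecidablePred p] (hp : ∀ i j, i ≤ j → p j → p i)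
    (j : Fin n) : (j : ℕ) < (Finset.univ.filter p).card ↔ p j := by
  constructor
  · intro h
    by_contra hj
    have : Finset.univ.filter p ⊆ Finset.Iio j := by
      intro i hi
      simp only [Finset.mem_filter, Finset.mem_univ, true_and] at hi
      rw [Finset.mem_Iio]
      by_contra hcon
      exact hj (hp j i (not_lt.1 hcon) hi)
    have := Finset.card_le_card this
    rw [Fin.card_Iio] at this
    omega
  · intro hj
    have : Finset.Iic j ⊆ Finset.univ.filter p := by
      intro i hi
      simp only [Finset.mem_filter, Finset.mem_univ, true_and]
      exact hp i j (Finset.mem_Iic.1 hi) hj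
    have := Finset.card_le_card this
    rw [Fin.card_Iic] at this
    omega

theorem card_filter_le_fin (p : Fin n → Prop) [DecidablePred p] :
    (Finset.univ.filter p).card ≤ n := by
  simpa using Finset.card_filter_le (Finset.univ : Finset (Fin n)) p

theorem countLE_le (X : Fin n → ℝ) (z : ℝ) : countLE X z ≤ n := card_filter_le_fin _

theorem countLT_le_countLE (X : Fin n → ℝ) (z : ℝ) : countLT X z ≤ countLE X z :=
  Finset.card_le_card fun j hj => by
    simp only [Finset.mem_filter, Finset.mem_univ, true_and] at hj ⊢
    exact hj.le

theorem lt_countLE_iff {X : Fin n → ℝ} (hX : Monotone X) (j : Fin n) (z : ℝ) :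
    (j : ℕ) < countLE X z ↔ X j ≤ z :=
  lt_card_filter_iff (fun _ _ h h' => (hX h).trans h') j

theorem lt_countLT_iff {X : Fin n → ℝ} (hX : Monotone X) (j : Fin n) (z : ℝ) :
    (j : ℕ) < countLT X z ↔ X j < z :=
  lt_card_filter_iff (fun _ _ h h' => (hX h).trans_lt h') j

/-- The fronts sitting at one point form a block of consecutive indices; interactions are studied
block by block. -/
theorem mem_Ico_count_iff {X : Fin n → ℝ} (hX : Monotone X) (j : Fin n) (z : ℝ) :
    (j : ℕ) ∈ Finset.Ico (countLT X z) (countLE X z) ↔ X j = z := by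
  rw [Finset.mem_Ico, lt_countLE_iff hX, ← not_lt, lt_countLT_iff hX, not_lt]
  exact ⟨fun h => le_antisymm h.2 h.1, fun h => ⟨h.ge, h.le⟩⟩

theorem countLE_eq_countLT {X : Fin n → ℝ} {z : ℝ} (h : ∀ j, X j ≠ z) :
    countLE X z = countLT X z := by
  unfold countLE countLT
  congr 1
  ext j
  simp only [Finset.mem_filter, Finset.mem_univ, true_and]
  exact ⟨fun h' => lt_of_le_of_ne h' (h j), le_of_lt⟩

theorem countLE_mono (X : Fin n → ℝ) : Monotone (countLE X) := fun a b hab =>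
  Finset.card_le_card fun j hj => by
    simp only [Finset.mem_filter, Finset.mem_univ, true_and] at hj ⊢
    exact hj.trans hab

theorem countLE_apply_self {X : Fin n → ℝ} (hX : StrictMono X) (j : Fin n) :
    countLE X (X j) = j + 1 := by
  have : (Finset.univ.filter fun i => X i ≤ X j) = Finset.Iic j := by
    ext i
    simp [hX.le_iff_le]
  rw [countLE, this, Fin.card_Iic]

theorem countLT_apply_self {X : Fin n → ℝ} (hX : StrictMono X) (j : Fin n) :
    countLT X (X j) = j := by
  have : (Finset.univ.filter fun i => X i < X j) = Finset.Iio j := by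
    ext i
    simp [hX.lt_iff_lt]
  rw [countLT, this, Fin.card_Iio]

theorem eventually_countLE_eq_countLT (X : Fin n → ℝ) (z : ℝ) :
    ∀ᶠ x in 𝓝[<] z, countLE X x = countLT X z := by
  have : ∀ᶠ x in 𝓝[<] z, ∀ j, X j ≤ x ↔ X j < z := by
    rw [eventually_all]
    intro j
    by_cases h : X j < z
    · have : ∀ᶠ x in 𝓝[<] z, X j < x := (eventually_gt_nhds h).filter_mono nhdsWithin_le_nhds
      filter_upwards [this] with x hx
      exact ⟨fun _ => h, fun _ => hx.le⟩
    · have : ∀ᶠ x in 𝓝[<] z, x < z := eventually_mem_nhdsWithin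
      filter_upwards [this] with x hx
      exact ⟨fun h' => h'.trans_lt hx, fun h' => absurd h' h⟩
  filter_upwards [this] with x hx
  simp only [countLE, countLT, hx]

theorem eventually_countLE_eq (X : Fin n → ℝ) (z : ℝ) :
    ∀ᶠ x in 𝓝[>] z, countLE X x = countLE X z := by
  have : ∀ᶠ x in 𝓝[>] z, ∀ j, X j ≤ x ↔ X j ≤ z := by
    rw [eventually_all]
    intro j
    by_cases h : X j ≤ z
    · have : ∀ᶠ x in 𝓝[>] z, z < x := eventually_mem_nhdsWithin
      filter_upwards [this] with x hx
      exact ⟨fun _ => h, fun _ => h.trans hx.le⟩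
    · have : ∀ᶠ x in 𝓝[>] z, x < X j :=
        (eventually_lt_nhds (not_le.1 h)).filter_mono nhdsWithin_le_nhds
      filter_upwards [this] with x hx
      exact ⟨fun h' => absurd h' (not_le.2 hx), fun h' => absurd h' h⟩
  filter_upwards [this] with x hx
  simp only [countLE, hx]

/-! ### Step profiles -/

theorem stepProfile_eq (X : Fin n → ℝ) (w : ℕ → ℝ) (z : ℝ) :
    stepProfile X w z = w (countLE X z) := rfl

theorem tendsto_stepProfile_left (X : Fin n → ℝ) (w : ℕ → ℝ) (z : ℝ) :
    Tendsto (stepProfile X w) (𝓝[<] z) (𝓝 (w (countLT X z))) := by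
  refine tendsto_const_nhds.congr' ?_
  filter_upwards [eventually_countLE_eq_countLT X z] with x hx
  rw [stepProfile_eq, hx]

theorem tendsto_stepProfile_right (X : Fin n → ℝ) (w : ℕ → ℝ) (z : ℝ) :
    Tendsto (stepProfile X w) (𝓝[>] z) (𝓝 (w (countLE X z))) := by
  refine tendsto_const_nhds.congr' ?_
  filter_upwards [eventually_countLE_eq X z] with x hx
  rw [stepProfile_eq, hx]

theorem leftLim_stepProfile (X : Fin n → ℝ) (w : ℕ → ℝ) (z : ℝ) :
    Function.leftLim (stepProfile X w) z = w (countLT X z) :=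
  leftLim_eq_of_tendsto (tendsto_stepProfile_left X w z)

theorem rightLim_stepProfile (X : Fin n → ℝ) (w : ℕ → ℝ) (z : ℝ) :
    Function.rightLim (stepProfile X w) z = w (countLE X z) :=
  rightLim_eq_of_tendsto (tendsto_stepProfile_right X w z)

theorem ncard_discontinuities_stepProfile {X : Fin n → ℝ} (hX : StrictMono X) {w : ℕ → ℝ}
    (hw : ∀ j < n, w j ≠ w (j + 1)) :
    {x | ¬ ContinuousAt (stepProfile X w) x}.ncard = n := by
  have : {x | ¬ ContinuousAt (stepProfile X w) x} = range X := by
    ext x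
    simp only [mem_ofPred_eq, mem_range]
    constructor
    · intro h
      by_contra hcon
      push Not at hcon
      apply h
      rw [continuousAt_iff_continuous_left'_right']
      refine ⟨?_, tendsto_stepProfile_right X w x⟩
      have := tendsto_stepProfile_left X w x
      rw [← countLE_eq_countLT hcon] at this
      exact this
    · rintro ⟨j, rfl⟩ h
      have h1 := h.tendsto.mono_left (nhdsWithin_le_nhds (s := Iio (X j)))
      have h2 := tendsto_nhds_unique h1 (tendsto_stepProfile_left X w (X j))
      rw [stepProfile_eq, countLE_apply_self hX, countLT_apply_self hX] at h2
      exact hw j j.2 h2.symm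
  rw [this, ← image_univ, ncard_image_of_injective _ hX.injective, ncard_univ]
  simp

theorem eVariationOn_nat (w : ℕ → ℝ) (n : ℕ) :
    eVariationOn w (Icc 0 n) = ∑ j ∈ Finset.range n, edist (w j) (w (j + 1)) := by
  induction n with
  | zero => simp [eVariationOn.subsingleton]
  | succ k ih =>
    have h := eVariationOn.Icc_add_Icc w (s := univ) (Nat.zero_le k) (Nat.le_succ k) (mem_univ _)
    simp only [univ_inter] at h
    have h2 : Icc k (k + 1) = {k, k + 1} := by
      ext i
      simp only [mem_Icc, mem_insert_iff, mem_singleton_iff]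
      omega
    rw [Nat.succ_eq_add_one] at h
    rw [← h, ih, h2, eVariationOn.pair, Finset.sum_range_succ]

theorem range_countLE {X : Fin n → ℝ} (hX : StrictMono X) :
    countLE X '' univ = Icc 0 n := by
  ext k
  simp only [image_univ, mem_range, mem_Icc, Nat.zero_le, true_and]
  constructor
  · rintro ⟨z, rfl⟩
    exact countLE_le X z
  · intro hk
    rcases Nat.eq_zero_or_pos k with rfl | hpos
    · obtain ⟨z, hz⟩ := (finite_range X).bddBelow
      refine ⟨z - 1, ?_⟩
      rw [countLE, Finset.card_eq_zero, Finset.filter_eq_empty_iff]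
      intro j _ h
      linarith [hz (mem_range_self j)]
    · refine ⟨X ⟨k - 1, by omega⟩, ?_⟩
      rw [countLE_apply_self hX]
      simp only
      omega

/-- The profile is the chain `w` reparametrised by the monotone counting function, which takes every
value from `0` to `n`. -/
theorem eVariationOn_stepProfile {X : Fin n → ℝ} (hX : StrictMono X) (w : ℕ → ℝ) :
    (eVariationOn (stepProfile X w) univ).toReal =
      ∑ j ∈ Finset.range n, |w (j + 1) - w j| := by
  have : stepProfile X w = w ∘ countLE X := rfl
  rw [this, eVariationOn.comp_eq_of_monotoneOn w (countLE X) ((countLE_mono X).monotoneOn _),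
    range_countLE hX, eVariationOn_nat, ENNReal.toReal_sum fun j _ => edist_ne_top _ _]
  refine Finset.sum_congr rfl fun j _ => ?_
  rw [edist_dist, ENNReal.toReal_ofReal dist_nonneg, dist_comm, Real.dist_eq]

/-- A sum over the fronts can be grouped by position. -/
theorem sum_range_eq_sum_groups {X : Fin n → ℝ} (hX : Monotone X) {Z : Finset ℝ}
    (hZ : ∀ j, X j ∈ Z) (g : ℕ → ℝ) :
    ∑ j ∈ Finset.range n, g j =
      ∑ z ∈ Z, ∑ j ∈ Finset.Ico (countLT X z) (countLE X z), g j := by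
  rw [Finset.sum_range, ← Finset.sum_fiberwise_of_maps_to (t := Z) (g := X) fun j _ => hZ j]
  refine Finset.sum_congr rfl fun z _ => ?_
  refine Finset.sum_bij (fun j _ => (j : ℕ)) ?_ ?_ ?_ ?_
  · intro j hj
    rw [mem_Ico_count_iff hX]
    exact (Finset.mem_filter.1 hj).2
  · intro i _ j _ h
    exact Fin.ext h
  · intro k hk
    have hkn : k < n := (Finset.mem_Ico.1 hk).2.trans_le (countLE_le X z)
    refine ⟨⟨k, hkn⟩, ?_, rfl⟩
    rw [Finset.mem_filter]
    exact ⟨Finset.mem_univ _, (mem_Ico_count_iff hX ⟨k, hkn⟩ z).1 hk⟩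
  · intro j _
    rfl

end Step

/-! ### Total variation of the control -/

section Control

variable {U : Set ℝ} {u : ℝ → ℝ}

/-- A continuous function from an interval to a finite set is constant. -/
theorem IsStepControl.eq_of_no_jump (hU : U.Finite) (hu : IsStepControl U u) {s t : ℝ}
    (hs : 0 ≤ s) (hst : s ≤ t) (h : ∀ x, s < x → x ≤ t → ContinuousAt u x) : u s = u t := by
  have hc : ContinuousOn u (Icc s t) := by
    intro x hx
    rcases hx.1.eq_or_lt with rfl | hlt
    · exact (hu.right_cont s hs).mono Icc_subset_Ici_self
    · exact (h x hlt hx.2).continuousWithinAt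
  exact isPreconnected_Icc.constant_of_mapsTo (T := U) hU.isDiscrete hc
    (fun x hx => hu.mem x (hs.trans hx.1)) ⟨le_rfl, hst⟩ ⟨hst, le_rfl⟩

/-- The control factors through the number of jumps so far, hence through a finite chain. Finiteness
matters because `toReal` would send an infinite variation to `0`. -/
theorem IsStepControl.eVariationOn_ne_top (hU : U.Finite) (hu : IsStepControl U u) {t : ℝ}
    (ht : 0 ≤ t) : eVariationOn u (Ici t) ≠ ⊤ := by
  set D := hu.finite_jumps.toFinset with hD
  have hDmem : ∀ x, x ∈ D ↔ 0 < x ∧ ¬ ContinuousAt u x := by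
    intro x
    simp [hD]
  set c : ℝ → ℕ := fun t => (D.filter (· ≤ t)).card with hc
  have hcm : Monotone c := fun a b hab => Finset.card_le_card fun j hj => by
    rw [Finset.mem_filter] at hj ⊢
    exact ⟨hj.1, hj.2.trans hab⟩
  have hconst' : ∀ s t, 0 ≤ s → s ≤ t → c s = c t → u s = u t := by
    intro s t hs hst hcst
    refine hu.eq_of_no_jump hU hs hst fun x hsx hxt => ?_
    by_contra hx
    have hsub : D.filter (· ≤ s) ⊆ D.filter (· ≤ t) := fun j hj => by
      rw [Finset.mem_filter] at hj ⊢
      exact ⟨hj.1, hj.2.trans hst⟩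
    have heq := Finset.eq_of_subset_of_card_le hsub hcst.ge
    have hxD : x ∈ D.filter (· ≤ t) :=
      Finset.mem_filter.2 ⟨(hDmem x).2 ⟨hs.trans_lt hsx, hx⟩, hxt⟩
    rw [← heq] at hxD
    exact absurd (Finset.mem_filter.1 hxD).2 (not_le.2 hsx)
  have hconst : ∀ s t, 0 ≤ s → 0 ≤ t → c s = c t → u s = u t := by
    intro s t hs ht h
    rcases le_total s t with h' | h'
    · exact hconst' s t hs h' h
    · exact (hconst' t s ht h' h.symm).symm
  classical
  set g : ℕ → ℝ := fun k => if h : ∃ s, 0 ≤ s ∧ c s = k then u h.choose else 0 with hg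
  have hgu : ∀ s, 0 ≤ s → g (c s) = u s := by
    intro s hs
    have h : ∃ s', 0 ≤ s' ∧ c s' = c s := ⟨s, hs, rfl⟩
    simp only [hg, dif_pos h]
    exact hconst _ _ h.choose_spec.1 hs h.choose_spec.2
  have h1 : eVariationOn u (Ici t) = eVariationOn (g ∘ c) (Ici t) :=
    eVariationOn.congr fun s hs => (hgu s (ht.trans hs)).symm
  rw [h1]
  refine ne_top_of_le_ne_top ?_ (eVariationOn.comp_le_of_monotoneOn g (s := Icc 0 D.card) c
    (hcm.monotoneOn _) fun s _ => ⟨Nat.zero_le _, Finset.card_filter_le _ _⟩)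
  rw [eVariationOn_nat]
  exact ENNReal.sum_ne_top.2 fun j _ => edist_ne_top _ _

theorem eVariationOn_Ici_split (u : ℝ → ℝ) {s t : ℝ} (hst : s ≤ t) :
    eVariationOn u (Ici s) = eVariationOn u (Icc s t) + eVariationOn u (Ici t) := by
  rw [← Icc_union_Ici_eq_Ici hst]
  exact eVariationOn.union u (x := t) ⟨⟨hst, le_rfl⟩, fun x hx => hx.2⟩
    ⟨self_mem_Ici, fun x hx => hx⟩

theorem eVariationOn_Icc_of_const {u : ℝ → ℝ} {s t c : ℝ} (hst : s ≤ t)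
    (h : ∀ x ∈ Ico s t, u x = c) (hs : u s = c) :
    eVariationOn u (Icc s t) = edist c (u t) := by
  -- Collapsing `[s,t[` to `s` does not change `u`, so the variation is that of a pair of points.
  set φ : ℝ → ℝ := fun x => if x < t then s else t with hφ
  have hm : MonotoneOn φ (Icc s t) := by
    intro x hx y hy hxy
    simp only [hφ]
    split_ifs with h1 h2
    · exact le_rfl
    · exact hst
    · exact absurd (hxy.trans_lt (by assumption)) h1
    · exact le_rfl
  have h1 : eVariationOn u (Icc s t) = eVariationOn (u ∘ φ) (Icc s t) := by
    refine eVariationOn.congr fun x hx => ?_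
    simp only [Function.comp, hφ]
    split_ifs with h2
    · rw [h x ⟨hx.1, h2⟩, hs]
    · rw [le_antisymm hx.2 (not_lt.1 h2)]
  have h2 : φ '' Icc s t = {s, t} := by
    ext x
    simp only [mem_image, mem_insert_iff, mem_singleton_iff]
    constructor
    · rintro ⟨y, -, rfl⟩
      simp only [hφ]
      split_ifs
      exacts [Or.inl rfl, Or.inr rfl]
    · rintro (rfl | rfl)
      · refine ⟨x, ⟨le_rfl, hst⟩, ?_⟩
        simp only [hφ]
        split_ifs with h3
        · rfl
        · exact le_antisymm (not_lt.1 h3) hst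
      · exact ⟨x, ⟨hst, le_rfl⟩, by simp [hφ]⟩
  rw [h1, eVariationOn.comp_eq_of_monotoneOn _ _ hm, h2, eVariationOn.pair, hs]

theorem IsStepControl.toReal_eVariationOn_Ici (hU : U.Finite) (hu : IsStepControl U u)
    {s t c : ℝ} (hs : 0 ≤ s) (hst : s < t) (h : ∀ x ∈ Ico s t, u x = c) :
    (eVariationOn u (Ici s)).toReal = |u t - c| + (eVariationOn u (Ici t)).toReal := by
  rw [eVariationOn_Ici_split u hst.le,
    eVariationOn_Icc_of_const hst.le h (h s ⟨le_rfl, hst⟩),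
    ENNReal.toReal_add (edist_ne_top _ _) (hu.eVariationOn_ne_top hU (hs.trans hst.le)),
    edist_dist, ENNReal.toReal_ofReal dist_nonneg, dist_comm, Real.dist_eq]

end Control

section Fronts

variable {n : ℕ} {x s : Fin n → ℝ} {a b : ℝ}

/-! ### Fronts that leave a point -/

theorem affine_nonneg_endpoints {c d : ℝ} (hab : a < b)
    (h : ∀ t ∈ Ioo a b, 0 ≤ c + d * (t - a)) : 0 ≤ c ∧ 0 ≤ c + d * (b - a) := by
  have hc : Continuous fun t => c + d * (t - a) := by fun_prop
  have hcl : IsClosed {t | 0 ≤ c + d * (t - a)} := isClosed_le continuous_const hc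
  have hsub : Icc a b ⊆ {t | 0 ≤ c + d * (t - a)} := by
    rw [← closure_Ioo hab.ne]
    exact closure_minimal h hcl
  have h1 : 0 ≤ c + d * (a - a) := hsub ⟨le_rfl, hab.le⟩
  exact ⟨by simpa using h1, hsub ⟨hab.le, le_rfl⟩⟩

/-- Applied to the signed distance from a front to the vehicle: if a front starts strictly to the
left, then it neither coincides with the vehicle nor crosses it before the stage ends. -/
theorem affine_neg {c d : ℝ} (hc : c < 0)
    (h : (∀ t ∈ Ioo a b, c + d * (t - a) = 0) ∨ ∀ t ∈ Ioo a b, c + d * (t - a) ≠ 0) :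
    ∀ t ∈ Ioo a b, c + d * (t - a) < 0 := by
  intro t ht
  rcases h with h | h
  · have h1 := h t ht
    have h2 := h ((a + t) / 2) ⟨by linarith [ht.1], by linarith [ht.1, ht.2]⟩
    exfalso
    have : d * ((a + t) / 2 - a) = d * (t - a) / 2 := by ring
    linarith
  · by_contra hcon
    push Not at hcon
    have hd : 0 < d := by
      by_contra hd
      nlinarith [ht.1]
    have hdiv : 0 < -c / d := div_pos (by linarith) hd
    have hle : -c / d ≤ t - a := by
      rw [div_le_iff₀ hd]
      linarith
    refine h (a + -c / d) ⟨by linarith, by linarith [ht.2]⟩ ?_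
    field_simp
    ring

/-- Lexicographic order of position and speed. -/
def LexMono (x s : Fin n → ℝ) : Prop :=
  ∀ i j, i < j → x i < x j ∨ (x i = x j ∧ s i < s j)

/-- The number of fronts that are on the left of, or on, the ray of speed `ξ` from `z`. -/
noncomputable def frontCountLE (x s : Fin n → ℝ) (z ξ : ℝ) : ℕ :=
  open Classical in (Finset.univ.filter fun j => x j < z ∨ (x j = z ∧ s j ≤ ξ)).card

/-- The number of fronts that are on the left of the ray of speed `ξ` from `z`. -/
noncomputable def frontCountLT (x s : Fin n → ℝ) (z ξ : ℝ) : ℕ :=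
  open Classical in (Finset.univ.filter fun j => x j < z ∨ (x j = z ∧ s j < ξ)).card

theorem LexMono.monotone (h : LexMono x s) : Monotone x := by
  intro i j hij
  rcases hij.eq_or_lt with rfl | hlt
  · exact le_rfl
  · rcases h i j hlt with h | h
    exacts [h.le, h.1.le]

theorem LexMono.lt_frontCountLE_iff (h : LexMono x s) (z ξ : ℝ) (j : Fin n) :
    (j : ℕ) < frontCountLE x s z ξ ↔ x j < z ∨ (x j = z ∧ s j ≤ ξ) := by
  classical
  unfold frontCountLE
  refine lt_card_filter_iff ?_ j
  intro i j hij hj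
  rcases hij.eq_or_lt with rfl | hlt
  · exact hj
  rcases h i j hlt with h1 | h1 <;> rcases hj with h2 | h2
  · exact Or.inl (h1.trans h2)
  · exact Or.inl (by linarith [h2.1])
  · exact Or.inl (by linarith [h1.1])
  · exact Or.inr ⟨h1.1.trans h2.1, h1.2.le.trans h2.2⟩

theorem LexMono.lt_frontCountLT_iff (h : LexMono x s) (z ξ : ℝ) (j : Fin n) :
    (j : ℕ) < frontCountLT x s z ξ ↔ x j < z ∨ (x j = z ∧ s j < ξ) := by
  classical
  unfold frontCountLT
  refine lt_card_filter_iff ?_ j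
  intro i j hij hj
  rcases hij.eq_or_lt with rfl | hlt
  · exact hj
  rcases h i j hlt with h1 | h1 <;> rcases hj with h2 | h2
  · exact Or.inl (h1.trans h2)
  · exact Or.inl (by linarith [h2.1])
  · exact Or.inl (by linarith [h1.1])
  · exact Or.inr ⟨h1.1.trans h2.1, h1.2.trans h2.2⟩

theorem frontCountLE_le (x s : Fin n → ℝ) (z ξ : ℝ) : frontCountLE x s z ξ ≤ n :=
  card_filter_le_fin _

theorem frontCountLT_le (x s : Fin n → ℝ) (z ξ : ℝ) :
    frontCountLT x s z ξ ≤ frontCountLE x s z ξ :=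
  Finset.card_le_card fun j hj => by
    simp only [Finset.mem_filter, Finset.mem_univ, true_and] at hj ⊢
    exact hj.imp id fun h => ⟨h.1, h.2.le⟩

theorem countLT_le_frontCountLT (x s : Fin n → ℝ) (z ξ : ℝ) :
    countLT x z ≤ frontCountLT x s z ξ :=
  Finset.card_le_card fun j hj => by
    simp only [Finset.mem_filter, Finset.mem_univ, true_and] at hj ⊢
    exact Or.inl hj

theorem frontCountLE_le_countLE (x s : Fin n → ℝ) (z ξ : ℝ) :
    frontCountLE x s z ξ ≤ countLE x z :=
  Finset.card_le_card fun j hj => by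
    simp only [Finset.mem_filter, Finset.mem_univ, true_and] at hj ⊢
    rcases hj with h | h
    exacts [h.le, h.1.le]

theorem nat_eq_of_fin_lt_iff {k l : ℕ} (hk : k ≤ n) (hl : l ≤ n)
    (h : ∀ j : Fin n, (j : ℕ) < k ↔ (j : ℕ) < l) : k = l := by
  rcases lt_trichotomy k l with h1 | h1 | h1
  · have := (h ⟨k, by omega⟩).2 h1
    simp at this
  · exact h1
  · have := (h ⟨l, by omega⟩).1 h1
    simp at this

theorem LexMono.frontCountLE_self (h : LexMono x s) (j : Fin n) :
    frontCountLE x s (x j) (s j) = j + 1 := by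
  refine nat_eq_of_fin_lt_iff (frontCountLE_le _ _ _ _) (by omega) fun i => ?_
  rw [h.lt_frontCountLE_iff]
  rcases lt_trichotomy i j with hij | rfl | hij
  · refine iff_of_true ?_ (by have : (i : ℕ) < j := hij; omega)
    exact (h i j hij).imp id fun h => ⟨h.1, h.2.le⟩
  · exact iff_of_true (Or.inr ⟨rfl, le_rfl⟩) (by omega)
  · refine iff_of_false ?_ (by have : (j : ℕ) < i := hij; omega)
    rcases h j i hij with h1 | ⟨h1, h1'⟩ <;> rintro (h2 | ⟨h2, h2'⟩) <;> linarith

theorem LexMono.frontCountLT_self (h : LexMono x s) (j : Fin n) :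
    frontCountLT x s (x j) (s j) = j := by
  refine nat_eq_of_fin_lt_iff ((frontCountLT_le _ _ _ _).trans (frontCountLE_le _ _ _ _))
    (by omega) fun i => ?_
  rw [h.lt_frontCountLT_iff]
  rcases lt_trichotomy i j with hij | rfl | hij
  · exact iff_of_true (h i j hij) hij
  · refine iff_of_false ?_ (lt_irrefl _)
    rintro (h2 | h2)
    exacts [lt_irrefl _ h2, lt_irrefl _ h2.2]
  · refine iff_of_false ?_ (by have : (j : ℕ) < i := hij; omega)
    rcases h j i hij with h1 | ⟨h1, h1'⟩ <;> rintro (h2 | ⟨h2, h2'⟩) <;> linarith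

theorem eventually_frontCountLE_eq (x s : Fin n → ℝ) (z σ : ℝ) :
    ∀ᶠ ξ in 𝓝[<] σ, frontCountLE x s z ξ = frontCountLT x s z σ := by
  have : ∀ᶠ ξ in 𝓝[<] σ, ∀ j, s j ≤ ξ ↔ s j < σ := by
    rw [eventually_all]
    intro j
    by_cases h : s j < σ
    · have : ∀ᶠ ξ in 𝓝[<] σ, s j < ξ := (eventually_gt_nhds h).filter_mono nhdsWithin_le_nhds
      filter_upwards [this] with ξ hξ
      exact ⟨fun _ => h, fun _ => hξ.le⟩
    · have : ∀ᶠ ξ in 𝓝[<] σ, ξ < σ := eventually_mem_nhdsWithin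
      filter_upwards [this] with ξ hξ
      exact ⟨fun h' => h'.trans_lt hξ, fun h' => absurd h' h⟩
  filter_upwards [this] with ξ hξ
  simp only [frontCountLE, frontCountLT, hξ]

/-- Just after time `a` fronts from different origins are still apart and those from `z` are ordered
by speed. The state on a ray from `z` is thus read off the chain, which is how the Riemann solvers
determine it. -/
theorem eventually_countLE_eq_frontCountLE (x s : Fin n → ℝ) (a z ξ : ℝ) :
    ∀ᶠ t in 𝓝[>] a, countLE (fun j => x j + s j * (t - a)) (z + ξ * (t - a)) =
      frontCountLE x s z ξ := by
  have : ∀ᶠ t in 𝓝[>] a, ∀ j, x j + s j * (t - a) ≤ z + ξ * (t - a) ↔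
      x j < z ∨ (x j = z ∧ s j ≤ ξ) := by
    rw [eventually_all]
    intro j
    have hc : Continuous fun t => x j - z + (s j - ξ) * (t - a) := by fun_prop
    have hlim : Tendsto (fun t => x j - z + (s j - ξ) * (t - a)) (𝓝[>] a) (𝓝 (x j - z)) := by
      have := (hc.tendsto a).mono_left (nhdsWithin_le_nhds (s := Ioi a))
      simpa using this
    rcases lt_trichotomy (x j) z with h | h | h
    · filter_upwards [hlim.eventually (gt_mem_nhds (sub_neg.2 h))] with t ht
      exact iff_of_true (by linarith) (Or.inl h)
    · have : ∀ᶠ t in 𝓝[>] a, a < t := eventually_mem_nhdsWithin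
      filter_upwards [this] with t ht
      have ht' : 0 < t - a := sub_pos.2 ht
      rw [h]
      constructor
      · intro h1
        refine Or.inr ⟨rfl, ?_⟩
        by_contra hcon
        nlinarith
      · rintro (h1 | h1)
        · exact absurd h1 (lt_irrefl _)
        · nlinarith [h1.2]
    · filter_upwards [hlim.eventually (lt_mem_nhds (sub_pos.2 h))] with t ht
      refine iff_of_false (by linarith) ?_
      rintro (h1 | ⟨h1, -⟩) <;> linarith
  filter_upwards [this] with t ht
  simp only [countLE, frontCountLE, ht]

theorem countLE_le_countLT_add_one {X : Fin n → ℝ} (hX : StrictMono X) (z : ℝ) :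
    countLE X z ≤ countLT X z + 1 := by
  by_contra hcon
  push Not at hcon
  have hn := countLE_le X z
  have h1 := (lt_countLE_iff hX.monotone ⟨countLT X z + 1, by omega⟩ z).1 hcon
  have h2 := (lt_countLT_iff hX.monotone ⟨countLT X z, by omega⟩ z).not.1 (lt_irrefl _)
  have h3 : X ⟨countLT X z, by omega⟩ < X ⟨countLT X z + 1, by omega⟩ :=
    hX (Fin.mk_lt_mk.2 (Nat.lt_succ_self _))
  linarith

end Fronts

/-! ### Description of a stage at its two ends -/

section Stage

variable {R β B α : ℝ} {v : ℝ → ℝ} {M : Set ℝ}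

/-- The fronts of the chain `w p, …, w q` are those of a classical Riemann solution from `l`
to `r`. -/
def IsClassicalChain (M : Set ℝ) (w : ℕ → ℝ) (p q : ℕ) (l r : ℝ) : Prop :=
  ∀ j, p ≤ j → j < q → (l < r ∧ w j = l ∧ w (j + 1) = r) ∨
    (r ≤ l ∧ IsRarefactionFront M (w j) (w (j + 1)))

/-- What remains of a stage at its beginning: the chain of states `w`, the origins `X` of the
fronts, and the value `γ` of the undercompressive-shock term. -/
structure IsOutgoing (R α : ℝ) (v : ℝ → ℝ) (M : Set ℝ) (r : ℝ → ℝ) (z₀ u : ℝ) {n : ℕ}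
    (w : ℕ → ℝ) (X : Fin n → ℝ) (γ : ℝ) : Prop where
  mem : ∀ j ≤ n, w j ∈ M
  ne : ∀ j < n, w j ≠ w (j + 1)
  mono : Monotone X
  profile : r = stepProfile X w
  classical : ∀ z, z ≠ z₀ → IsClassicalChain M w (countLT X z) (countLE X z)
    (w (countLT X z)) (w (countLE X z))
  gamma : γ = 0 ∨ γ = -2 * (rhoHat R α v u - rhoCheck R α v u)
  vehicle :
    ((w (countLT X z₀) ≤ rhoCheck R α v u ∨ rhoHat R α v u ≤ w (countLE X z₀)) ∧
      IsClassicalChain M w (countLT X z₀) (countLE X z₀)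
        (w (countLT X z₀)) (w (countLE X z₀))) ∨
    (rhoCheck R α v u < w (countLT X z₀) ∧ w (countLE X z₀) < rhoHat R α v u ∧
      rhoCheck R α v u < rhoHat R α v u ∧
      γ = -2 * (rhoHat R α v u - rhoCheck R α v u) ∧
      ∃ P, countLT X z₀ ≤ P ∧ P < countLE X z₀ ∧ w P = rhoHat R α v u ∧
        w (P + 1) = rhoCheck R α v u ∧
        IsClassicalChain M w (countLT X z₀) P (w (countLT X z₀)) (rhoHat R α v u) ∧
        IsClassicalChain M w (P + 1) (countLE X z₀) (rhoCheck R α v u) (w (countLE X z₀)))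

/-- What remains of a stage at its end: the chain of states `w`, the final positions `X` of the
fronts, the indices `P` and `Q` of the traces at the vehicle, and the value `γ` of the
undercompressive-shock term. -/
structure IsIncoming (R α : ℝ) (v : ℝ → ℝ) (M : Set ℝ) (r : ℝ → ℝ) (z₀ u : ℝ) {n : ℕ}
    (w : ℕ → ℝ) (X : Fin n → ℝ) (P Q : ℕ) (γ : ℝ) : Prop where
  mem : ∀ j ≤ n, w j ∈ M
  ne : ∀ j < n, w j ≠ w (j + 1)
  mono : Monotone X
  profile : r = stepProfile X w
  no_double : ∀ z j, countLT X z ≤ j → j + 1 < countLE X z →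
    ¬ (w (j + 1) < w j ∧ w (j + 2) < w (j + 1))
  le_P : countLT X z₀ ≤ P
  P_le_Q : P ≤ Q
  Q_le : Q ≤ P + 1
  Q_le_count : Q ≤ countLE X z₀
  trace_P : ¬ (rhoCheck R α v u < w P ∧ w P < rhoHat R α v u)
  trace_Q : ¬ (rhoCheck R α v u < w Q ∧ w Q < rhoHat R α v u)
  front : ∀ j < n, w j < w (j + 1) ∨ IsRarefactionFront M (w j) (w (j + 1)) ∨
    (j = P ∧ Q = P + 1 ∧ w P = rhoHat R α v u ∧ w Q = rhoCheck R α v u)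
  gamma : (w P = rhoHat R α v u ∧ w Q = rhoCheck R α v u ∧
      γ = -2 * (rhoHat R α v u - rhoCheck R α v u)) ∨
    (¬ (w P = rhoHat R α v u ∧ w Q = rhoCheck R α v u) ∧ γ = 0)

/-- On every ray from a point at time `a` the solver and the chain `w` give the same state, so each
front of the chain is a jump of a Riemann solution and has its type and its Rankine–Hugoniot speed.
What happens at time `b` follows because the chain does not change and positions are affine in time.
-/
theorem IsStage.description (hF : FluxCondition R β B v) (hM : M.Finite)
    (hMR : M ⊆ Icc 0 R) {ρ : ℝ → ℝ → ℝ} {y u : ℝ → ℝ} {a b : ℝ} (hab : a < b)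
    (hu : IsGridSpeed R α v M (u a)) (h : IsStage R α v M ρ y u a b) :
    ∃ (n : ℕ) (w : ℕ → ℝ) (Xa Xb : Fin n → ℝ) (P Q : ℕ) (γ : ℝ),
      IsOutgoing R α v M (ρ a) (y a) (u a) w Xa γ ∧
      IsIncoming R α v M (ρ b) (y b) (u a) w Xb P Q γ ∧
      ∀ t ∈ Ioo a b,
        (eVariationOn (ρ t) univ).toReal = ∑ j ∈ Finset.range n, |w (j + 1) - w j| ∧
        waveCount ρ t = n ∧ gammaTerm R α v ρ y u t = γ := by
  classical
  obtain ⟨n, x, s, w, hmem, hne, hstrict, hprof, hveh⟩ := h.fronts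
  set X : ℝ → Fin n → ℝ := fun t j => x j + s j * (t - a) with hXdef
  have hXa : X a = x := by funext j; simp [hXdef]
  have hρ : ∀ t ∈ Icc a b, ρ t = stepProfile (X t) w := fun t ht => funext (hprof t ht)
  have hρa : ρ a = stepProfile x w := by rw [hρ a ⟨le_rfl, hab.le⟩, hXa]
  have hmid : (a + b) / 2 ∈ Ioo a b := ⟨by linarith, by linarith⟩
  have hlex : LexMono x s := by
    intro i j hij
    have h1 : ∀ t ∈ Ioo a b, 0 ≤ x j - x i + (s j - s i) * (t - a) := fun t ht => by
      have := hstrict t ht hij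
      simp only at this
      linarith
    have h2 := (affine_nonneg_endpoints hab h1).1
    rcases (sub_nonneg.1 h2).eq_or_lt with h3 | h3
    · refine Or.inr ⟨h3, ?_⟩
      have := hstrict _ hmid hij
      simp only [h3] at this
      have h4 : 0 < (a + b) / 2 - a := by linarith
      by_contra hcon
      nlinarith
    · exact Or.inl h3
  have hXb : Monotone (X b) := by
    intro i j hij
    rcases hij.eq_or_lt with rfl | hlt
    · exact le_rfl
    have h1 : ∀ t ∈ Ioo a b, 0 ≤ x j - x i + (s j - s i) * (t - a) := fun t ht => by
      have := hstrict t ht hlt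
      simp only at this
      linarith
    have h2 := (affine_nonneg_endpoints hab h1).2
    simp only [hXdef]
    linarith
  have hleft : ∀ z, Function.leftLim (ρ a) z = w (countLT x z) := fun z => by
    rw [hρa, leftLim_stepProfile]
  have hright : ∀ z, Function.rightLim (ρ a) z = w (countLE x z) := fun z => by
    rw [hρa, rightLim_stepProfile]
  have hmemLE : ∀ z, w (countLE x z) ∈ M := fun z => hmem _ (countLE_le _ _)
  have hmemLT : ∀ z, w (countLT x z) ∈ M := fun z =>
    hmem _ ((countLT_le_countLE _ _).trans (countLE_le _ _))
  -- the solution near a point in terms of the chain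
  have hriem : ∀ (z ξ A : ℝ), (∀ᶠ t in 𝓝[>] a, ρ t (z + ξ * (t - a)) = A) →
      A = w (frontCountLE x s z ξ) := by
    intro z ξ A hA
    have hI : ∀ᶠ t in 𝓝[>] a, t ∈ Ioo a b := Ioo_mem_nhdsGT hab
    obtain ⟨t, ⟨h1, h2⟩, h3⟩ :=
      ((hA.and (eventually_countLE_eq_frontCountLE x s a z ξ)).and hI).exists
    rw [← h1, hρ t (Ioo_subset_Icc_self h3), stepProfile_eq, ← h2]
  have hcl : ∀ z, z ≠ y a → ∀ ξ, classicalRiemann M (flux v) (w (countLT x z))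
      (w (countLE x z)) ξ = w (frontCountLE x s z ξ) := by
    intro z hz ξ
    have := h.classical z hz ξ
    rw [hleft, hright] at this
    exact hriem z ξ _ this
  have hco : ∀ ξ, constrainedRiemann R α v M (u a) (w (countLT x (y a)))
      (w (countLE x (y a))) ξ = w (frontCountLE x s (y a) ξ) := by
    intro ξ
    have := h.constrained ξ
    rw [hleft, hright] at this
    exact hriem (y a) ξ _ this
  set σ := vehicleSpeed R α v M (u a) (w (countLT x (y a))) (w (countLE x (y a))) with hσ
  have hy : ∀ t ∈ Icc a b, y t = y a + σ * (t - a) := by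
    intro t ht
    have := h.vehicle t ht
    rw [hleft, hright] at this
    rw [this]
    ring
  set P := frontCountLT x s (y a) σ with hP
  set Q := frontCountLE x s (y a) σ with hQ
  have hPn : P ≤ n := (frontCountLT_le _ _ _ _).trans (frontCountLE_le _ _ _ _)
  have hQn : Q ≤ n := frontCountLE_le _ _ _ _
  have hveh' : ∀ j, (∀ t ∈ Ioo a b, x j - y a + (s j - σ) * (t - a) = 0) ∨
      ∀ t ∈ Ioo a b, x j - y a + (s j - σ) * (t - a) ≠ 0 := by
    intro j
    refine (hveh j).imp (fun h1 t ht => ?_) fun h1 t ht h2 => h1 t ht ?_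
    · have := h1 t ht
      rw [hy t (Ioo_subset_Icc_self ht)] at this
      linarith
    · rw [hy t (Ioo_subset_Icc_self ht)]
      linarith
  -- Fronts that start on one side of the vehicle stay there, so the trace indices `P` and `Q` are
  -- the same throughout the stage.
  have hneg : ∀ j, x j < y a → ∀ t ∈ Ioo a b, x j - y a + (s j - σ) * (t - a) < 0 :=
    fun j hj => affine_neg (sub_neg.2 hj) (hveh' j)
  have hpos : ∀ j, y a < x j → ∀ t ∈ Ioo a b, 0 < x j - y a + (s j - σ) * (t - a) := by
    intro j hj t ht
    have := affine_neg (c := -(x j - y a)) (d := -(s j - σ)) (a := a) (b := b) (by linarith)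
      ((hveh' j).imp (fun h1 t ht => by linarith [h1 t ht])
        fun h1 t ht h2 => h1 t ht (by linarith)) t ht
    linarith
  have hcountLE : ∀ t ∈ Ioo a b, countLE (X t) (y t) = Q := by
    intro t ht
    have ht' : 0 < t - a := sub_pos.2 ht.1
    refine nat_eq_of_fin_lt_iff (countLE_le _ _) hQn fun j => ?_
    rw [lt_countLE_iff (hstrict t ht).monotone, hQ, hlex.lt_frontCountLE_iff,
      hy t (Ioo_subset_Icc_self ht)]
    rcases lt_trichotomy (x j) (y a) with hj | hj | hj
    · exact iff_of_true (by linarith [hneg j hj t ht]) (Or.inl hj)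
    · rw [hj]
      constructor
      · intro h1
        refine Or.inr ⟨rfl, ?_⟩
        by_contra hcon
        nlinarith
      · rintro (h1 | h1)
        · exact absurd h1 (lt_irrefl _)
        · nlinarith [h1.2]
    · refine iff_of_false (by linarith [hpos j hj t ht]) ?_
      rintro (h1 | ⟨h1, -⟩) <;> linarith
  have hcountLT : ∀ t ∈ Ioo a b, countLT (X t) (y t) = P := by
    intro t ht
    have ht' : 0 < t - a := sub_pos.2 ht.1
    refine nat_eq_of_fin_lt_iff ((countLT_le_countLE _ _).trans (countLE_le _ _)) hPn
      fun j => ?_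
    rw [lt_countLT_iff (hstrict t ht).monotone, hP, hlex.lt_frontCountLT_iff,
      hy t (Ioo_subset_Icc_self ht)]
    rcases lt_trichotomy (x j) (y a) with hj | hj | hj
    · exact iff_of_true (by linarith [hneg j hj t ht]) (Or.inl hj)
    · rw [hj]
      constructor
      · intro h1
        refine Or.inr ⟨rfl, ?_⟩
        by_contra hcon
        nlinarith
      · rintro (h1 | h1)
        · exact absurd h1 (lt_irrefl _)
        · nlinarith [h1.2]
    · refine iff_of_false (by linarith [hpos j hj t ht]) ?_
      rintro (h1 | ⟨h1, -⟩) <;> linarith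
  have hQP : Q ≤ P + 1 := by
    rw [← hcountLE _ hmid, ← hcountLT _ hmid]
    exact countLE_le_countLT_add_one (hstrict _ hmid) _
  have hPQ : P ≤ Q := frontCountLT_le _ _ _ _
  -- one sided limits of the Riemann solutions along a front
  have hev : ∀ z σ', ∀ᶠ ξ in 𝓝[<] σ', w (frontCountLE x s z ξ) = w (frontCountLT x s z σ') :=
    fun z σ' => by
      filter_upwards [eventually_frontCountLE_eq x s z σ'] with ξ hξ
      rw [hξ]
  have hjump_cl : ∀ j : Fin n, (x j ≠ y a ∨ ¬ ConstraintViolated R α v M (u a)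
      (w (countLT x (y a))) (w (countLE x (y a)))) →
      rhSpeed (flux v) (w j) (w (j + 1)) = s j ∧
      ((w (countLT x (x j)) < w (countLE x (x j)) ∧ w j = w (countLT x (x j)) ∧
          w (j + 1) = w (countLE x (x j))) ∨
        (w (countLE x (x j)) ≤ w (countLT x (x j)) ∧
          IsRarefactionFront M (w j) (w (j + 1)))) := by
    intro j hj
    have hcl' : ∀ ξ, classicalRiemann M (flux v) (w (countLT x (x j)))
        (w (countLE x (x j))) ξ = w (frontCountLE x s (x j) ξ) := by
      -- Where the constraint is not enforced the constrained solver is the classical one, so the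
      -- vehicle's position needs no separate treatment.
      by_cases hz : x j = y a
      · have hnv := hj.resolve_left (not_not.2 hz)
        intro ξ
        rw [hz, ← hco ξ, constrainedRiemann, if_neg hnv]
      · exact hcl _ hz
    refine classicalRiemann_jump hF hM hMR (hmemLT _) ?_ ?_ (hne j j.2)
    · have := hev (x j) (s j)
      rw [hlex.frontCountLT_self] at this
      filter_upwards [this] with ξ hξ
      rw [hcl', hξ]
    · rw [hcl', hlex.frontCountLE_self]
  have hjump_co : ∀ j : Fin n, x j = y a → ConstraintViolated R α v M (u a)
      (w (countLT x (y a))) (w (countLE x (y a))) → _ := fun j hj hv =>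
    constrainedRiemann_jump (s := s j) hF hM hMR hu (hmemLT (y a)) (hmemLE (y a)) hv
      (A := w j) (C := w (j + 1))
      (by
        have := hev (x j) (s j)
        rw [hlex.frontCountLT_self, hj] at this
        filter_upwards [this] with ξ hξ
        rw [hco, hξ])
      (by rw [hco, ← hj, hlex.frontCountLE_self]) (hne j j.2)
  have htrace := vehicle_traces (A := w P) (C := w Q) hF hM hMR hu (hmemLT (y a))
    (hmemLE (y a))
    (by
      filter_upwards [hev (y a) σ] with ξ hξ
      rw [hco, hξ])
    (by rw [hco])
  have hspeed : ∀ j : Fin n, rhSpeed (flux v) (w j) (w (j + 1)) = s j := by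
    intro j
    by_cases hj : x j = y a
    · by_cases hv : ConstraintViolated R α v M (u a) (w (countLT x (y a)))
        (w (countLE x (y a)))
      · exact (hjump_co j hj hv).1
      · exact (hjump_cl j (Or.inr hv)).1
    · exact (hjump_cl j (Or.inl hj)).1
  have hgroup : ∀ z j, countLT x z ≤ j → j < countLE x z → ∃ hjn : j < n, x ⟨j, hjn⟩ = z := by
    intro z j h1 h2
    have hjn : j < n := h2.trans_le (countLE_le _ _)
    exact ⟨hjn, (mem_Ico_count_iff hlex.monotone ⟨j, hjn⟩ z).1 (Finset.mem_Ico.2 ⟨h1, h2⟩)⟩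
  have hchain : ∀ z, (z ≠ y a ∨ ¬ ConstraintViolated R α v M (u a) (w (countLT x (y a)))
      (w (countLE x (y a)))) → IsClassicalChain M w (countLT x z) (countLE x z)
      (w (countLT x z)) (w (countLE x z)) := by
    intro z hz j h1 h2
    obtain ⟨hjn, rfl⟩ := hgroup z j h1 h2
    exact (hjump_cl ⟨j, hjn⟩ hz).2
  have hviol_spec : ConstraintViolated R α v M (u a) (w (countLT x (y a)))
      (w (countLE x (y a))) → σ = u a ∧ w P = rhoHat R α v (u a) ∧
        w Q = rhoCheck R α v (u a) ∧ Q = P + 1 := by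
    intro hv
    have hσu : σ = u a := by rw [hσ, vehicleSpeed, if_pos hv]
    obtain ⟨h1, h2⟩ := constrainedRiemann_traces hF hM hMR hu (hmemLT (y a)) (hmemLE (y a)) hv
    rw [← hσu] at h1 h2
    have hwP : w P = rhoHat R α v σ := by
      obtain ⟨ξ, h3, h4⟩ := (h1.and (hev (y a) σ)).exists
      rw [← h3, hσu, hco, h4]
    have hwQ : w Q = rhoCheck R α v σ := by
      rw [← h2, hσu, hco, hQ, hσu]
    rw [hσu] at hwP hwQ
    refine ⟨hσu, hwP, hwQ, ?_⟩
    have h3 := ((constraintViolated_iff hF hM hMR hu (hmemLT (y a)) (hmemLE (y a))).1 hv).2.2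
    have hne' : P ≠ Q := by
      intro he
      rw [he, hwQ] at hwP
      linarith
    omega
  set γ : ℝ := if w P = rhoHat R α v (u a) ∧ w Q = rhoCheck R α v (u a) then
    -2 * (rhoHat R α v (u a) - rhoCheck R α v (u a)) else 0 with hγ
  refine ⟨n, w, x, X b, P, Q, γ, ⟨hmem, hne, hlex.monotone, hρa, fun z hz => hchain z (Or.inl hz),
    ?_, ?_⟩, ⟨hmem, hne, hXb, hρ b ⟨hab.le, le_rfl⟩, ?_, ?_, hPQ, hQP, ?_, ?_, ?_, ?_, ?_⟩, ?_⟩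
  · rw [hγ]
    split_ifs
    exacts [Or.inr rfl, Or.inl rfl]
  · by_cases hv : ConstraintViolated R α v M (u a) (w (countLT x (y a)))
      (w (countLE x (y a)))
    · right
      obtain ⟨h1, h2, h3⟩ :=
        (constraintViolated_iff hF hM hMR hu (hmemLT (y a)) (hmemLE (y a))).1 hv
      obtain ⟨hσu, hwP, hwQ, hQP1⟩ := hviol_spec hv
      refine ⟨h1, h2, h3, by rw [hγ, if_pos ⟨hwP, hwQ⟩], P, countLT_le_frontCountLT _ _ _ _, ?_,
        hwP, by rw [← hQP1]; exact hwQ, ?_, ?_⟩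
      · have : Q ≤ countLE x (y a) := frontCountLE_le_countLE _ _ _ _
        omega
      · intro j h4 h5
        have hPc : Q ≤ countLE x (y a) := frontCountLE_le_countLE _ _ _ _
        obtain ⟨hjn, hxj⟩ := hgroup (y a) j h4 (by omega)
        have h6 := (hlex.lt_frontCountLT_iff (y a) σ ⟨j, hjn⟩).1 h5
        have h7 : s ⟨j, hjn⟩ < u a := by
          rcases h6 with h6 | h6
          · rw [hxj] at h6; exact absurd h6 (lt_irrefl _)
          · rw [← hσu]; exact h6.2
        rcases (hjump_co ⟨j, hjn⟩ hxj hv).2 with h8 | h8 | h8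
        · exact h8.2
        · linarith [h8.1]
        · linarith [h8.1]
      · intro j h4 h5
        have hPc : countLT x (y a) ≤ P := countLT_le_frontCountLT _ _ _ _
        obtain ⟨hjn, hxj⟩ := hgroup (y a) j (by omega) h5
        have h6 := (hlex.lt_frontCountLE_iff (y a) σ ⟨j, hjn⟩).not.1
          (by simp only; omega)
        have h7 : u a < s ⟨j, hjn⟩ := by
          by_contra hcon
          exact h6 (Or.inr ⟨hxj, by rw [hσu]; exact not_lt.1 hcon⟩)
        rcases (hjump_co ⟨j, hjn⟩ hxj hv).2 with h8 | h8 | h8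
        · linarith [h8.1]
        · linarith [h8.1]
        · exact h8.2
    · left
      refine ⟨?_, hchain _ (Or.inr hv)⟩
      by_contra hcon
      push Not at hcon
      have hv' := (constraintViolated_iff hF hM hMR hu (hmemLT (y a)) (hmemLE (y a))).not.1 hv
      -- Only the degenerate case is left, in which both contact densities are `0`; a right state
      -- below `ρ̂ = 0` is impossible.
      have hle : rhoHat R α v (u a) ≤ rhoCheck R α v (u a) := by
        by_contra h3
        exact hv' ⟨hcon.1, hcon.2, not_le.1 h3⟩
      have h0 := hu.hat_eq_zero hle
      linarith [(hMR (hmemLE (y a))).1]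
  -- Of two successive falling jumps the right one is strictly faster and is already ahead inside
  -- the stage, so they cannot end at one point. Every front has its Rankine–Hugoniot speed, so this
  -- covers undercompressive shocks too.
  · rintro z j h1 h2 ⟨h3, h4⟩
    have hj1 : j + 1 < n := h2.trans_le (countLE_le _ _)
    have e1 := (mem_Ico_count_iff hXb ⟨j, by omega⟩ z).1 (Finset.mem_Ico.2 ⟨h1, by simp only; omega⟩)
    have e2 := (mem_Ico_count_iff hXb ⟨j + 1, hj1⟩ z).1
      (Finset.mem_Ico.2 ⟨by simp only; omega, h2⟩)
    have h5 := (hF.rhSpeed_lt (hMR (hmem (j + 2) (by omega))) (hMR (hmem j (by omega))) h4 h3)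
    rw [rhSpeed_comm _ (w (j + 1)), rhSpeed_comm _ (w (j + 2)) (w (j + 1))] at h5
    have h6 := hspeed ⟨j, by omega⟩
    have h7 := hspeed ⟨j + 1, hj1⟩
    simp only at h6 h7
    have h8 := hstrict _ hmid (show (⟨j, by omega⟩ : Fin n) < ⟨j + 1, hj1⟩ from
      Fin.mk_lt_mk.2 (Nat.lt_succ_self j))
    simp only [hXdef] at e1 e2 h8
    have h9 : s ⟨j, by omega⟩ < s ⟨j + 1, hj1⟩ := by
      rw [← h6, ← h7]
      exact h5.1.trans h5.2
    nlinarith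
  · refine Finset.card_le_card fun j hj => ?_
    simp only [Finset.mem_filter, Finset.mem_univ, true_and] at hj ⊢
    rw [hy b ⟨hab.le, le_rfl⟩] at hj
    simp only [hXdef] at hj
    rcases lt_trichotomy (x j) (y a) with h1 | h1 | h1
    · exact Or.inl h1
    · refine Or.inr ⟨h1, ?_⟩
      by_contra hcon
      nlinarith
    · have := (affine_nonneg_endpoints hab fun t ht => (hpos j h1 t ht).le).2
      linarith
  · refine Finset.card_le_card fun j hj => ?_
    simp only [Finset.mem_filter, Finset.mem_univ, true_and] at hj ⊢
    rw [hy b ⟨hab.le, le_rfl⟩]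
    simp only [hXdef]
    rcases hj with h1 | h1
    · have := (affine_nonneg_endpoints (c := -(x j - y a)) (d := -(s j - σ)) hab
        fun t ht => by linarith [hneg j h1 t ht]).2
      linarith
    · nlinarith [h1.1, h1.2]
  · rw [← hu.capacity_lt_iff _ (hMR (hmem _ hPn))]
    exact not_lt.2 htrace.1
  · rw [← hu.capacity_lt_iff _ (hMR (hmem _ hQn))]
    exact not_lt.2 htrace.2
  · intro j hj
    by_cases hxj : x ⟨j, hj⟩ = y a
    · by_cases hv : ConstraintViolated R α v M (u a) (w (countLT x (y a)))
        (w (countLE x (y a)))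
      · rcases (hjump_co ⟨j, hj⟩ hxj hv).2 with ⟨-, h1 | h1⟩ | h1 | ⟨-, h1 | h1⟩
        · left; simp only at h1; rw [h1.2.1, h1.2.2]; exact h1.1
        · exact Or.inr (Or.inl h1.2)
        · obtain ⟨hσu, hwP, hwQ, hQP1⟩ := hviol_spec hv
          refine Or.inr (Or.inr ⟨?_, hQP1, hwP, hwQ⟩)
          have := hlex.frontCountLT_self ⟨j, hj⟩
          rw [hxj, h1.1, ← hσu] at this
          exact this.symm
        · left; simp only at h1; rw [h1.2.1, h1.2.2]; exact h1.1
        · exact Or.inr (Or.inl h1.2)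
      · rcases (hjump_cl ⟨j, hj⟩ (Or.inr hv)).2 with h1 | h1
        · left; simp only at h1; rw [h1.2.1, h1.2.2]; exact h1.1
        · exact Or.inr (Or.inl h1.2)
    · rcases (hjump_cl ⟨j, hj⟩ (Or.inl hxj)).2 with h1 | h1
      · left; simp only at h1; rw [h1.2.1, h1.2.2]; exact h1.1
      · exact Or.inr (Or.inl h1.2)
  · by_cases hc : w P = rhoHat R α v (u a) ∧ w Q = rhoCheck R α v (u a)
    · exact Or.inl ⟨hc.1, hc.2, by rw [hγ, if_pos hc]⟩
    · exact Or.inr ⟨hc, by rw [hγ, if_neg hc]⟩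
  · intro t ht
    have hρt := hρ t (Ioo_subset_Icc_self ht)
    have hs : StrictMono (X t) := hstrict t ht
    refine ⟨by rw [hρt, eVariationOn_stepProfile hs], ?_, ?_⟩
    · rw [waveCount, hρt, ncard_discontinuities_stepProfile hs hne]
    · rw [gammaTerm, hρt, leftLim_stepProfile, rightLim_stepProfile, hcountLE t ht,
        hcountLT t ht, h.control_const t ⟨ht.1.le, ht.2⟩]

end Stage

section Chain

variable {R β B α : ℝ} {v : ℝ → ℝ} {M : Set ℝ} {δ : ℝ} {w w' : ℕ → ℝ} {p q p' q' : ℕ}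

/-! ### Chains of states -/

/-- The total variation of the chain `w p, …, w q`. -/
def chainVar (w : ℕ → ℝ) (p q : ℕ) : ℝ := ∑ j ∈ Finset.Ico p q, |w (j + 1) - w j|

theorem chainVar_add {P : ℕ} (w : ℕ → ℝ) (h1 : p ≤ P) (h2 : P ≤ q) :
    chainVar w p q = chainVar w p P + chainVar w P q :=
  (Finset.sum_Ico_consecutive _ h1 h2).symm

theorem chainVar_succ (w : ℕ → ℝ) (p : ℕ) : chainVar w p (p + 1) = |w (p + 1) - w p| := by
  simp [chainVar]

theorem abs_sub_le_chainVar (w : ℕ → ℝ) (hpq : p ≤ q) : |w q - w p| ≤ chainVar w p q := by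
  rw [← Finset.sum_Ico_sub w hpq]
  exact Finset.abs_sum_le_sum_abs _ _

theorem chainVar_of_up (hpq : p ≤ q) (h : ∀ j, p ≤ j → j < q → w j < w (j + 1)) :
    chainVar w p q = w q - w p := by
  rw [← Finset.sum_Ico_sub w hpq]
  refine Finset.sum_congr rfl fun j hj => abs_of_pos (sub_pos.2 ?_)
  exact h j (Finset.mem_Ico.1 hj).1 (Finset.mem_Ico.1 hj).2

theorem chainVar_of_down (hpq : p ≤ q) (h : ∀ j, p ≤ j → j < q → w (j + 1) < w j) :
    chainVar w p q = w p - w q := by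
  have : w p - w q = -(w q - w p) := by ring
  rw [this, ← Finset.sum_Ico_sub w hpq, ← Finset.sum_neg_distrib]
  refine Finset.sum_congr rfl fun j hj => abs_of_neg (sub_neg.2 ?_)
  exact h j (Finset.mem_Ico.1 hj).1 (Finset.mem_Ico.1 hj).2

theorem le_of_up {i k : ℕ} (h : ∀ j, p ≤ j → j < q → w j < w (j + 1)) (hi : p ≤ i) (hik : i ≤ k)
    (hk : k ≤ q) : w i ≤ w k := by
  have := chainVar_of_up hik fun j h1 h2 => h j (hi.trans h1) (h2.trans_le hk)
  have h0 : 0 ≤ chainVar w i k := Finset.sum_nonneg fun _ _ => abs_nonneg _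
  linarith

theorem lt_of_up (hpq : p < q) (h : ∀ j, p ≤ j → j < q → w j < w (j + 1)) : w p < w q :=
  (h p le_rfl hpq).trans_le (le_of_up h (Nat.le_succ p) hpq le_rfl)

theorem le_of_down {i k : ℕ} (h : ∀ j, p ≤ j → j < q → w (j + 1) < w j) (hi : p ≤ i)
    (hik : i ≤ k) (hk : k ≤ q) : w k ≤ w i := by
  have := chainVar_of_down hik fun j h1 h2 => h j (hi.trans h1) (h2.trans_le hk)
  have h0 : 0 ≤ chainVar w i k := Finset.sum_nonneg fun _ _ => abs_nonneg _
  linarith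

theorem lt_of_down (hpq : p < q) (h : ∀ j, p ≤ j → j < q → w (j + 1) < w j) : w q < w p :=
  (le_of_down h (Nat.le_succ p) hpq le_rfl).trans_lt (h p le_rfl hpq)

/-- The points of `M` have mutual distance at least `δ`. -/
def IsSeparatedBy (M : Set ℝ) (δ : ℝ) : Prop := ∀ a ∈ M, ∀ b ∈ M, a < b → δ ≤ b - a

/-- A chain of states is increasing, decreasing, or its variation exceeds the distance of its ends
by the mesh size. -/
theorem chain_cases (hδ : IsSeparatedBy M δ) (hpq : p ≤ q) (hmem : ∀ j ≤ q, w j ∈ M)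
    (hne : ∀ j < q, w j ≠ w (j + 1)) :
    (∀ j, p ≤ j → j < q → w j < w (j + 1)) ∨ (∀ j, p ≤ j → j < q → w (j + 1) < w j) ∨
      |w p - w q| + δ ≤ chainVar w p q := by
  by_cases h1 : ∀ j, p ≤ j → j < q → w j < w (j + 1)
  · exact Or.inl h1
  by_cases h2 : ∀ j, p ≤ j → j < q → w (j + 1) < w j
  · exact Or.inr (Or.inl h2)
  right; right
  push Not at h1 h2
  obtain ⟨i, hi1, hi2, hi3⟩ := h1
  obtain ⟨k, hk1, hk2, hk3⟩ := h2
  have hi3 := lt_of_le_of_ne hi3 (hne i hi2).symm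
  have hk3 := lt_of_le_of_ne hk3 (hne k hk2)
  have hdi := hδ _ (hmem (i + 1) hi2) _ (hmem i hi2.le) hi3
  have hdk := hδ _ (hmem k hk2.le) _ (hmem (k + 1) hk2) hk3
  -- The variation minus the net change counts each falling step twice, and their sum counts each
  -- rising step twice. One step of each kind therefore gives an excess over both signs of the net
  -- change.
  have e1 : chainVar w p q - (w q - w p) =
      ∑ j ∈ Finset.Ico p q, (|w (j + 1) - w j| - (w (j + 1) - w j)) := by
    rw [Finset.sum_sub_distrib, Finset.sum_Ico_sub w hpq, chainVar]
  have e2 : chainVar w p q + (w q - w p) =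
      ∑ j ∈ Finset.Ico p q, (|w (j + 1) - w j| + (w (j + 1) - w j)) := by
    rw [Finset.sum_add_distrib, Finset.sum_Ico_sub w hpq, chainVar]
  have f1 := Finset.single_le_sum (f := fun j => |w (j + 1) - w j| - (w (j + 1) - w j))
    (fun j _ => sub_nonneg.2 (le_abs_self _)) (Finset.mem_Ico.2 ⟨hi1, hi2⟩)
  have f2 := Finset.single_le_sum (f := fun j => |w (j + 1) - w j| + (w (j + 1) - w j))
    (fun j _ => by linarith [neg_abs_le (w (j + 1) - w j)]) (Finset.mem_Ico.2 ⟨hk1, hk2⟩)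
  rw [← e1] at f1
  rw [← e2] at f2
  rw [abs_of_neg (by linarith)] at f1
  rw [abs_of_pos (by linarith)] at f2
  rcases abs_cases (w p - w q) with h | h <;> linarith

/-- An outgoing classical solution is monotone, so its variation is minimal. It is a single front
when it rises, or when no grid point lies strictly between its end states. -/
theorem IsClassicalChain.spec {l r : ℝ} (h : IsClassicalChain M w p q l r) (hpq : p ≤ q)
    (hl : w p = l) (hr : w q = r) (hmem : ∀ j ≤ q, w j ∈ M) :
    chainVar w p q = |l - r| ∧ (l < r → q ≤ p + 1) ∧ (l = r → q = p) ∧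
      (IsRarefactionFront M l r → q ≤ p + 1) := by
  rcases lt_or_ge l r with hlr | hlr
  · have h' : ∀ j, p ≤ j → j < q → w j = l ∧ w (j + 1) = r := by
      intro j h1 h2
      rcases h j h1 h2 with h3 | h3
      · exact h3.2
      · exact absurd h3.1 (not_le.2 hlr)
    have hq : q ≤ p + 1 := by
      by_contra hcon
      push Not at hcon
      have h1 := (h' p le_rfl (by omega)).2
      have h2 := (h' (p + 1) (by omega) (by omega)).1
      linarith
    refine ⟨?_, fun _ => hq, fun he => absurd he hlr.ne, fun _ => hq⟩
    rw [chainVar_of_up hpq fun j h1 h2 => by rw [(h' j h1 h2).1, (h' j h1 h2).2]; exact hlr,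
      hl, hr, abs_of_neg (by linarith)]
    ring
  · have h' : ∀ j, p ≤ j → j < q → w (j + 1) < w j := by
      intro j h1 h2
      rcases h j h1 h2 with h3 | h3
      · exact absurd h3.1 (not_lt.2 hlr)
      · exact h3.2.2.2.1
    refine ⟨?_, fun h1 => absurd h1 (not_lt.2 hlr), fun he => ?_, fun hrf => ?_⟩
    · rw [chainVar_of_down hpq h', hl, hr, abs_of_nonneg (by linarith)]
    · by_contra hcon
      have := lt_of_down (by omega : p < q) h'
      linarith
    · by_contra hcon
      push Not at hcon
      have h1 := h' p le_rfl (by omega)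
      have h2 := lt_of_down (p := p + 1) hcon fun j h1 h2 => h' j (by omega) h2
      have h3 := hrf.2.2.2 (w (p + 1)) (hmem _ hcon.le) (by linarith)
      linarith

/-- An interaction away from undercompressive shocks. -/
theorem classical_interaction (hδ : IsSeparatedBy M δ) (hpq : p ≤ q) (hpq' : p' ≤ q')
    (hmem : ∀ j ≤ q, w j ∈ M) (hne : ∀ j < q, w j ≠ w (j + 1)) (hmem' : ∀ j ≤ q', w' j ∈ M)
    (hp : w' p' = w p) (hq : w' q' = w q)
    (hdouble : ∀ j, p ≤ j → j + 1 < q → ¬ (w (j + 1) < w j ∧ w (j + 2) < w (j + 1)))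
    (hfront : ∀ j, p ≤ j → j < q → w j < w (j + 1) ∨ IsRarefactionFront M (w j) (w (j + 1)))
    (hout : IsClassicalChain M w' p' q' (w' p') (w' q')) :
    chainVar w' p' q' + δ ≤ chainVar w p q ∨
      (chainVar w' p' q' = chainVar w p q ∧ q' - p' ≤ q - p) := by
  obtain ⟨h1, h2, h3, h4⟩ := hout.spec hpq' rfl rfl hmem'
  rw [hp, hq] at h1 h2 h3 h4
  rcases hpq.eq_or_lt with rfl | hlt
  · right
    have := h3 rfl
    rw [h1]
    simp [chainVar, this]
  rcases chain_cases hδ hpq hmem hne with h | h | h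
  · right
    have := lt_of_up hlt h
    have h5 := h2 this
    rw [h1, chainVar_of_up hpq h, abs_of_neg (by linarith)]
    exact ⟨by ring, by omega⟩
  · right
    have hq1 : q = p + 1 := by
      by_contra hcon
      exact hdouble p le_rfl (by omega) ⟨h p le_rfl hlt, h (p + 1) (by omega) (by omega)⟩
    subst hq1
    have h5 := h p le_rfl hlt
    have h6 := h4 ((hfront p le_rfl hlt).resolve_left (not_lt.2 h5.le))
    rw [h1, chainVar_of_down hpq h, abs_of_pos (by linarith)]
    exact ⟨rfl, by omega⟩
  · left
    rw [h1]
    exact h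

end Chain

/-! ### Interactions at the vehicle -/

section Vehicle

variable {R β B α : ℝ} {v : ℝ → ℝ} {M : Set ℝ} {δ : ℝ} {w w' : ℕ → ℝ} {n n' : ℕ}
  {X : Fin n → ℝ} {X' : Fin n' → ℝ} {r : ℝ → ℝ} {z₀ u u' γ γ' : ℝ} {P Q : ℕ}

/-- Both chains describe the same profile at the common time, so their one-sided limits agree even
though the indices differ. -/
theorem IsOutgoing.left_state (h : IsIncoming R α v M r z₀ u w X P Q γ)
    (h' : IsOutgoing R α v M r z₀ u' w' X' γ') (z : ℝ) :
    w' (countLT X' z) = w (countLT X z) := by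
  rw [← leftLim_stepProfile X' w' z, ← leftLim_stepProfile X w z, ← h.profile, ← h'.profile]

theorem IsOutgoing.right_state (h : IsIncoming R α v M r z₀ u w X P Q γ)
    (h' : IsOutgoing R α v M r z₀ u' w' X' γ') (z : ℝ) :
    w' (countLE X' z) = w (countLE X z) := by
  rw [← stepProfile_eq X' w' z, ← stepProfile_eq X w z, ← h.profile, ← h'.profile]

theorem IsIncoming.interaction_of_ne (hδ : IsSeparatedBy M δ)
    (h : IsIncoming R α v M r z₀ u w X P Q γ) (h' : IsOutgoing R α v M r z₀ u' w' X' γ')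
    {z : ℝ} (hz : z ≠ z₀) :
    chainVar w' (countLT X' z) (countLE X' z) + δ ≤ chainVar w (countLT X z) (countLE X z) ∨
      (chainVar w' (countLT X' z) (countLE X' z) = chainVar w (countLT X z) (countLE X z) ∧
        countLE X' z - countLT X' z ≤ countLE X z - countLT X z) := by
  have hn := countLE_le X z
  have hn' := countLE_le X' z
  refine classical_interaction hδ (countLT_le_countLE X z) (countLT_le_countLE X' z)
    (fun j hj => h.mem j (hj.trans hn)) (fun j hj => h.ne j (hj.trans_le hn))
    (fun j hj => h'.mem j (hj.trans hn')) (h'.left_state h z) (h'.right_state h z)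
    (h.no_double z) (fun j h1 h2 => ?_) (h'.classical z hz)
  rcases h.front j (h2.trans_le hn) with h3 | h3 | ⟨h3, h4, -, -⟩
  · exact Or.inl h3
  · exact Or.inr h3
  -- The undercompressive front ends at the vehicle, hence not at a point other than `z₀`.
  · exfalso
    have hjn : j < n := h2.trans_le hn
    have e1 := (mem_Ico_count_iff h.mono ⟨j, hjn⟩ z).1 (Finset.mem_Ico.2 ⟨h1, h2⟩)
    have e2 := (mem_Ico_count_iff h.mono ⟨j, hjn⟩ z₀).1
      (Finset.mem_Ico.2 ⟨h3 ▸ h.le_P, by have := h.Q_le_count; simp only; omega⟩)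
    exact hz (e1.symm.trans e2)

/-- Upper bounds for the contribution of the vehicle after an interaction. -/
theorem IsOutgoing.vehicle_bound (hkh : rhoCheck R α v u' ≤ rhoHat R α v u')
    (h' : IsOutgoing R α v M r z₀ u' w' X' γ') :
    chainVar w' (countLT X' z₀) (countLE X' z₀) + γ' ≤
        |w' (countLT X' z₀) - w' (countLE X' z₀)| ∧
      chainVar w' (countLT X' z₀) (countLE X' z₀) + γ' ≤
        |w' (countLT X' z₀) - rhoHat R α v u'| + |w' (countLE X' z₀) - rhoCheck R α v u'| -
          (rhoHat R α v u' - rhoCheck R α v u') := by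
  have hn' := countLE_le X' z₀
  have hpq := countLT_le_countLE X' z₀
  have hmem : ∀ j ≤ countLE X' z₀, w' j ∈ M := fun j hj => h'.mem j (hj.trans hn')
  rcases h'.vehicle with ⟨h1, h2⟩ | ⟨h1, h2, h3, h4, P', h5, h6, h7, h8, h9, h10⟩
  · have hγ : γ' ≤ 0 := by rcases h'.gamma with h | h <;> rw [h]; linarith
    rw [(h2.spec hpq rfl rfl hmem).1]
    refine ⟨by linarith, ?_⟩
    -- If `l ≤ ρ̌`, then `|l - ρ̂| - (ρ̂ - ρ̌) = |l - ρ̌|` and the triangle inequality through `ρ̌`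
    -- suffices. If `ρ̂ ≤ r`, the inequality through `ρ̂` does.
    rcases h1 with h1 | h1
    · rw [abs_of_nonpos (by linarith : w' (countLT X' z₀) - rhoHat R α v u' ≤ 0)]
      have := abs_sub_le (w' (countLT X' z₀)) (rhoCheck R α v u') (w' (countLE X' z₀))
      rw [abs_of_nonpos (by linarith : w' (countLT X' z₀) - rhoCheck R α v u' ≤ 0),
        abs_sub_comm (rhoCheck R α v u')] at this
      linarith
    · rw [abs_of_nonneg (by linarith : 0 ≤ w' (countLE X' z₀) - rhoCheck R α v u')]
      have := abs_sub_le (w' (countLT X' z₀)) (rhoHat R α v u') (w' (countLE X' z₀))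
      rw [abs_of_nonpos (by linarith : rhoHat R α v u' - w' (countLE X' z₀) ≤ 0)] at this
      linarith
  · have e1 := (h9.spec h5 rfl h7 fun j hj => hmem j (hj.trans h6.le)).1
    have e2 := (h10.spec h6 h8 rfl hmem).1
    rw [chainVar_add w' h5 h6.le, chainVar_add w' (Nat.le_succ P') h6, chainVar_succ, e1, e2, h7,
      h8, h4, abs_of_neg (by linarith : rhoCheck R α v u' - rhoHat R α v u' < 0),
      abs_sub_comm (rhoCheck R α v u')]
    refine ⟨?_, by linarith⟩
    rcases abs_cases (w' (countLT X' z₀) - rhoHat R α v u') with h | h <;>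
    rcases abs_cases (w' (countLE X' z₀) - rhoCheck R α v u') with h' | h' <;>
    rcases abs_cases (w' (countLT X' z₀) - w' (countLE X' z₀)) with h'' | h'' <;> linarith

/-- Either the vehicle carries no proper undercompressive shock before the interaction, or its
traces are the contact densities. -/
theorem IsIncoming.vehicle_cases (hkh : rhoCheck R α v u ≤ rhoHat R α v u)
    (h : IsIncoming R α v M r z₀ u w X P Q γ) :
    (γ = 0 ∧ ∀ j < n, w j < w (j + 1) ∨ IsRarefactionFront M (w j) (w (j + 1))) ∨
      (rhoCheck R α v u < rhoHat R α v u ∧ γ = -2 * (rhoHat R α v u - rhoCheck R α v u) ∧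
        Q = P + 1 ∧ w P = rhoHat R α v u ∧ w (P + 1) = rhoCheck R α v u) := by
  rcases h.gamma with ⟨h1, h2, h3⟩ | ⟨h1, h2⟩
  · rcases hkh.eq_or_lt with heq | hlt
    · left
      refine ⟨by rw [h3, heq]; ring, fun j hj => ?_⟩
      rcases h.front j hj with h4 | h4 | ⟨h4, h5, h6, h7⟩
      · exact Or.inl h4
      · exact Or.inr h4
      · exfalso
        apply h.ne j hj
        rw [h4, h6, ← h5, h7, heq]
    · right
      have hPQ : P ≠ Q := by
        rintro rfl
        linarith
      have hQ : Q = P + 1 := by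
        have := h.P_le_Q
        have := h.Q_le
        omega
      exact ⟨hlt, h3, hQ, h1, hQ ▸ h2⟩
  · left
    refine ⟨h2, fun j hj => ?_⟩
    rcases h.front j hj with h4 | h4 | ⟨h4, h5, h6, h7⟩
    · exact Or.inl h4
    · exact Or.inr h4
    · exact absurd ⟨h6, h7⟩ h1

/-- Decomposition of the incoming chain at an undercompressive shock. -/
theorem IsIncoming.chainVar_vehicle (h : IsIncoming R α v M r z₀ u w X P Q γ)
    (hlt : rhoCheck R α v u < rhoHat R α v u) (hQ : Q = P + 1) (hP : w P = rhoHat R α v u)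
    (hP1 : w (P + 1) = rhoCheck R α v u) :
    chainVar w (countLT X z₀) (countLE X z₀) = chainVar w (countLT X z₀) P +
      (rhoHat R α v u - rhoCheck R α v u) + chainVar w (P + 1) (countLE X z₀) := by
  have h1 := h.Q_le_count
  rw [hQ] at h1
  rw [chainVar_add w h.le_P (by omega), chainVar_add w (Nat.le_succ P) h1, chainVar_succ, hP, hP1,
    abs_of_neg (by linarith)]
  ring

/-- An interaction at the vehicle at which the control jumps. -/
theorem IsIncoming.vehicle_jump {E : ℝ} (hkh : rhoCheck R α v u ≤ rhoHat R α v u)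
    (hkh' : rhoCheck R α v u' ≤ rhoHat R α v u')
    (h : IsIncoming R α v M r z₀ u w X P Q γ) (h' : IsOutgoing R α v M r z₀ u' w' X' γ')
    (hE1 : 3 * |rhoHat R α v u' - rhoHat R α v u| ≤ E)
    (hE2 : 3 * |rhoCheck R α v u' - rhoCheck R α v u| ≤ E)
    (hδ : δ ≤ |rhoHat R α v u' - rhoHat R α v u|)
    (hsign : 0 ≤ (rhoHat R α v u' - rhoHat R α v u) * (rhoCheck R α v u' - rhoCheck R α v u)) :
    chainVar w' (countLT X' z₀) (countLE X' z₀) + γ' ≤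
        chainVar w (countLT X z₀) (countLE X z₀) + γ ∨
      chainVar w' (countLT X' z₀) (countLE X' z₀) + γ' + δ ≤
        chainVar w (countLT X z₀) (countLE X z₀) + γ + E := by
  obtain ⟨b1, b2⟩ := h'.vehicle_bound hkh'
  rw [h'.left_state h, h'.right_state h] at b1 b2
  rcases h.vehicle_cases hkh with ⟨h1, -⟩ | ⟨h1, h2, h3, h4, h5⟩
  · left
    have := abs_sub_le_chainVar w (countLT_le_countLE X z₀)
    rw [abs_sub_comm] at this
    linarith
  · right
    have hQc := h.Q_le_count
    rw [h3] at hQc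
    have e1 := abs_sub_le_chainVar w h.le_P
    have e2 := abs_sub_le_chainVar w hQc
    rw [h4, abs_sub_comm] at e1
    rw [h5] at e2
    rw [h.chainVar_vehicle h1 h3 h4 h5]
    have t1 := abs_sub_le (w (countLT X z₀)) (rhoHat R α v u) (rhoHat R α v u')
    have t2 := abs_sub_le (w (countLE X z₀)) (rhoCheck R α v u) (rhoCheck R α v u')
    rw [abs_sub_comm (rhoHat R α v u)] at t1
    rw [abs_sub_comm (rhoCheck R α v u)] at t2
    -- The increments have equal signs, so two of the four terms cancel: the left side is twice the
    -- increment of `ρ̌` when both rise and twice that of `ρ̂`, in absolute value, when both fall.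
    have key : |rhoHat R α v u' - rhoHat R α v u| + |rhoCheck R α v u' - rhoCheck R α v u| -
        (rhoHat R α v u' - rhoHat R α v u) + (rhoCheck R α v u' - rhoCheck R α v u) ≤
        2 * max |rhoHat R α v u' - rhoHat R α v u| |rhoCheck R α v u' - rhoCheck R α v u| := by
      have m1 := le_max_left |rhoHat R α v u' - rhoHat R α v u|
        |rhoCheck R α v u' - rhoCheck R α v u|
      have m2 := le_max_right |rhoHat R α v u' - rhoHat R α v u|
        |rhoCheck R α v u' - rhoCheck R α v u|
      rcases abs_cases (rhoHat R α v u' - rhoHat R α v u) with ⟨a1, a2⟩ | ⟨a1, a2⟩ <;>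
      rcases abs_cases (rhoCheck R α v u' - rhoCheck R α v u) with ⟨a3, a4⟩ | ⟨a3, a4⟩
      · linarith
      · have : rhoHat R α v u' - rhoHat R α v u = 0 := by
          by_contra hne
          have := mul_neg_of_pos_of_neg (lt_of_le_of_ne a2 (Ne.symm hne)) a4
          linarith
        linarith
      · have : rhoCheck R α v u' - rhoCheck R α v u = 0 := by
          by_contra hne
          have := mul_neg_of_neg_of_pos a2 (lt_of_le_of_ne a4 (Ne.symm hne))
          linarith
        linarith
      · linarith
    have hmax : 3 * max |rhoHat R α v u' - rhoHat R α v u|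
        |rhoCheck R α v u' - rhoCheck R α v u| ≤ E := by
      rcases max_cases |rhoHat R α v u' - rhoHat R α v u|
        |rhoCheck R α v u' - rhoCheck R α v u| with h | h <;> rw [h.1] <;> assumption
    have hδ' := hδ.trans (le_max_left |rhoHat R α v u' - rhoHat R α v u|
        |rhoCheck R α v u' - rhoCheck R α v u|)
    linarith

/-- An interaction at the vehicle at which the control does not jump. -/
theorem IsIncoming.vehicle_interaction (hδ : IsSeparatedBy M δ)
    (hkh : rhoCheck R α v u ≤ rhoHat R α v u) (hkM : rhoCheck R α v u ∈ M)
    (hhM : rhoHat R α v u ∈ M) (h : IsIncoming R α v M r z₀ u w X P Q γ)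
    (h' : IsOutgoing R α v M r z₀ u w' X' γ') :
    chainVar w' (countLT X' z₀) (countLE X' z₀) + γ' + δ ≤
        chainVar w (countLT X z₀) (countLE X z₀) + γ ∨
      (chainVar w' (countLT X' z₀) (countLE X' z₀) + γ' =
          chainVar w (countLT X z₀) (countLE X z₀) + γ ∧
        countLE X' z₀ - countLT X' z₀ ≤ countLE X z₀ - countLT X z₀) := by
  have hn := countLE_le X z₀
  have hn' := countLE_le X' z₀
  have hpq := countLT_le_countLE X z₀
  have hpq' := countLT_le_countLE X' z₀
  have hmem : ∀ j ≤ countLE X z₀, w j ∈ M := fun j hj => h.mem j (hj.trans hn)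
  have hne : ∀ j < countLE X z₀, w j ≠ w (j + 1) := fun j hj => h.ne j (hj.trans_le hn)
  have hmem' : ∀ j ≤ countLE X' z₀, w' j ∈ M := fun j hj => h'.mem j (hj.trans hn')
  have hl := h'.left_state h z₀
  have hr := h'.right_state h z₀
  have hlM := hmem _ hpq
  have hrM := hmem _ le_rfl
  have hb := (h'.vehicle_bound hkh).2
  rw [hl, hr] at hb
  -- Distinct contact densities are grid points, so a nonzero `γ'` is at most `-2 δ`; it can only
  -- help.
  have hγ' : γ' = 0 ∨ γ' + δ ≤ 0 := by
    rcases h'.gamma with hg | hg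
    · exact Or.inl hg
    · rcases hkh.eq_or_lt with heq | hlt
      · left; rw [hg, heq]; ring
      · right
        have := hδ _ hkM _ hhM hlt
        linarith
  have hQc := h.Q_le_count
  have hPQ := h.P_le_Q
  have hpP := h.le_P
  have hdouble := h.no_double z₀
  have htr := h.trace_P
  rcases h.vehicle_cases hkh with ⟨h1, h2⟩ | ⟨hlt, h2, h3, h4, h5⟩
  · rcases h'.vehicle with ⟨-, hc⟩ | ⟨hv1, hv2, hv3, -, -⟩
    · have := classical_interaction hδ hpq hpq' hmem hne hmem' hl hr hdouble
        (fun j _ hj => h2 j (hj.trans_le hn)) hc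
      rcases this with h3 | ⟨h3, h4⟩
      · left
        rcases hγ' with hg | hg
        · linarith
        · have hγ0 : γ' ≤ 0 := by rcases h'.gamma with h | h <;> rw [h]; linarith
          linarith
      · rcases hγ' with hg | hg
        · right
          exact ⟨by linarith, h4⟩
        · left; linarith
    · left
      rw [hl] at hv1
      rw [hr] at hv2
      rw [h1, add_zero]
      set l := w (countLT X z₀)
      set rr := w (countLE X z₀)
      rcases chain_cases hδ hpq hmem hne with h3 | h3 | h3
      -- In a rising chain from a state above `ρ̌` to one below `ρ̂`, the trace at the vehicle would
      -- violate the constraint.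
      · exfalso
        refine htr ⟨hv1.trans_le (le_of_up h3 le_rfl hpP (hPQ.trans hQc)),
          (le_of_up h3 hpP (hPQ.trans hQc) le_rfl).trans_lt hv2⟩
      · rcases hpq.eq_or_lt with heq | hplt
        · exfalso
          have hPp : P = countLT X z₀ := by omega
          have hlr : l = rr := by simp only [l, rr, ← heq]
          refine htr ⟨by rw [hPp]; exact hv1, ?_⟩
          rw [hPp]
          exact hlr.trans_lt hv2
        · have hlr : rr < l := lt_of_down hplt h3
          rw [chainVar_of_down hpq h3]
          -- The falling chain has variation `l - r`. According to the positions of `l` and `r`, the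
          -- drop is twice `l - ρ̌`, `ρ̂ - r`, `ρ̂ - ρ̌` or `l - r`, each a distance between
          -- distinct grid points.
          refine (add_le_add_left hb δ).trans ?_
          have d1 := hδ _ hkM _ hlM hv1
          have d2 := hδ _ hrM _ hhM hv2
          have d3 := hδ _ hkM _ hhM hv3
          have d4 := hδ _ hrM _ hlM hlr
          rcases abs_cases (l - rhoHat R α v u) with a1 | a1 <;>
          rcases abs_cases (rr - rhoCheck R α v u) with a2 | a2 <;> rw [a1.1, a2.1] <;> linarith
      · refine le_trans ?_ h3
        have := (h'.vehicle_bound hkh).1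
        rw [hl, hr] at this
        linarith
  · rw [h3] at hQc
    rw [h.chainVar_vehicle hlt h3 h4 h5, h2]
    have e1 := abs_sub_le_chainVar w hpP
    have e2 := abs_sub_le_chainVar w hQc
    rw [h4, abs_sub_comm] at e1
    rw [h5] at e2
    set l := w (countLT X z₀)
    set rr := w (countLE X z₀)
    -- fronts on the left of the vehicle are shocks, unless the variation drops
    have c1 : (∀ j, countLT X z₀ ≤ j → j < P → w j < w (j + 1)) ∨
        |l - rhoHat R α v u| + δ ≤ chainVar w (countLT X z₀) P := by
      rcases chain_cases hδ hpP (fun j hj => hmem j (by omega)) (fun j hj => hne j (by omega))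
        with c | c | c
      · exact Or.inl c
      · left
        intro j hj1 hj2
        exfalso
        have c' := c (P - 1) (by omega) (by omega)
        have hP1 : P - 1 + 1 = P := by omega
        refine hdouble (P - 1) (by omega) (by omega) ⟨c', ?_⟩
        have hP2 : P - 1 + 2 = P + 1 := by omega
        rw [hP1, hP2, h4, h5]
        exact hlt
      · right
        rwa [h4] at c
    have c2 : (∀ j, P + 1 ≤ j → j < countLE X z₀ → w j < w (j + 1)) ∨
        |rr - rhoCheck R α v u| + δ ≤ chainVar w (P + 1) (countLE X z₀) := by
      rcases chain_cases hδ hQc hmem hne with c | c | c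
      · exact Or.inl c
      · left
        intro j hj1 hj2
        exfalso
        refine hdouble P hpP (by omega) ⟨by rw [h4, h5]; exact hlt, ?_⟩
        exact c (P + 1) le_rfl (by omega)
      · right
        rwa [h5, abs_sub_comm] at c
    rcases c1 with c1 | c1
    swap
    · left; linarith
    rcases c2 with c2 | c2
    swap
    · left; linarith
    have v1 := chainVar_of_up hpP c1
    have v2 := chainVar_of_up hQc c2
    have hle1 := le_of_up c1 le_rfl hpP le_rfl
    have hle2 := le_of_up c2 le_rfl hQc le_rfl
    rw [h4] at v1 hle1
    rw [h5] at v2 hle2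
    -- Only shocks hit the undercompressive shock, so `l ≤ ρ̂`, `ρ̌ ≤ r`, and the incoming value is
    -- `(ρ̂ - l) + (r - ρ̌) - (ρ̂ - ρ̌) = r - l`.
    rw [v1, v2]
    rcases h'.vehicle with ⟨hnv, hc⟩ | ⟨hv1, hv2, hv3, hg, P', g1, g2, g3, g4, g5, g6⟩
    · rw [hl, hr] at hnv hc
      obtain ⟨s1, s2, s3, -⟩ := hc.spec hpq' hl hr hmem'
      have hlr : l ≤ rr := by rcases hnv with hnv | hnv <;> linarith
      rw [s1, abs_of_nonpos (by linarith : l - rr ≤ 0)]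
      rcases hγ' with hg | hg
      · right
        -- At most one shock leaves, while the incoming group contains at least the undercompressive
        -- front.
        refine ⟨by rw [hg]; ring, ?_⟩
        rcases hlr.eq_or_lt with he | he
        · have := s3 he; omega
        · have := s2 he; omega
      · left; linarith
    · right
      rw [hl] at hv1 g5
      rw [hr] at hv2 g6
      obtain ⟨s1, s2, s3, -⟩ := g5.spec g1 hl g3 fun j hj => hmem' j (hj.trans g2.le)
      obtain ⟨t1, t2, t3, -⟩ := g6.spec g2 g4 hr hmem'
      rw [chainVar_add w' g1 g2.le, chainVar_add w' (Nat.le_succ P') g2, chainVar_succ, s1, t1, g3,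
        g4, hg, abs_of_neg (by linarith : rhoCheck R α v u - rhoHat R α v u < 0),
        abs_of_nonpos (by linarith : l - rhoHat R α v u ≤ 0),
        abs_of_nonpos (by linarith : rhoCheck R α v u - rr ≤ 0)]
      refine ⟨by ring, ?_⟩
      have n1 : P' - countLT X' z₀ ≤ P - countLT X z₀ := by
        rcases hpP.eq_or_lt with he | he
        · have : l = rhoHat R α v u := by rw [← h4, ← he]
          have := s3 this
          omega
        · have : l < rhoHat R α v u := by rw [← h4]; exact lt_of_up he c1
          have := s2 this
          omega
      have n2 : countLE X' z₀ - (P' + 1) ≤ countLE X z₀ - (P + 1) := by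
        rcases hQc.eq_or_lt with he | he
        · have : rhoCheck R α v u = rr := by simp only [rr, ← h5, he]
          have := t3 this
          omega
        · have : rhoCheck R α v u < rr := by rw [← h5]; exact lt_of_up he c2
          have := t2 this
          omega
      omega

end Vehicle

/-! ### The functional across an interaction time -/

section Global

variable {R β B α : ℝ} {v : ℝ → ℝ} {M : Set ℝ} {δ : ℝ}

/-- Handles simultaneous events: no point contributes an increase, so one strict drop suffices;
without any, values are conserved pointwise and the wave counts add up. -/
theorem sum_add_le_or_eq {Z : Finset ℝ} {S S' : ℝ → ℝ} {m m' : ℝ → ℕ} (hδ : 0 ≤ δ)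
    (h : ∀ z ∈ Z, S' z + δ ≤ S z ∨ (S' z = S z ∧ m' z ≤ m z)) :
    ∑ z ∈ Z, S' z + δ ≤ ∑ z ∈ Z, S z ∨
      (∑ z ∈ Z, S' z = ∑ z ∈ Z, S z ∧ ∑ z ∈ Z, m' z ≤ ∑ z ∈ Z, m z) := by
  have hle : ∀ z ∈ Z, S' z ≤ S z := fun z hz => by
    rcases h z hz with h | ⟨h, -⟩ <;> linarith
  by_cases hex : ∃ z ∈ Z, S' z + δ ≤ S z
  · left
    obtain ⟨z, hz, hz'⟩ := hex
    have h1 := Finset.sum_le_sum fun x (hx : x ∈ Z.erase z) => hle x (Finset.mem_of_mem_erase hx)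
    rw [← Finset.add_sum_erase Z S hz, ← Finset.add_sum_erase Z S' hz]
    linarith
  · right
    push Not at hex
    have h2 : ∀ z ∈ Z, S' z = S z ∧ m' z ≤ m z := fun z hz =>
      (h z hz).resolve_left (not_le.2 (hex z hz))
    exact ⟨Finset.sum_congr rfl fun z hz => (h2 z hz).1, Finset.sum_le_sum fun z hz => (h2 z hz).2⟩

theorem card_eq_sum_groups {n : ℕ} {X : Fin n → ℝ} (hX : Monotone X) {Z : Finset ℝ}
    (hZ : ∀ j, X j ∈ Z) : n = ∑ z ∈ Z, (countLE X z - countLT X z) := by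
  have h := sum_range_eq_sum_groups hX hZ fun _ => 1
  simp only [Finset.sum_const, Finset.card_range, Nat.card_Ico, nsmul_eq_mul, mul_one] at h
  exact_mod_cast h

/-- The change of the functional at the common end of two stages, in terms of the chains of
states. -/
theorem IsIncoming.interaction {n n' : ℕ} {w w' : ℕ → ℝ} {X : Fin n → ℝ} {X' : Fin n' → ℝ}
    {r : ℝ → ℝ} {z₀ u u' γ γ' E : ℝ} {P Q : ℕ} (hδ0 : 0 ≤ δ) (hδ : IsSeparatedBy M δ)
    (hu : IsGridSpeed R α v M u) (hu' : IsGridSpeed R α v M u')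
    (h : IsIncoming R α v M r z₀ u w X P Q γ) (h' : IsOutgoing R α v M r z₀ u' w' X' γ')
    (hE : u ≠ u' → 3 * |rhoHat R α v u' - rhoHat R α v u| ≤ E ∧
      3 * |rhoCheck R α v u' - rhoCheck R α v u| ≤ E ∧
      δ ≤ |rhoHat R α v u' - rhoHat R α v u| ∧
      0 ≤ (rhoHat R α v u' - rhoHat R α v u) * (rhoCheck R α v u' - rhoCheck R α v u)) :
    (u = u' ∧ (chainVar w' 0 n' + γ' + δ ≤ chainVar w 0 n + γ ∨
      (chainVar w' 0 n' + γ' = chainVar w 0 n + γ ∧ n' ≤ n))) ∨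
    (u ≠ u' ∧ (chainVar w' 0 n' + γ' ≤ chainVar w 0 n + γ ∨
      chainVar w' 0 n' + γ' + δ ≤ chainVar w 0 n + γ + E)) := by
  classical
  set Z : Finset ℝ := insert z₀ (Finset.univ.image X ∪ Finset.univ.image X') with hZ
  have hz₀ : z₀ ∈ Z := Finset.mem_insert_self _ _
  have hXZ : ∀ j, X j ∈ Z := fun j => by simp [hZ]
  have hXZ' : ∀ j, X' j ∈ Z := fun j => by simp [hZ]
  have e1 : chainVar w 0 n = ∑ z ∈ Z, chainVar w (countLT X z) (countLE X z) := by
    rw [chainVar, ← Finset.range_eq_Ico]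
    exact sum_range_eq_sum_groups h.mono hXZ _
  have e2 : chainVar w' 0 n' = ∑ z ∈ Z, chainVar w' (countLT X' z) (countLE X' z) := by
    rw [chainVar, ← Finset.range_eq_Ico]
    exact sum_range_eq_sum_groups h'.mono hXZ' _
  have e3 := card_eq_sum_groups h.mono hXZ
  have e4 := card_eq_sum_groups h'.mono hXZ'
  by_cases huu : u = u'
  · subst huu
    refine Or.inl ⟨rfl, ?_⟩
    -- The term `γ` is charged to the summand of the vehicle's position.
    have e5 : ∀ c : ℝ, c = ∑ z ∈ Z, if z = z₀ then c else 0 := fun c => by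
      rw [Finset.sum_ite_eq' Z z₀, if_pos hz₀]
    rw [e1, e2, e5 γ, e5 γ', ← Finset.sum_add_distrib, ← Finset.sum_add_distrib]
    have key := sum_add_le_or_eq (Z := Z)
      (S := fun z => chainVar w (countLT X z) (countLE X z) + if z = z₀ then γ else 0)
      (S' := fun z => chainVar w' (countLT X' z) (countLE X' z) + if z = z₀ then γ' else 0)
      (m := fun z => countLE X z - countLT X z) (m' := fun z => countLE X' z - countLT X' z)
      hδ0 (fun z _ => by
        by_cases hz : z = z₀
        · subst hz
          simp only [if_true]
          exact h.vehicle_interaction hδ hu.check_le_hat hu.check_mem hu.hat_mem h'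
        · simp only [if_neg hz, add_zero]
          exact h.interaction_of_ne hδ h' hz)
    rw [← e3, ← e4] at key
    exact key
  · refine Or.inr ⟨huu, ?_⟩
    obtain ⟨hE1, hE2, hE3, hE4⟩ := hE huu
    have h1 := h.vehicle_jump hu.check_le_hat hu'.check_le_hat h' hE1 hE2 hE3 hE4
    have h2 : ∑ z ∈ Z.erase z₀, chainVar w' (countLT X' z) (countLE X' z) ≤
        ∑ z ∈ Z.erase z₀, chainVar w (countLT X z) (countLE X z) := by
      refine Finset.sum_le_sum fun z hz => ?_
      rcases h.interaction_of_ne hδ h' (Finset.ne_of_mem_erase hz) with h3 | h3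
      · linarith
      · exact h3.1.le
    rw [e1, e2, ← Finset.add_sum_erase Z _ hz₀, ← Finset.add_sum_erase Z _ hz₀]
    rcases h1 with h1 | h1
    · left; linarith
    · right; linarith

/-- Explains the weight `6/β`: it is three times the Lipschitz constant `2/β`. Two parts pay for the
moved shock and the third leaves a drop of at least one density gap. -/
theorem contact_jump_bounds (hF : FluxCondition R β B v) (hα0 : 0 < α) (hα1 : α < 1) {u u' : ℝ}
    (hu : u ∈ Icc 0 (maxSpeed R v)) (hu' : u' ∈ Icc 0 (maxSpeed R v)) (huu : u ≠ u') :
    rhoHat R α v u ≠ rhoHat R α v u' ∧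
      3 * |rhoHat R α v u' - rhoHat R α v u| ≤ 6 / β * |u' - u| ∧
      3 * |rhoCheck R α v u' - rhoCheck R α v u| ≤ 6 / β * |u' - u| ∧
      0 ≤ (rhoHat R α v u' - rhoHat R α v u) * (rhoCheck R α v u' - rhoCheck R α v u) := by
  have hβ := hF.beta_pos
  have key : ∀ a ∈ Icc 0 (maxSpeed R v), ∀ b ∈ Icc 0 (maxSpeed R v), a < b →
      rhoHat R α v b < rhoHat R α v a ∧ rhoCheck R α v b < rhoCheck R α v a ∧
      3 * (rhoHat R α v a - rhoHat R α v b) ≤ 6 / β * (b - a) ∧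
      3 * (rhoCheck R α v a - rhoCheck R α v b) ≤ 6 / β * (b - a) := by
    intro a ha b hb hab
    have h1 := rhoHat_sub_le hF hα0 hα1 ha hb hab
    have h2 := rhoCheck_sub_le hF hα0 hα1 ha hb hab
    refine ⟨rhoHat_strictAntiOn hF hα0 hα1 ha hb hab, rhoCheck_strictAntiOn hF hα0 hα1 ha hb hab,
      ?_, ?_⟩
    · rw [div_mul_eq_mul_div, le_div_iff₀ hβ]; linarith
    · rw [div_mul_eq_mul_div, le_div_iff₀ hβ]; linarith
  rcases huu.lt_or_gt with h | h
  · obtain ⟨h1, h2, h3, h4⟩ := key u hu u' hu' h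
    rw [abs_of_neg (sub_neg.2 h1), abs_of_neg (sub_neg.2 h2), abs_of_pos (sub_pos.2 h)]
    exact ⟨h1.ne', by linarith, by linarith, (mul_pos_of_neg_of_neg (sub_neg.2 h1) (sub_neg.2 h2)).le⟩
  · obtain ⟨h1, h2, h3, h4⟩ := key u' hu' u hu h
    rw [abs_of_pos (sub_pos.2 h1), abs_of_pos (sub_pos.2 h2), abs_of_neg (sub_neg.2 h)]
    exact ⟨h1.ne, by linarith, by linarith, (mul_pos (sub_pos.2 h1) (sub_pos.2 h2)).le⟩

/-- An instant of the construction lies inside a stage, or two stages meet there. -/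
theorem IsWaveFrontTracking.exists_stage {T : ℝ} {ρ : ℝ → ℝ → ℝ} {y u : ℝ → ℝ}
    (h : IsWaveFrontTracking R α v M T ρ y u) {t₀ : ℝ} (h0 : 0 < t₀) (hT : t₀ < T) :
    ∃ a b, 0 ≤ a ∧ a < t₀ ∧ IsStage R α v M ρ y u a b ∧
      (t₀ < b ∨ (t₀ = b ∧ ∃ c, t₀ < c ∧ IsStage R α v M ρ y u t₀ c)) := by
  classical
  obtain ⟨m, τ, hτ, hτ0, hτT, hst⟩ := h
  have hne : (Finset.univ.filter fun i => τ i < t₀).Nonempty :=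
    ⟨0, by simp [hτ0, h0]⟩
  obtain ⟨i, hi, himax⟩ := Finset.exists_max_image _ id hne
  simp only [Finset.mem_filter, Finset.mem_univ, true_and, id] at hi himax
  have hil : i ≠ Fin.last m := by
    rintro rfl
    rw [hτT] at hi
    linarith
  obtain ⟨k, rfl⟩ := Fin.exists_castSucc_eq.2 hil
  have hk : t₀ ≤ τ k.succ := by
    by_contra hcon
    have := himax k.succ (not_le.1 hcon)
    exact absurd this (not_le.2 k.castSucc_lt_succ)
  refine ⟨τ k.castSucc, τ k.succ, ?_, hi, hst k, ?_⟩
  · rw [← hτ0]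
    exact hτ.monotone (Fin.zero_le _)
  · rcases hk.lt_or_eq with hlt | heq
    · exact Or.inl hlt
    · have hkl : k.succ ≠ Fin.last m := by
        intro hl
        rw [hl, hτT] at heq
        linarith
      obtain ⟨k', hk'⟩ := Fin.exists_castSucc_eq.2 hkl
      refine Or.inr ⟨heq, τ k'.succ, ?_, ?_⟩
      · rw [heq, ← hk']
        exact hτ k'.castSucc_lt_succ
      · rw [heq, ← hk']
        exact hst k'

end Global

end MovingBottleneck

/-! ### Proof of the proposition. -/

open MovingBottleneck in
theorem proposition3p3 {R β B α : ℝ} {v : ℝ → ℝ}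
    (hF : MovingBottleneck.FluxCondition R β B v) (hα0 : 0 < α) (hα1 : α < 1)
    {ν J : ℕ} (hν : 1 ≤ ν)
    (hJ : MovingBottleneck.maxSpeed R v - MovingBottleneck.gridSpeed R α v ν 0 (J + 1)
      < 1 / 2 ^ ν)
    {T : ℝ} {ρ : ℝ → ℝ → ℝ} {y u : ℝ → ℝ}
    (hu : MovingBottleneck.IsStepControl (MovingBottleneck.speedGrid R α v ν J) u)
    (hρ : MovingBottleneck.IsWaveFrontTracking R α v
      (MovingBottleneck.densityGrid R α v ν J) T ρ y u)
    {t₀ : ℝ} (ht₀ : 0 < t₀) (ht₀T : t₀ < T) :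
    ∃ (Υm Υp : ℝ) (Nm Np : ℕ),
      (∀ᶠ t in 𝓝[<] t₀, MovingBottleneck.glimm R α β v ρ y u t = Υm ∧
        MovingBottleneck.waveCount ρ t = Nm) ∧
      (∀ᶠ t in 𝓝[>] t₀, MovingBottleneck.glimm R α β v ρ y u t = Υp ∧
        MovingBottleneck.waveCount ρ t = Np) ∧
      (Υp ≤ Υm - min (MovingBottleneck.minGap (MovingBottleneck.densityGrid R α v ν J))
          (6 * MovingBottleneck.minGap (MovingBottleneck.speedGrid R α v ν J) / β) ∨
        (Υp = Υm ∧ Np ≤ Nm)) := by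
  have hβ := hF.beta_pos
  have hM : (densityGrid R α v ν J).Finite := finite_densityGrid ν J
  have hMR := densityGrid_subset hF hα0 hα1 (ν := ν) (J := J)
  have hU : (speedGrid R α v ν J).Finite := finite_speedGrid ν J
  have hgrid : ∀ t, 0 ≤ t → IsGridSpeed R α v (densityGrid R α v ν J) (u t) := fun t ht =>
    isGridSpeed hF hα0 hα1 hν (hu.mem t ht)
  obtain ⟨a, b, ha, hat, hab, hcase⟩ := hρ.exists_stage ht₀ ht₀T
  have hb : t₀ ≤ b := by rcases hcase with h | ⟨h, -⟩ <;> linarith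
  obtain ⟨n, w, Xa, Xb, P, Q, γ, -, hin, hdesc⟩ :=
    hab.description hF hM hMR (hat.trans_le hb) (hgrid a ha)
  -- the functional during the stage that contains the times just before `t₀`
  have hbefore : ∀ t ∈ Ioo a b, glimm R α β v ρ y u t = ∑ j ∈ Finset.range n, |w (j + 1) - w j| +
      2 * R + γ + 6 / β * (|u b - u a| + (eVariationOn u (Ici b)).toReal) ∧
      waveCount ρ t = n := by
    intro t ht
    obtain ⟨h1, h2, h3⟩ := hdesc t ht
    -- The jump of the control at the end of the stage belongs to the variation on `[t,∞)` for every
    -- earlier `t`, so this term is constant before `b` and drops by `|u b - u a|` there.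
    have h4 := hu.toReal_eVariationOn_Ici hU (ha.trans ht.1.le) ht.2
      fun s hs => hab.control_const s ⟨ht.1.le.trans hs.1, hs.2⟩
    exact ⟨by rw [glimm, h1, h3, h4], h2⟩
  rcases hcase with hlt | ⟨rfl, c, hc, hac⟩
  · exact ⟨_, _, n, n, Filter.eventually_of_mem (Ioo_mem_nhdsLT hat)
        fun t ht => hbefore t ⟨ht.1, ht.2.trans hlt⟩,
      Filter.eventually_of_mem (Ioo_mem_nhdsGT hlt)
        fun t ht => hbefore t ⟨hat.trans ht.1, ht.2⟩, Or.inr ⟨rfl, le_rfl⟩⟩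
  obtain ⟨n', w', Xa', Xb', P', Q', γ', hout, -, hdesc'⟩ :=
    hac.description hF hM hMR hc (hgrid t₀ ht₀.le)
  have hafter : ∀ t ∈ Ioo t₀ c, glimm R α β v ρ y u t =
      ∑ j ∈ Finset.range n', |w' (j + 1) - w' j| + 2 * R + γ' +
      6 / β * (eVariationOn u (Ici t₀)).toReal ∧ waveCount ρ t = n' := by
    intro t ht
    obtain ⟨h1, h2, h3⟩ := hdesc' t ht
    have h4 := hu.toReal_eVariationOn_Ici hU ht₀.le ht.1
      fun s hs => hac.control_const s ⟨hs.1, hs.2.trans ht.2⟩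
    rw [hac.control_const t ⟨ht.1.le, ht.2⟩, sub_self, abs_zero, zero_add] at h4
    exact ⟨by rw [glimm, h1, h3, h4], h2⟩
  refine ⟨_, _, n, n', Filter.eventually_of_mem (Ioo_mem_nhdsLT hat) hbefore,
    Filter.eventually_of_mem (Ioo_mem_nhdsGT hc) hafter, ?_⟩
  have hsep : IsSeparatedBy (densityGrid R α v ν J) (minGap (densityGrid R α v ν J)) := by
    intro p hp q hq hpq
    have := minGap_le hp hq hpq.ne
    rwa [abs_of_pos (sub_pos.2 hpq)] at this
  have huM := speedGrid_subset hF hα0 hα1 (hu.mem a ha)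
  have huM' := speedGrid_subset hF hα0 hα1 (hu.mem t₀ ht₀.le)
  have hmain := hin.interaction (E := 6 / β * |u t₀ - u a|) (minGap_nonneg _) hsep (hgrid a ha)
    (hgrid t₀ ht₀.le) hout (fun hne => by
      obtain ⟨h1, h2, h3, h4⟩ := contact_jump_bounds hF hα0 hα1 huM huM' hne
      exact ⟨h2, h3, minGap_le (hgrid a ha).hat_mem (hgrid t₀ ht₀.le).hat_mem h1, h4⟩)
  simp only [chainVar, ← Finset.range_eq_Ico] at hmain
  have hmin1 := min_le_left (minGap (densityGrid R α v ν J))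
    (6 * minGap (speedGrid R α v ν J) / β)
  have hmin2 := min_le_right (minGap (densityGrid R α v ν J))
    (6 * minGap (speedGrid R α v ν J) / β)
  rcases hmain with ⟨heq, h | ⟨h, hn⟩⟩ | ⟨hne, h | h⟩
  · left
    rw [heq, sub_self, abs_zero]
    linarith
  · right
    rw [heq, sub_self, abs_zero]
    exact ⟨by linarith, hn⟩
  · left
    -- The density part does not increase, so the whole jump of the control, at least one gap of the
    -- speed grid, is gained.
    have h1 := minGap_le (hu.mem a ha) (hu.mem t₀ ht₀.le) hne
    have h2 : 6 * minGap (speedGrid R α v ν J) / β ≤ 6 / β * |u t₀ - u a| := by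
      rw [div_mul_eq_mul_div]
      gcongr
    linarith
  -- Here the allowance `E` is exactly the amount released by the control term, and the drop `δ_ρ`
  -- remains.
  · left
    linarith
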